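/- **Execution graphs.** Events have an identifier, a thread (or are initialisation events), a transaction identifier ($0$ outside transactions) and a label: a read $\mathtt R\,x\,v$, a write $\mathtt W\,x\,v$, an update $\mathtt U\,x\,v\,v'$, or a call to the lock of a location $x$: $\mathtt{RL}\,x,\mathtt{RU}\,x$ (acquire/release in reader mode), $\mathtt{WL}\,x,\mathtt{WU}\,x$ (acquire/release in writer mode), $\mathtt{PL}\,x$ (promotion from reader to writer mode). *Reader calls* are $\mathtt{RL},\mathtt{RU}$; *writer calls* are $\mathtt{WL},\mathtt{WU},\mathtt{PL}$. An execution graph consists of a set $E$ of events with one initialisation write of $0$ per location, and relations $\mathsf{po}$ (initialisation events first, then a strict total order per thread; transactions are contiguous and contain only reads and writes), $\mathsf{rf}$ (from exactly one write to each read, with the same location and value), $\mathsf{mo}$ (a strict total order on the writes to each location, with the initialisation write first) and $\mathsf{lo}$ (a strict partial order on the lock events of each location). Put $\mathsf{rb}=(\mathsf{rf}^{-1};\mathsf{mo})\setminus\mathrm{id}$, let $\mathsf{st}$ be the relation "same transaction", and for a relation $r$ let $r_{\mathsf I}=r\cap\mathsf{st}$ and $r_{\mathsf T}=\mathsf{st};(r\setminus\mathsf{st});\mathsf{st}$.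 * A graph is *SI-consistent* if $\mathsf{rf}_{\mathsf I}\cup\mathsf{mo}_{\mathsf I}\cup\mathsf{rb}_{\mathsf I}\subseteq\mathsf{po}$ and $(\mathsf{po}_{\mathsf T}\cup\mathsf{rf}_{\mathsf T}\cup\mathsf{mo}_{\mathsf T});\mathsf{rb}_{\mathsf T}^{?}$ is acyclic. * A graph is *RA-consistent* if, with $\mathsf{hb}=(\mathsf{po}\cup\mathsf{rf}\cup\mathsf{lo})^+$, the relation $\mathsf{hb}|_{loc}\cup\mathsf{mo}\cup\mathsf{rb}$ is acyclic and: any writer call is $\mathsf{lo}$-related to every other call to the same lock; if $(a,b)\in\mathsf{lo}$ and $a$ is a $\mathtt{WL}$ or $\mathtt{PL}$, then some $\mathtt{WU}$ of that lock is $\mathsf{po}$-after $a$ and equal to or $\mathsf{lo}$-before $b$; if $(a,b)\in\mathsf{lo}$, $a$ is an $\mathtt{RL}$ and $b$ is a writer call, then some $\mathtt{RU}$ or $\mathtt{PL}$ of that lock is $\mathsf{po}$-after $a$ and equal to or $\mathsf{lo}$-before $b$. **Programs.** A transactional program $P$ assigns to each of finitely many threads sequential code (local assignments, sequencing, conditionals,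 loops, transactions), over finitely many shared locations, all shared accesses being inside transactions; a transaction body $T$ consists of local assignments, reads $r:=x$, writes $x:=e$, sequencing, conditionals and loops. Each transaction is supplied with a read set $\mathtt{RS}$ and a write set $\mathtt{WS}$. The sets *cover* $P$ if, in every run of a transaction, every location that is read before being written is in $\mathtt{RS}$ and every location written is in $\mathtt{WS}$; they are *exact* if moreover every location of $\mathtt{RS}$ is read and every location of $\mathtt{WS}$ is written in every such run. The outcome of an execution is the tuple of final values of the local variables of all threads (initially $0$). $\mathrm{outcomes}(P,M)$ is the set of outcomes of the $M$-consistent execution graphs of (terminating runs of) $P$. **Implementations.** Each of them turns every transaction into non-transactional code; a thread-local array $s$ serves as a snapshot. * *Eager, prescient* $P_{\mathrm e}$: (start) acquire the reader locks of $\mathtt{RS}\cup\mathtt{WS}$; record the values of $\mathtt{RS}$ in $s$; release the reader locks of $\mathtt{RS}\setminus\mathtt{WS}$; promote the locks of $\mathtt{WS}$ one by one. If a promotion fails, release the writer locks obtained so far and the remaining reader locks of $\mathtt{WS}$, and go back to start. Then run $T$, where $r:=x$ becomes $r:=s[x]$ and $x:=e$ writes $e$ to $x$ and to $s[x]$. Finally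 release the writer locks of $\mathtt{WS}$. * *Lazy, non-prescient* $P_{\mathrm l}$ (it ignores the supplied sets): (start) clear $s$ and set $\mathtt{RS}=\mathtt{WS}=\emptyset$; run $T$, where $r:=x$ first, if $x\notin\mathtt{RS}\cup\mathtt{WS}$, acquires the reader lock of $x$, adds $x$ to $\mathtt{RS}$ and records the value of $x$ in $s[x]$, and then performs $r:=s[x]$; and $x:=e$ acquires the reader lock of $x$ if $x\notin\mathtt{RS}\cup\mathtt{WS}$, adds $x$ to $\mathtt{WS}$ and sets $s[x]:=e$. Then release the reader locks of $\mathtt{RS}\setminus\mathtt{WS}$ and promote the locks of $\mathtt{WS}$, with the same handling of failures (the local variables are restored before going back to start); write $s[x]$ to $x$ for all $x\in\mathtt{WS}$; release the writer locks of $\mathtt{WS}$. **Theorem.** Let $P$ be a transactional program. 1. If the supplied sets are exact, then $\mathrm{outcomes}(P_{\mathrm e},\mathrm{RA})=\mathrm{outcomes}(P,\mathrm{SI})$. Without assumption, $\mathrm{outcomes}(P_{\mathrm l},\mathrm{RA})=\mathrm{outcomes}(P,\mathrm{SI})$. 2. (Soundness.) For every RA-consistent execution graph of $P_{\mathrm l}$,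 and, if the supplied sets cover $P$, for every RA-consistent execution graph of $P_{\mathrm e}$, there is an SI-consistent execution graph of $P$ with the same outcome. 3. (Completeness.) Let $H$ be an SI-consistent execution graph of $P$. There is a strict total order $\mathsf{TCO}$ on its transactions that extends the transaction dependency order $\big(\mathsf{rb}_{\mathsf T}^{?};(\mathsf{po}_{\mathsf T}\cup\mathsf{mo}_{\mathsf T}\cup\mathsf{rf}_{\mathsf T})\big)^+$. For every such $\mathsf{TCO}$, there are an execution graph of $P_{\mathrm l}$ and, if the supplied sets are exact, an execution graph of $P_{\mathrm e}$, with the same outcome as $H$, in which each transaction $\xi$ of $H$ owns, for each location $x$ that it accesses, exactly one $\mathtt{RL}\,x$, and exactly one $\mathtt{PL}\,x$ and one $\mathtt{WU}\,x$ if it writes to $x$, exactly one $\mathtt{RU}\,x$ if it does not, and in which there are no other lock events, such that the graph is RA-consistent for each of the following two lock orders. For a location $x$, say that $\xi$ belongs to phase $i\ge 0$ of $x$ if $\xi$ is the $i$-th writer of $x$ in $\mathsf{TCO}$ (counted from $0$), or $\xi$ reads $x$ from the $(i-1)$-st writer, another transaction (from the initialisation write if $i=0$). Let $a,b$ be lock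 events of $x$ owned by transactions $\xi,\zeta$ of phases $i,k$. * The order generated (by transitive closure) by the edges $\mathsf{LO}$: $(a,b)\in\mathsf{LO}$ if $a$ is a writer call and $i<k$; or $\xi=\zeta$, $a=\mathtt{PL}\,x$ and $b=\mathtt{WU}\,x$; or $a$ is a reader call, $b$ is a writer call and $i\le k$. * The order consisting of the edges $\mathsf{LO}$ and, between reader calls $a,b$, the edges with $i<k$; or $i=k$ and $(\xi,\zeta)\in\mathsf{TCO}$; or $\xi=\zeta$, $a=\mathtt{RL}\,x$ and $b=\mathtt{RU}\,x$. For this order, any two distinct reader calls to the same lock are also related. -/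

import Mathlib

namespace SnapIso

/-! ### Events and execution graphs -/

/-- Event labels: reads, writes, atomic updates, and the five kinds of lock events (reader lock
acquisition and release, writer lock acquisition and release, promotion of a reader lock). -/
inductive Label (Loc Val : Type*) where
  | R (x : Loc) (v : Val)
  | W (x : Loc) (v : Val)
  | U (x : Loc) (vr vw : Val)
  | RL (x : Loc)
  | RU (x : Loc)
  | WL (x : Loc)
  | WU (x : Loc)
  | PL (x : Loc)

namespace Label

variable {Loc Val : Type*}

def loc : Label Loc Val → Loc
  | R x _ => x
  | W x _ => x
  | U x _ _ => x
  | RL x => x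
  | RU x => x
  | WL x => x
  | WU x => x
  | PL x => x

/-- The value read, for reads and updates. -/
def valR : Label Loc Val → Option Val
  | R _ v => some v
  | U _ v _ => some v
  | _ => none

/-- The value written, for writes and updates. -/
def valW : Label Loc Val → Option Val
  | W _ v => some v
  | U _ _ v => some v
  | _ => none

def IsRead (l : Label Loc Val) : Prop := l.valR ≠ none

def IsWrite (l : Label Loc Val) : Prop := l.valW ≠ none

/-- Lock events of reader kind: acquisition or release of a reader lock. -/
def IsRLock (l : Label Loc Val) : Prop := l = RL l.loc ∨ l = RU l.loc

/-- Lock events of writer kind: acquisition or release of a writer lock, or promotion. -/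
def IsWLock (l : Label Loc Val) : Prop := l = WL l.loc ∨ l = WU l.loc ∨ l = PL l.loc

def IsLock (l : Label Loc Val) : Prop := l.IsRLock ∨ l.IsWLock

end Label

/-- An event: identifier, thread (`none` for initialisation events), transaction identifier
(`0` for events outside transactions) and label. -/
structure Event (Tid Loc Val : Type*) where
  id : ℕ
  tid : Option Tid
  tx : ℕ
  lab : Label Loc Val

def Event.loc {Tid Loc Val : Type*} (e : Event Tid Loc Val) : Loc := e.lab.loc

/-- The data of an execution graph: events, program order, reads-from, modification order and
lock order. -/
structure ExecGraph (Tid Loc Val : Type*) where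
  E : Set (Event Tid Loc Val)
  po : Event Tid Loc Val → Event Tid Loc Val → Prop
  rf : Event Tid Loc Val → Event Tid Loc Val → Prop
  mo : Event Tid Loc Val → Event Tid Loc Val → Prop
  lo : Event Tid Loc Val → Event Tid Loc Val → Prop

def Acyclic {α : Type*} (r : α → α → Prop) : Prop := ∀ a, ¬ Relation.TransGen r a a

namespace ExecGraph

variable {Tid Loc Val : Type*}

/-- The well-formedness conditions of execution graphs. -/
structure WF [Zero Val] (G : ExecGraph Tid Loc Val) : Prop where
  /-- Initialisation events are non-transactional writes of `0`. -/
  init_lab : ∀ e ∈ G.E, e.tid = none → e.tx = 0 ∧ ∃ x, e.lab = .W x 0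
  /-- There is exactly one initialisation event per location. -/
  init_unique : ∀ x, ∃! e, e ∈ G.E ∧ e.tid = none ∧ e.lab = .W x 0
  /-- Only reads and writes occur in transactions. -/
  tx_lab : ∀ e ∈ G.E, e.tx ≠ 0 → ∃ x v, e.lab = .R x v ∨ e.lab = .W x v
  /-- `po` orders initialisation events before all others, and is otherwise a disjoint union of
  strict total orders, one for each thread. -/
  po_mem : ∀ a b, G.po a b → a ∈ G.E ∧ b ∈ G.E
  po_thread : ∀ a b, G.po a b → b.tid ≠ none ∧ (a.tid = none ∨ a.tid = b.tid)
  po_init : ∀ a ∈ G.E, ∀ b ∈ G.E, a.tid = none → b.tid ≠ none → G.po a b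
  po_irrefl : ∀ a, ¬ G.po a a
  po_trans : ∀ a b c, G.po a b → G.po b c → G.po a c
  po_total : ∀ a ∈ G.E, ∀ b ∈ G.E, a.tid = b.tid → a.tid ≠ none → a ≠ b → G.po a b ∨ G.po b a
  /-- The events of a transaction are ordered by `po`, contiguously. -/
  po_tx_total : ∀ a ∈ G.E, ∀ b ∈ G.E, a.tx ≠ 0 → a.tx = b.tx → a ≠ b → G.po a b ∨ G.po b a
  po_tx_between : ∀ a b c, a.tx ≠ 0 → a.tx = c.tx → G.po a b → G.po b c → b.tx = a.tx
  /-- `rf` relates a write and a read of the same location with matching values; every read is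
  related to exactly one write. -/
  rf_mem : ∀ a b, G.rf a b → a ∈ G.E ∧ b ∈ G.E
  rf_val : ∀ a b, G.rf a b → a.loc = b.loc ∧ ∃ v, a.lab.valW = some v ∧ b.lab.valR = some v
  rf_unique : ∀ b ∈ G.E, b.lab.IsRead → ∃! a, G.rf a b
  /-- `mo` is a disjoint union of strict total orders, one on the writes to each location, with
  the initialisation write first. -/
  mo_mem : ∀ a b, G.mo a b → a ∈ G.E ∧ b ∈ G.E
  mo_write : ∀ a b, G.mo a b → a.lab.IsWrite ∧ b.lab.IsWrite ∧ a.loc = b.loc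
  mo_irrefl : ∀ a, ¬ G.mo a a
  mo_trans : ∀ a b c, G.mo a b → G.mo b c → G.mo a c
  mo_total : ∀ a ∈ G.E, ∀ b ∈ G.E, a.lab.IsWrite → b.lab.IsWrite → a.loc = b.loc → a ≠ b →
    G.mo a b ∨ G.mo b a
  mo_init : ∀ a ∈ G.E, ∀ b ∈ G.E, a.tid = none → b.tid ≠ none → b.lab.IsWrite → a.loc = b.loc →
    G.mo a b
  /-- `lo` is a disjoint union of strict partial orders, one on the lock events of each
  location. -/
  lo_mem : ∀ a b, G.lo a b → a ∈ G.E ∧ b ∈ G.E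
  lo_lock : ∀ a b, G.lo a b → a.lab.IsLock ∧ b.lab.IsLock ∧ a.loc = b.loc
  lo_irrefl : ∀ a, ¬ G.lo a a
  lo_trans : ∀ a b c, G.lo a b → G.lo b c → G.lo a c

/-- Same transaction. -/
def st (G : ExecGraph Tid Loc Val) (a b : Event Tid Loc Val) : Prop :=
  a ∈ G.E ∧ b ∈ G.E ∧ a.tx ≠ 0 ∧ a.tx = b.tx

/-- Reads-before: `(rf⁻¹ ; mo)` minus the identity. -/
def rb (G : ExecGraph Tid Loc Val) (a b : Event Tid Loc Val) : Prop :=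
  a ≠ b ∧ ∃ w, G.rf w a ∧ G.mo w b

/-- Restriction of a relation to edges within a transaction. -/
def intra (G : ExecGraph Tid Loc Val) (r : Event Tid Loc Val → Event Tid Loc Val → Prop)
    (a b : Event Tid Loc Val) : Prop :=
  r a b ∧ G.st a b

/-- Lifting of a relation to transactions: `st ; (r \ st) ; st`. -/
def lift (G : ExecGraph Tid Loc Val) (r : Event Tid Loc Val → Event Tid Loc Val → Prop)
    (a b : Event Tid Loc Val) : Prop :=
  ∃ c d, G.st a c ∧ (r c d ∧ ¬ G.st c d) ∧ G.st d b

/-- Dependencies between transactions: the union of lifted `po`, `rf` and `mo`. -/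
def dep (G : ExecGraph Tid Loc Val) (a b : Event Tid Loc Val) : Prop :=
  G.lift G.po a b ∨ G.lift G.rf a b ∨ G.lift G.mo a b

/-- SI-consistency. -/
structure SIConsistent (G : ExecGraph Tid Loc Val) : Prop where
  int : ∀ a b, G.intra G.rf a b ∨ G.intra G.mo a b ∨ G.intra G.rb a b → G.po a b
  ext : Acyclic fun a b => ∃ c, G.dep a c ∧ (c = b ∨ G.lift G.rb c b)

/-- Happens-before of the release/acquire model with locks. -/
def hb (G : ExecGraph Tid Loc Val) : Event Tid Loc Val → Event Tid Loc Val → Prop :=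
  Relation.TransGen fun a b => G.po a b ∨ G.rf a b ∨ G.lo a b

/-- RA-consistency of graphs with multiple-readers-single-writer lock events. -/
structure RAConsistent (G : ExecGraph Tid Loc Val) : Prop where
  acyclic : Acyclic fun a b => (G.hb a b ∧ a.loc = b.loc) ∨ G.mo a b ∨ G.rb a b
  /-- Calls to writer locks synchronise with all calls to the same lock. -/
  wsync : ∀ a ∈ G.E, ∀ b ∈ G.E, a.lab.IsWLock → b.lab.IsLock → a.loc = b.loc → a ≠ b →
    G.lo a b ∨ G.lo b a
  /-- A lock held in writer mode has to be released before any later call to the same lock. -/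
  wex : ∀ a b, G.lo a b → (a.lab = .WL a.loc ∨ a.lab = .PL a.loc) →
    ∃ u ∈ G.E, u.lab = .WU a.loc ∧ G.po a u ∧ (u = b ∨ G.lo u b)
  /-- A lock held in reader mode has to be released, or promoted by its holder, before any later
  writer call to the same lock. -/
  rshared : ∀ a b, G.lo a b → a.lab = .RL a.loc → b.lab.IsWLock →
    ∃ u ∈ G.E, (u.lab = .RU a.loc ∨ u.lab = .PL a.loc) ∧ G.po a u ∧ (u = b ∨ G.lo u b)

/-- The additional property of lock libraries in which any two reader calls to the same lock
synchronise as well. -/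
def RSync (G : ExecGraph Tid Loc Val) : Prop :=
  ∀ a ∈ G.E, ∀ b ∈ G.E, a.lab.IsRLock → b.lab.IsRLock → a.loc = b.loc → a ≠ b →
    G.lo a b ∨ G.lo b a

/-- For every thread `τ`, the events of `τ` listed in program order carry the transaction
identifiers and labels `tr τ`. -/
def HasThreads (G : ExecGraph Tid Loc Val) (tr : Tid → List (ℕ × Label Loc Val)) : Prop :=
  ∃ es : Tid → List (Event Tid Loc Val), ∀ τ,
    (es τ).Pairwise G.po ∧
    (∀ e, e ∈ es τ ↔ e ∈ G.E ∧ e.tid = some τ) ∧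
    (es τ).map (fun e => (e.tx, e.lab)) = tr τ

end ExecGraph

/-! ### Transactional programs and their SI executions -/

/-- Bodies of transactions. `rd r x` is `r := x` for a shared location `x` and a local variable
`r`; `wr x e` is `x := e` for a local expression `e`. -/
inductive Body (Reg Loc Val : Type*) where
  | skip
  | assign (r : Reg) (e : (Reg → Val) → Val)
  | rd (r : Reg) (x : Loc)
  | wr (x : Loc) (e : (Reg → Val) → Val)
  | seq (c d : Body Reg Loc Val)
  | cond (b : (Reg → Val) → Prop) (c d : Body Reg Loc Val)
  | loop (b : (Reg → Val) → Prop) (c : Body Reg Loc Val)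

/-- Code of a thread without non-transactional accesses. `tx T rs ws` is the transaction with body
`T`, supplied with a read set `rs` and a write set `ws` (used only by the eager
implementation). -/
inductive Prog (Reg Loc Val : Type*) where
  | skip
  | assign (r : Reg) (e : (Reg → Val) → Val)
  | seq (c d : Prog Reg Loc Val)
  | cond (b : (Reg → Val) → Prop) (c d : Prog Reg Loc Val)
  | loop (b : (Reg → Val) → Prop) (c : Prog Reg Loc Val)
  | tx (T : Body Reg Loc Val) (rs ws : Finset Loc)

section Source

variable {Tid Reg Loc Val : Type*} [DecidableEq Reg]

/-- `BRun T σ t σ'`: from the local variables `σ`, the body `T` can terminate with `σ'` and the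
sequence `t` of accesses, where the values read are unconstrained. -/
inductive BRun :
    Body Reg Loc Val → (Reg → Val) → List (Label Loc Val) → (Reg → Val) → Prop where
  | skip (σ) : BRun .skip σ [] σ
  | assign (r e σ) : BRun (.assign r e) σ [] (Function.update σ r (e σ))
  | rd (r x v σ) : BRun (.rd r x) σ [.R x v] (Function.update σ r v)
  | wr (x e σ) : BRun (.wr x e) σ [.W x (e σ)] σ
  | seq {c d σ₁ σ₂ σ₃ t₁ t₂} : BRun c σ₁ t₁ σ₂ → BRun d σ₂ t₂ σ₃ →
      BRun (.seq c d) σ₁ (t₁ ++ t₂) σ₃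
  | cond_true {b c d σ σ' t} : b σ → BRun c σ t σ' → BRun (.cond b c d) σ t σ'
  | cond_false {b c d σ σ' t} : ¬ b σ → BRun d σ t σ' → BRun (.cond b c d) σ t σ'
  | loop_false {b c σ} : ¬ b σ → BRun (.loop b c) σ [] σ
  | loop_true {b c σ₁ σ₂ σ₃ t₁ t₂} : b σ₁ → BRun c σ₁ t₁ σ₂ → BRun (.loop b c) σ₂ t₂ σ₃ →
      BRun (.loop b c) σ₁ (t₁ ++ t₂) σ₃

/-- Terminating runs of the code of a thread, with the list of the access sequences of the
transactions executed. -/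
inductive PRun :
    Prog Reg Loc Val → (Reg → Val) → List (List (Label Loc Val)) → (Reg → Val) → Prop where
  | skip (σ) : PRun .skip σ [] σ
  | assign (r e σ) : PRun (.assign r e) σ [] (Function.update σ r (e σ))
  | seq {c d σ₁ σ₂ σ₃ t₁ t₂} : PRun c σ₁ t₁ σ₂ → PRun d σ₂ t₂ σ₃ →
      PRun (.seq c d) σ₁ (t₁ ++ t₂) σ₃
  | cond_true {b c d σ σ' t} : b σ → PRun c σ t σ' → PRun (.cond b c d) σ t σ'
  | cond_false {b c d σ σ' t} : ¬ b σ → PRun d σ t σ' → PRun (.cond b c d) σ t σ'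
  | loop_false {b c σ} : ¬ b σ → PRun (.loop b c) σ [] σ
  | loop_true {b c σ₁ σ₂ σ₃ t₁ t₂} : b σ₁ → PRun c σ₁ t₁ σ₂ → PRun (.loop b c) σ₂ t₂ σ₃ →
      PRun (.loop b c) σ₁ (t₁ ++ t₂) σ₃
  | tx {T rs ws σ σ' t} : BRun T σ t σ' → PRun (.tx T rs ws) σ [t] σ'

/-- `G` is an execution graph of the transactional program `P` (one piece of code per thread, all
local variables initially `0`) with outcome `out`, the final values of the local variables.
Transactions executed receive pairwise distinct nonzero identifiers `txid τ k`. -/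
def SIExec [Zero Val] (P : Tid → Prog Reg Loc Val) (G : ExecGraph Tid Loc Val)
    (out : Tid → Reg → Val) : Prop :=
  G.WF ∧ ∃ (blocks : Tid → List (List (Label Loc Val))) (txid : Tid → ℕ → ℕ),
    (∀ τ k, txid τ k ≠ 0) ∧
    (∀ τ k τ' k', txid τ k = txid τ' k' → τ = τ' ∧ k = k') ∧
    (∀ τ, PRun (P τ) (fun _ => 0) (blocks τ) (out τ)) ∧
    G.HasThreads fun τ => (blocks τ).zipIdx.flatMap fun p => p.1.map fun l => (txid τ p.2, l)

def SIOutcomes [Zero Val] (P : Tid → Prog Reg Loc Val) : Set (Tid → Reg → Val) :=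
  {out | ∃ G, SIExec P G out ∧ G.SIConsistent}

def readsOf (t : List (Label Loc Val)) : Set Loc := {x | ∃ v, Label.R x v ∈ t}

def writesOf (t : List (Label Loc Val)) : Set Loc := {x | ∃ v, Label.W x v ∈ t}

/-- Locations that are read before they are written. -/
def readsFirst (t : List (Label Loc Val)) : Set Loc :=
  {x | ∃ t₁ v t₂, t = t₁ ++ Label.R x v :: t₂ ∧ x ∉ writesOf t₁}

/-- A property holds of all transactions in a program. -/
def Prog.AllTx (p : Body Reg Loc Val → Finset Loc → Finset Loc → Prop) : Prog Reg Loc Val → Prop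
  | .skip => True
  | .assign _ _ => True
  | .seq c d => c.AllTx p ∧ d.AllTx p
  | .cond _ c d => c.AllTx p ∧ d.AllTx p
  | .loop _ c => c.AllTx p
  | .tx T rs ws => p T rs ws

/-- The read and write sets supplied with transactions are over-approximations. -/
def Prog.SetsCover (c : Prog Reg Loc Val) : Prop :=
  c.AllTx fun T rs ws => ∀ σ t σ', BRun T σ t σ' → readsFirst t ⊆ ↑rs ∧ writesOf t ⊆ ↑ws

/-- The read and write sets supplied with transactions are exact. Whether a location that is read
only after having been written belongs to the read set does not matter. -/
def Prog.SetsExact (c : Prog Reg Loc Val) : Prop :=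
  c.AllTx fun T rs ws => ∀ σ t σ', BRun T σ t σ' →
    readsFirst t ⊆ ↑rs ∧ ↑rs ⊆ readsOf t ∧ writesOf t = ↑ws

end Source

/-! ### The language of the implementations -/

/-- Programs with shared memory accesses and lock calls, over local states `S`. `each A c` runs
`c x` for the elements `x` of the finite set `A`, in increasing order. `canPromote x k` either
promotes the reader lock on `x` or fails to do so, and passes the result to `k`. -/
inductive Com (S Loc Val : Type*) where
  | skip
  | upd (f : S → S)
  | load (x : Loc) (k : S → Val → S)
  | store (x : Loc) (e : S → Val)
  | lockR (x : Loc)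
  | unlockR (x : Loc)
  | lockW (x : Loc)
  | unlockW (x : Loc)
  | canPromote (x : Loc) (k : S → Bool → S)
  | seq (c d : Com S Loc Val)
  | cond (b : S → Prop) (c d : Com S Loc Val)
  | loop (b : S → Prop) (c : Com S Loc Val)
  | each (A : S → Finset Loc) (c : Loc → Com S Loc Val)

section Impl

variable {Tid Reg Loc Val : Type*} {S : Type*} [LinearOrder Loc]

/-- Terminating runs, with the sequence of labels of the events generated. The values read are
unconstrained. A failed promotion generates no lock event. -/
inductive Run : Com S Loc Val → S → List (Label Loc Val) → S → Prop where
  | skip (s) : Run .skip s [] s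
  | upd (f s) : Run (.upd f) s [] (f s)
  | load (x k v s) : Run (.load x k) s [.R x v] (k s v)
  | store (x e s) : Run (.store x e) s [.W x (e s)] s
  | lockR (x s) : Run (.lockR x) s [.RL x] s
  | unlockR (x s) : Run (.unlockR x) s [.RU x] s
  | lockW (x s) : Run (.lockW x) s [.WL x] s
  | unlockW (x s) : Run (.unlockW x) s [.WU x] s
  | promoted (x k s) : Run (.canPromote x k) s [.PL x] (k s true)
  | not_promoted (x k s) : Run (.canPromote x k) s [] (k s false)
  | seq {c d s₁ s₂ s₃ t₁ t₂} : Run c s₁ t₁ s₂ → Run d s₂ t₂ s₃ → Run (.seq c d) s₁ (t₁ ++ t₂) s₃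
  | cond_true {b c d s s' t} : b s → Run c s t s' → Run (.cond b c d) s t s'
  | cond_false {b c d s s' t} : ¬ b s → Run d s t s' → Run (.cond b c d) s t s'
  | loop_false {b c s} : ¬ b s → Run (.loop b c) s [] s
  | loop_true {b c s₁ s₂ s₃ t₁ t₂} : b s₁ → Run c s₁ t₁ s₂ → Run (.loop b c) s₂ t₂ s₃ →
      Run (.loop b c) s₁ (t₁ ++ t₂) s₃
  | each {A c s s' t} :
      Run (((A s).sort (· ≤ ·)).foldr (fun x d => Com.seq (c x) d) Com.skip) s t s' →
      Run (.each A c) s t s'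

/-- Local state of a thread of the implementations: the local variables of the program, their
values at the start of the current transaction, the snapshot array `s` (with `none` for `⊥`), the
sets `RS`, `WS` and `LS`, and a flag that tells whether the transaction may proceed past the
promotions. -/
structure LState (Reg Loc Val : Type*) where
  regs : Reg → Val
  saved : Reg → Val
  snap : Loc → Option Val
  RS : Finset Loc
  WS : Finset Loc
  LS : Finset Loc
  ok : Bool

/-- The initial local state: all local variables are `0`. -/
def LState.start [Zero Val] : LState Reg Loc Val := ⟨fun _ => 0, fun _ => 0, fun _ => none, ∅, ∅, ∅, false⟩

/-- Promotion of the locks on the write set `ws`, in order, with deadlock avoidance: if a promotion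
fails, then the writer locks on `LS` and the reader locks on `ws \ LS` are released, and the flag
`ok` is cleared, which makes the transaction restart. -/
def promoteAll (ws : LState Reg Loc Val → Finset Loc) : Com (LState Reg Loc Val) Loc Val :=
  .each ws fun x =>
    .cond (fun s => s.ok = true)
      (.seq
        (.canPromote x fun s b => if b then { s with LS := insert x s.LS } else { s with ok := false })
        (.cond (fun s => s.ok = true) .skip
          (.seq (.each (fun s => s.LS) .unlockW) (.each (fun s => ws s \ s.LS) .unlockR))))
      .skip

variable [DecidableEq Reg] [Zero Val]

/-- The translation of transaction bodies in the eager implementation: reads are from the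
snapshot, writes are in place and update the snapshot. -/
def eagerBody : Body Reg Loc Val → Com (LState Reg Loc Val) Loc Val
  | .skip => .skip
  | .assign r e => .upd fun s => { s with regs := Function.update s.regs r (e s.regs) }
  | .rd r x => .upd fun s => { s with regs := Function.update s.regs r ((s.snap x).getD 0) }
  | .wr x e => .seq (.store x fun s => e s.regs)
      (.upd fun s => { s with snap := Function.update s.snap x (some (e s.regs)) })
  | .seq c d => .seq (eagerBody c) (eagerBody d)
  | .cond b c d => .cond (fun s => b s.regs) (eagerBody c) (eagerBody d)
  | .loop b c => .loop (fun s => b s.regs) (eagerBody c)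

/-- The eager, prescient SI implementation of a transaction `T` with read set `rs` and write set
`ws`: acquire reader locks, take a snapshot, release the reader locks on `rs \ ws`, promote the
locks on `ws` (and restart if this fails), execute `T`, release the writer locks. -/
def eagerTx (T : Body Reg Loc Val) (rs ws : Finset Loc) : Com (LState Reg Loc Val) Loc Val :=
  .seq (.upd fun s => { s with ok := false }) <|
  .seq (.loop (fun s => s.ok = false) <|
    .seq (.upd fun s => { s with LS := ∅, ok := true }) <|
    .seq (.each (fun _ => rs ∪ ws) .lockR) <|
    .seq (.each (fun _ => rs) fun x =>
      .load x fun s v => { s with snap := Function.update s.snap x (some v) }) <|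
    .seq (.each (fun _ => rs \ ws) .unlockR) <|
    promoteAll fun _ => ws) <|
  .seq (eagerBody T) <|
  .each (fun _ => ws) .unlockW

/-- The translation of transaction bodies in the lazy implementation: locks are acquired and
values are recorded in the snapshot at the first access, writes are recorded in the snapshot. -/
def lazyBody : Body Reg Loc Val → Com (LState Reg Loc Val) Loc Val
  | .skip => .skip
  | .assign r e => .upd fun s => { s with regs := Function.update s.regs r (e s.regs) }
  | .rd r x =>
      .seq (.cond (fun s => x ∉ s.RS ∪ s.WS)
        (.seq (.lockR x) <|
          .seq (.upd fun s => { s with RS := insert x s.RS }) <|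
          .load x fun s v => { s with snap := Function.update s.snap x (some v) })
        .skip) <|
      .upd fun s => { s with regs := Function.update s.regs r ((s.snap x).getD 0) }
  | .wr x e =>
      .seq (.cond (fun s => x ∉ s.RS ∪ s.WS) (.lockR x) .skip) <|
      .upd fun s =>
        { s with WS := insert x s.WS, snap := Function.update s.snap x (some (e s.regs)) }
  | .seq c d => .seq (lazyBody c) (lazyBody d)
  | .cond b c d => .cond (fun s => b s.regs) (lazyBody c) (lazyBody d)
  | .loop b c => .loop (fun s => b s.regs) (lazyBody c)

/-- The lazy, non-prescient SI implementation of a transaction `T`: execute `T` on the snapshot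
while computing its read and write sets, release the reader locks on `RS \ WS`, promote the locks on
`WS` (and restart, from the initial values of the local variables, if this fails), propagate the
recorded writes to memory, release the writer locks. -/
def lazyTx (T : Body Reg Loc Val) : Com (LState Reg Loc Val) Loc Val :=
  .seq (.upd fun s => { s with saved := s.regs, ok := false }) <|
  .seq (.loop (fun s => s.ok = false) <|
    .seq (.upd fun s =>
      { s with regs := s.saved, snap := fun _ => none, RS := ∅, WS := ∅, LS := ∅, ok := true }) <|
    .seq (lazyBody T) <|
    .seq (.each (fun s => s.RS \ s.WS) .unlockR) <|
    promoteAll fun s => s.WS) <|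
  .seq (.each (fun s => s.WS) fun x => .store x fun s => (s.snap x).getD 0) <|
  .each (fun s => s.WS) .unlockW

/-- Replaces all transactions of a program by an implementation `f`. -/
def implement (f : Body Reg Loc Val → Finset Loc → Finset Loc → Com (LState Reg Loc Val) Loc Val) :
    Prog Reg Loc Val → Com (LState Reg Loc Val) Loc Val
  | .skip => .skip
  | .assign r e => .upd fun s => { s with regs := Function.update s.regs r (e s.regs) }
  | .seq c d => .seq (implement f c) (implement f d)
  | .cond b c d => .cond (fun s => b s.regs) (implement f c) (implement f d)
  | .loop b c => .loop (fun s => b s.regs) (implement f c)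
  | .tx T rs ws => f T rs ws

/-- The eager implementation of a transactional program. -/
def eager (P : Tid → Prog Reg Loc Val) : Tid → Com (LState Reg Loc Val) Loc Val :=
  fun τ => implement eagerTx (P τ)

/-- The lazy implementation of a transactional program; it does not use the read and write sets
supplied with transactions. -/
def lazy (P : Tid → Prog Reg Loc Val) : Tid → Com (LState Reg Loc Val) Loc Val :=
  fun τ => implement (fun T _ _ => lazyTx T) (P τ)

end Impl

section Exec

variable {Tid Reg Loc Val : Type*} [LinearOrder Loc] [Zero Val]

/-- `G` is an execution graph of the implementation `C` (which has no transactional events) with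
outcome `out`, the final values of the local variables of the implemented program. -/
def ImplExec (C : Tid → Com (LState Reg Loc Val) Loc Val) (G : ExecGraph Tid Loc Val)
    (out : Tid → Reg → Val) : Prop :=
  G.WF ∧ ∃ (tr : Tid → List (Label Loc Val)) (fin : Tid → LState Reg Loc Val),
    (∀ τ, Run (C τ) LState.start (tr τ) (fin τ)) ∧
    (∀ τ, (fin τ).regs = out τ) ∧
    G.HasThreads fun τ => (tr τ).map fun l => (0, l)

def RAOutcomes (C : Tid → Com (LState Reg Loc Val) Loc Val) : Set (Tid → Reg → Val) :=
  {out | ∃ G, ImplExec C G out ∧ G.RAConsistent}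

end Exec

/-! ### Lock orders built from an order of the transactions -/

namespace ExecGraph

variable {Tid Loc Val : Type*}

/-- The identifiers of the transactions of `G`. -/
def txs (G : ExecGraph Tid Loc Val) : Set ℕ := {ξ | ξ ≠ 0 ∧ ∃ e ∈ G.E, e.tx = ξ}

def TxAccesses (G : ExecGraph Tid Loc Val) (ξ : ℕ) (x : Loc) : Prop :=
  ∃ e ∈ G.E, e.tx = ξ ∧ e.loc = x

def TxWrites (G : ExecGraph Tid Loc Val) (ξ : ℕ) (x : Loc) : Prop :=
  ∃ e ∈ G.E, e.tx = ξ ∧ e.loc = x ∧ e.lab.IsWrite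

/-- `tco` is a strict total order on the transactions of `G` that extends the transaction
dependency order, the transitive closure of `(lifted rb)^? ; (lifted po ∪ mo ∪ rf)`. -/
structure IsTCO (G : ExecGraph Tid Loc Val) (tco : ℕ → ℕ → Prop) : Prop where
  irrefl : ∀ ξ ∈ G.txs, ¬ tco ξ ξ
  trans : ∀ ξ ∈ G.txs, ∀ ζ ∈ G.txs, ∀ η ∈ G.txs, tco ξ ζ → tco ζ η → tco ξ η
  total : ∀ ξ ∈ G.txs, ∀ ζ ∈ G.txs, ξ ≠ ζ → tco ξ ζ ∨ tco ζ ξ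
  extend : ∀ a b, Relation.TransGen (fun a b => ∃ c, (a = c ∨ G.lift G.rb a c) ∧ G.dep c b) a b →
    tco a.tx b.tx

/-- `ξ` is the `i`-th transaction in `tco`, counted from `0`, among those that write to `x`. -/
def WriterAt (G : ExecGraph Tid Loc Val) (tco : ℕ → ℕ → Prop) (x : Loc) (i ξ : ℕ) : Prop :=
  ξ ∈ G.txs ∧ G.TxWrites ξ x ∧ {ζ | ζ ∈ G.txs ∧ G.TxWrites ζ x ∧ tco ζ ξ}.ncard = i

/-- `ξ` belongs to the `i`-th phase of `x`: it is the `i`-th writer of `x`, or it reads `x` from the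
preceding writer (from the initialisation event if `i = 0`). -/
def InPhase (G : ExecGraph Tid Loc Val) (tco : ℕ → ℕ → Prop) (x : Loc) : ℕ → ℕ → Prop
  | 0, ξ => G.WriterAt tco x 0 ξ ∨ ∃ w r, w.tid = none ∧ w.loc = x ∧ r.tx = ξ ∧ G.rf w r
  | i + 1, ξ => G.WriterAt tco x (i + 1) ξ ∨
      ∃ w r, G.WriterAt tco x i w.tx ∧ w.loc = x ∧ r.tx = ξ ∧ G.rf w r ∧ ¬ G.st w r

/-- `own` assigns the lock events of the implementation graph `G` to transactions of `H`, in
accordance with program order, such that each transaction owns, for each location that it accesses,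
exactly one reader lock acquisition, and either one promotion and one writer lock release (if it
writes to the location) or one reader lock release (otherwise). -/
structure LockOwner (H G : ExecGraph Tid Loc Val) (own : Event Tid Loc Val → ℕ) : Prop where
  mem : ∀ a ∈ G.E, a.lab.IsLock → own a ∈ H.txs ∧ ∃ e ∈ H.E, e.tx = own a ∧ e.tid = a.tid
  po : ∀ a b, a.lab.IsLock → b.lab.IsLock → G.po a b → own a ≠ own b →
    ∀ c ∈ H.E, ∀ d ∈ H.E, c.tx = own a → d.tx = own b → H.po c d
  inj : ∀ a ∈ G.E, ∀ b ∈ G.E, a.lab.IsLock → a.lab = b.lab → own a = own b → a = b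
  rl : ∀ ξ ∈ H.txs, ∀ x, (∃ a ∈ G.E, a.lab = .RL x ∧ own a = ξ) ↔ H.TxAccesses ξ x
  ru : ∀ ξ ∈ H.txs, ∀ x,
    (∃ a ∈ G.E, a.lab = .RU x ∧ own a = ξ) ↔ H.TxAccesses ξ x ∧ ¬ H.TxWrites ξ x
  pl : ∀ ξ ∈ H.txs, ∀ x, (∃ a ∈ G.E, a.lab = .PL x ∧ own a = ξ) ↔ H.TxWrites ξ x
  wu : ∀ ξ ∈ H.txs, ∀ x, (∃ a ∈ G.E, a.lab = .WU x ∧ own a = ξ) ↔ H.TxWrites ξ x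
  wl : ∀ a ∈ G.E, ∀ x, a.lab ≠ .WL x

/-- The synchronisation edges that involve writer calls: writer calls of the writer of phase `i`
precede all calls of later phases, its promotion precedes its release, and reader calls of phase `i`
precede the writer calls of phases `k ≥ i`. -/
def LO (H : ExecGraph Tid Loc Val) (tco : ℕ → ℕ → Prop) (G : ExecGraph Tid Loc Val)
    (own : Event Tid Loc Val → ℕ) (a b : Event Tid Loc Val) : Prop :=
  a ∈ G.E ∧ b ∈ G.E ∧ a.lab.IsLock ∧ b.lab.IsLock ∧ a.loc = b.loc ∧
    ∃ i k, H.InPhase tco a.loc i (own a) ∧ H.InPhase tco a.loc k (own b) ∧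
      ((a.lab.IsWLock ∧ i < k) ∨
       (a.lab = .PL a.loc ∧ b.lab = .WU a.loc ∧ own a = own b) ∨
       (a.lab.IsRLock ∧ b.lab.IsWLock ∧ i ≤ k))

/-- The edges `LO` together with edges between reader calls, which are ordered by phase, within a
phase by `tco`, and within a transaction with the acquisition first. -/
def RLO (H : ExecGraph Tid Loc Val) (tco : ℕ → ℕ → Prop) (G : ExecGraph Tid Loc Val)
    (own : Event Tid Loc Val → ℕ) (a b : Event Tid Loc Val) : Prop :=
  LO H tco G own a b ∨
  (a ∈ G.E ∧ b ∈ G.E ∧ a.lab.IsRLock ∧ b.lab.IsRLock ∧ a.loc = b.loc ∧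
    ∃ i k, H.InPhase tco a.loc i (own a) ∧ H.InPhase tco a.loc k (own b) ∧
      (i < k ∨ (i = k ∧ tco (own a) (own b)) ∨
       (own a = own b ∧ a.lab = .RL a.loc ∧ b.lab = .RU a.loc)))

end ExecGraph

/-- The SI execution graph `H` with outcome `out` is realised by the implementation `C` using the
order `tco`: there is an execution graph of `C` with the same outcome, without repeated attempts,
that is RA-consistent both for the lock order `RLO` built from `tco`, for which all lock calls
synchronise, and for the lock order generated by `LO` alone. -/
def Realised {Tid Reg Loc Val : Type*} [LinearOrder Loc] [Zero Val]
    (C : Tid → Com (LState Reg Loc Val) Loc Val) (H : ExecGraph Tid Loc Val)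
    (tco : ℕ → ℕ → Prop) (out : Tid → Reg → Val) : Prop :=
  ∃ (G G₁ G₂ : ExecGraph Tid Loc Val) (own : Event Tid Loc Val → ℕ),
    ExecGraph.LockOwner H G own ∧
    G₁ = { G with lo := Relation.TransGen (ExecGraph.LO H tco G own) } ∧
    G₂ = { G with lo := ExecGraph.RLO H tco G own } ∧
    ImplExec C G₁ out ∧ G₁.RAConsistent ∧
    ImplExec C G₂ out ∧ G₂.RAConsistent ∧ G₂.RSync

end SnapIso

/-!
Both inclusions rest on reading the lock-based protocols as follows. In an execution of an
implementation, a transaction consists of failed attempts, which store nothing, and one successful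
attempt, whose events occur in stages (`Label.stage`): lock and load, release reader locks, promote,
store, release writer locks. The structure `Block` records all that matters about a successful
attempt. The end of the first stage is the moment at which the attempt has completed its snapshot,
the end of the promotions is the moment at which it commits.

**Soundness.** In an RA-consistent graph a lock on `x` that has been promoted is released, after all
stores, before any later call to it, and a reader lock is released or promoted before it is granted
to a writer. Hence, with respect to happens-before, two writers of `x` commit one after the other,
the first one even before the snapshot of the second one (`Attempts.commitSnap_of_commitLT`); and
a transaction that loads `x` completes its snapshot before a given writer of `x` commits, or else it
loads `x` after all stores of that writer (`Attempts.hb_or_hb`). Coherence then tells that a load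
returns the last store of some writer that has committed, and that all later writers commit after
the snapshot (`Attempts.exists_source`). Ordering the writes to each location by the commits gives a
graph of the transactional program. Each of its dependencies `po`, `rf`, `mo` leads from a commit to
a later snapshot, and `rb` leads from a snapshot to a later commit. So every edge of `dep ; rb?`
leads from a commit to a later commit, and the graph is SI-consistent
(`Attempts.exists_siConsistent`, `soundness`).

**Completeness.** In an SI-consistent graph, cycles of `rb? ; dep` can be rotated to cycles of
`dep ; rb?`, so that the transaction dependency order has a linear extension `tco`
(`ExecGraph.exists_isTCO`). Given such an extension, each transaction takes its snapshot at its
place in `tco`, and commits as soon as all transactions that precede it in `rb` have taken their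
snapshots. Since `rb? ; dep` is contained in `tco`, a transaction commits before the snapshots of
all transactions that depend on it (`TxOrdered.commitTime_lt_snapTime`). The values read in the
given graph are the ones that this schedule produces (`TxLayout.legal`), so every transaction can be
executed by a single successful attempt (`eagerTx_complete`, `lazyTx_complete`), which makes no
superfluous lock calls (`ExactBlock`). Program order, reads-from, modification order, reads-before
and both lock orders only lead forward in time (`Earlier`), which excludes all cycles that
RA-consistency forbids. For the lock orders this uses that they compare the phases of the owners
first (`LocksOwned.rlo_iff`), and that phases are ordered in the same way as snapshots and commits
(`TxOrdered.dep_of_writer`, `TxOrdered.dep_or_rb_of_inPhase`). The conclusion is `completeness`.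
-/

namespace SnapIso

/-! ### Sequences of accesses -/

section Traces

variable {Loc Val : Type*}

theorem mem_writesOf_append {t₁ t₂ : List (Label Loc Val)} {x : Loc} :
    x ∈ writesOf (t₁ ++ t₂) ↔ x ∈ writesOf t₁ ∨ x ∈ writesOf t₂ := by
  simp [writesOf, exists_or]

/-- A location is read before being written in a concatenation if it is so in the first part, or if
it is so in the second part and the first part does not write to it. -/
theorem mem_readsFirst_append {t₁ t₂ : List (Label Loc Val)} {x : Loc} :
    x ∈ readsFirst (t₁ ++ t₂) ↔
      x ∈ readsFirst t₁ ∨ (x ∉ writesOf t₁ ∧ x ∈ readsFirst t₂) := by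
  constructor
  · rintro ⟨a, v, b, h, hx⟩
    rcases List.append_eq_append_iff.1 h with ⟨c, rfl, hc⟩ | ⟨c, rfl, hc⟩
    · exact .inr ⟨fun h' => hx (mem_writesOf_append.2 (.inl h')),
        c, v, b, hc, fun h' => hx (mem_writesOf_append.2 (.inr h'))⟩
    · cases c with
      | nil =>
        refine .inr ⟨by simpa using hx, [], v, b, by simpa using hc.symm, by simp [writesOf]⟩
      | cons l c =>
        simp only [List.cons_append, List.cons.injEq] at hc
        exact .inl ⟨a, v, c, by rw [hc.1], hx⟩
  · rintro (⟨a, v, b, rfl, hx⟩ | ⟨hn, a, v, b, rfl, hx⟩)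
    · exact ⟨a, v, b ++ t₂, by simp, hx⟩
    · exact ⟨t₁ ++ a, v, b, by simp, by simp [mem_writesOf_append, hn, hx]⟩

theorem readsFirst_subset_readsOf {t : List (Label Loc Val)} : readsFirst t ⊆ readsOf t := by
  rintro x ⟨a, v, b, rfl, -⟩
  exact ⟨v, by simp⟩

theorem readsOf_subset {t : List (Label Loc Val)} :
    readsOf t ⊆ readsFirst t ∪ writesOf t := by
  rintro x ⟨v, hv⟩
  obtain ⟨a, b, rfl⟩ := List.append_of_mem hv
  by_cases hx : x ∈ writesOf a
  · exact .inr (mem_writesOf_append.2 (.inl hx))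
  · exact .inl ⟨a, v, b, rfl, hx⟩

/-- The locations read or written by a sequence of accesses. -/
def accessed (t : List (Label Loc Val)) : Set Loc := readsFirst t ∪ writesOf t

theorem accessed_append {t₁ t₂ : List (Label Loc Val)} {x : Loc} :
    x ∈ accessed (t₁ ++ t₂) ↔ x ∈ accessed t₁ ∨ x ∈ accessed t₂ := by
  simp only [accessed, Set.mem_union, mem_readsFirst_append, mem_writesOf_append]
  tauto

theorem mem_readsFirst_of_getElem? {t : List (Label Loc Val)} {j : ℕ}
    {x : Loc} {v : Val} (hj : t[j]? = some (.R x v)) (hx : x ∉ writesOf (t.take j)) :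
    x ∈ readsFirst t := by
  obtain ⟨hlt, hv⟩ := List.getElem?_eq_some_iff.1 hj
  refine ⟨_, v, t.drop (j + 1), ?_, hx⟩
  rw [← hv, List.cons_getElem_drop_succ, List.take_append_drop]

/-- The last write to `x` in `t` is at position `i`. -/
def IsLastWrite (x : Loc) (i : ℕ) (t : List (Label Loc Val)) : Prop :=
  (∃ v, t[i]? = some (.W x v)) ∧ ∀ i' v, t[i']? = some (.W x v) → i' ≤ i

theorem IsLastWrite.unique {x : Loc} {i j : ℕ} {t : List (Label Loc Val)}
    (hi : IsLastWrite x i t) (hj : IsLastWrite x j t) : i = j := by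
  obtain ⟨⟨v, hv⟩, h⟩ := hi
  obtain ⟨⟨w, hw⟩, h'⟩ := hj
  exact le_antisymm (h' _ _ hv) (h _ _ hw)

theorem mem_writesOf_iff_getElem? {x : Loc} {t : List (Label Loc Val)} :
    x ∈ writesOf t ↔ ∃ (i : ℕ) (v : Val), t[i]? = some (.W x v) := by
  simp only [writesOf, Set.mem_ofPred_eq, List.mem_iff_getElem?]
  exact exists_comm

theorem exists_isLastWrite {x : Loc} {t : List (Label Loc Val)} (h : x ∈ writesOf t) :
    ∃ i, IsLastWrite x i t := by
  classical
  obtain ⟨i, v, hi⟩ := mem_writesOf_iff_getElem?.1 h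
  have hb : ∀ j v, t[j]? = some (.W x v) → j ≤ t.length := fun j v hj =>
    (List.getElem?_eq_some_iff.1 hj).1.le
  refine ⟨Nat.findGreatest (fun j => ∃ v, t[j]? = some (.W x v)) t.length,
    Nat.findGreatest_spec (P := fun j => ∃ v, t[j]? = some (.W x v)) (hb i v hi) ⟨v, hi⟩,
      fun j w hj => ?_⟩
  exact Nat.le_findGreatest (hb j w hj) ⟨w, hj⟩

variable [DecidableEq Loc]

/-- The contents of the memory after the writes among the accesses, starting from the contents
`m`. -/
def memAfter (m : Loc → Val) : List (Label Loc Val) → Loc → Val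
  | [] => m
  | .W x v :: t => memAfter (Function.update m x v) t
  | .R _ _ :: t | .U _ _ _ :: t | .RL _ :: t | .RU _ :: t | .WL _ :: t | .WU _ :: t
  | .PL _ :: t => memAfter m t

theorem memAfter_append (m : Loc → Val) (t₁ t₂ : List (Label Loc Val)) :
    memAfter m (t₁ ++ t₂) = memAfter (memAfter m t₁) t₂ := by
  induction t₁ generalizing m with
  | nil => rfl
  | cons l t ih => cases l <;> simp [memAfter, ih]

theorem memAfter_of_notMem {t : List (Label Loc Val)} {x : Loc} (h : x ∉ writesOf t)
    (m : Loc → Val) : memAfter m t x = m x := by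
  induction t generalizing m with
  | nil => rfl
  | cons l t ih =>
    have ht : x ∉ writesOf t := fun ⟨v, hv⟩ => h ⟨v, List.mem_cons_of_mem _ hv⟩
    cases l <;> simp only [memAfter, ih ht]
    rename_i y v
    rw [Function.update_of_ne]
    rintro rfl
    exact h ⟨v, by simp⟩

theorem memAfter_congr {t : List (Label Loc Val)} {x : Loc} {m m' : Loc → Val}
    (h : x ∉ writesOf t → m x = m' x) : memAfter m t x = memAfter m' t x := by
  induction t generalizing m m' with
  | nil => exact h (by simp [writesOf])
  | cons l t ih =>
    have key : (x ∉ writesOf t → (∀ v, l ≠ .W x v) → m x = m' x) := by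
      intro h1 h2
      refine h fun ⟨v, hv⟩ => ?_
      rcases List.mem_cons.1 hv with hv | hv
      · exact h2 v hv.symm
      · exact h1 ⟨v, hv⟩
    cases l with
    | W y v =>
      refine ih fun hx => ?_
      by_cases hxy : x = y
      · subst hxy; simp
      · simp only [Function.update_of_ne hxy]
        exact key hx (by simp [Ne.symm hxy])
    | _ => exact ih fun hx => key hx (by simp)

theorem memAfter_of_mem {t : List (Label Loc Val)} {x : Loc} (h : x ∈ writesOf t)
    (m m' : Loc → Val) : memAfter m t x = memAfter m' t x :=
  memAfter_congr fun h' => (h' h).elim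

/-- Every read returns the value of the last preceding write to its location, or the value of the
location in `m` if there is none. -/
def Legal (m : Loc → Val) (t : List (Label Loc Val)) : Prop :=
  ∀ t₁ x v t₂, t = t₁ ++ Label.R x v :: t₂ → v = memAfter m t₁ x

theorem legal_nil (m : Loc → Val) : Legal m [] := by
  intro t₁ x v t₂ h; simp at h

theorem legal_append {m : Loc → Val} {t₁ t₂ : List (Label Loc Val)} :
    Legal m (t₁ ++ t₂) ↔ Legal m t₁ ∧ Legal (memAfter m t₁) t₂ := by
  constructor
  · refine fun h => ⟨fun a x v b e => h a x v (b ++ t₂) (by simp [e]), fun a x v b e => ?_⟩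
    rw [← memAfter_append]
    exact h (t₁ ++ a) x v b (by simp [e])
  · rintro ⟨h₁, h₂⟩ a x v b e
    rcases List.append_eq_append_iff.1 e with ⟨c, rfl, hc⟩ | ⟨c, rfl, hc⟩
    · rw [memAfter_append]; exact h₂ c x v b hc
    · cases c with
      | nil => simpa [memAfter] using h₂ [] x v b (by simpa using hc.symm)
      | cons l c =>
        simp only [List.cons_append, List.cons.injEq] at hc
        exact h₁ a x v c (by rw [hc.1])

theorem legal_R {m : Loc → Val} {x : Loc} {v : Val} : Legal m [.R x v] ↔ v = m x := by
  constructor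
  · intro h; exact h [] x v [] rfl
  · intro h a y w b e
    rcases List.cons_eq_append_iff.1 e with ⟨rfl, h'⟩ | ⟨c, rfl, h'⟩
    · simp only [List.cons.injEq, Label.R.injEq] at h'
      obtain ⟨⟨rfl, rfl⟩, -⟩ := h'
      exact h
    · simp at h'

theorem legal_W {m : Loc → Val} {x : Loc} {v : Val} : Legal m [.W x v] := by
  intro a y w b e
  rcases List.cons_eq_append_iff.1 e with ⟨rfl, h'⟩ | ⟨c, rfl, h'⟩ <;> simp at h'

theorem Legal.congr {m m' : Loc → Val} {t : List (Label Loc Val)} (h : Legal m t)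
    (hm : ∀ x ∈ readsFirst t, m x = m' x) : Legal m' t := by
  rintro a x v b e
  rw [h a x v b e]
  exact memAfter_congr fun hx => hm x ⟨a, v, b, e, hx⟩

theorem Legal.eq_of_getElem? {m : Loc → Val} {t : List (Label Loc Val)} (h : Legal m t) {j : ℕ}
    {x : Loc} {v : Val} (hj : t[j]? = some (.R x v)) : v = memAfter m (t.take j) x := by
  obtain ⟨hlt, hv⟩ := List.getElem?_eq_some_iff.1 hj
  refine h _ x v (t.drop (j + 1)) ?_
  rw [← hv, List.cons_getElem_drop_succ, List.take_append_drop]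

theorem legal_of_getElem? {m : Loc → Val} {t : List (Label Loc Val)}
    (h : ∀ j x v, t[j]? = some (.R x v) → v = memAfter m (t.take j) x) : Legal m t := by
  rintro a x v b rfl
  simpa using h a.length x v (by simp)

theorem memAfter_of_isLastWrite {x : Loc} {i : ℕ} {t : List (Label Loc Val)} {v : Val}
    (h : IsLastWrite x i t) (hv : t[i]? = some (.W x v)) (m : Loc → Val) :
    memAfter m t x = v := by
  obtain ⟨hlt, hv⟩ := List.getElem?_eq_some_iff.1 hv
  have e : t = t.take i ++ Label.W x v :: t.drop (i + 1) := by
    rw [← hv, List.cons_getElem_drop_succ, List.take_append_drop]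
  have hn : x ∉ writesOf (t.drop (i + 1)) := by
    intro hx
    obtain ⟨j, w, hj⟩ := mem_writesOf_iff_getElem?.1 hx
    rw [List.getElem?_drop] at hj
    have := h.2 _ _ hj
    omega
  rw [e, memAfter_append]
  simp [memAfter, memAfter_of_notMem hn]

/-! ### Committed blocks -/

/-- The stage of the commit protocol at which a lock call or access of an implementation occurs:
locks are acquired and values are loaded first, then reader locks are released, the locks on the
write set are promoted, values are stored, and writer locks are released. -/
def Label.stage : Label Loc Val → ℕ
  | .R _ _ => 0
  | .RL _ => 0
  | .RU _ => 1
  | .PL _ => 2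
  | .W _ _ => 3
  | .U _ _ _ => 3
  | .WL _ => 3
  | .WU _ => 4

/-- The sequence `v` of labels is what a successful attempt to execute a transaction with accesses
`t` generates, where `m` contains the values that the transaction reads from other transactions.
It is allowed to lock and load more than necessary. -/
structure Block (m : Loc → Val) (t v : List (Label Loc Val)) : Prop where
  legal : Legal m t
  sorted : v.Pairwise fun a b => a.stage ≤ b.stage
  no_upd : ∀ x a b, Label.U x a b ∉ v
  mem : ∀ m', memAfter m' v = memAfter m' t
  writes : writesOf v = writesOf t
  rl : ∀ x ∈ accessed t, Label.RL x ∈ v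
  load : ∀ x ∈ readsFirst t, ∃ v₁ v₂, v = v₁ ++ Label.R x (m x) :: v₂ ∧ Label.RL x ∈ v₁
  pl : ∀ x ∈ writesOf t, Label.PL x ∈ v ∧ Label.RU x ∉ v

/-- A block without superfluous lock calls and loads. -/
structure ExactBlock (m : Loc → Val) (t v : List (Label Loc Val)) : Prop extends Block m t v where
  distinct : v.Pairwise fun a b => a.IsLock → a ≠ b
  loads : ∀ x y, Label.R x y ∈ v → y = m x ∧ x ∈ accessed t
  rl_mem : ∀ x, Label.RL x ∈ v → x ∈ accessed t
  ru_iff : ∀ x, Label.RU x ∈ v ↔ x ∈ accessed t ∧ x ∉ writesOf t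
  pl_mem : ∀ x, Label.PL x ∈ v → x ∈ writesOf t
  wu_iff : ∀ x, Label.WU x ∈ v ↔ x ∈ writesOf t
  no_wl : ∀ x, Label.WL x ∉ v

theorem block_nil (m : Loc → Val) : Block m [] [] where
  legal := legal_nil m
  sorted := .nil
  no_upd := by simp
  mem _ := rfl
  writes := rfl
  rl := by simp [accessed, readsFirst, writesOf]
  load := by simp [readsFirst]
  pl := by simp [writesOf]

theorem exactBlock_nil (m : Loc → Val) : ExactBlock m [] [] where
  toBlock := block_nil m
  distinct := .nil
  loads := by simp
  rl_mem := by simp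
  ru_iff := by simp [accessed, readsFirst, writesOf]
  pl_mem := by simp
  wu_iff := by simp [writesOf]
  no_wl := by simp

end Traces

/-! ### Inversion of runs -/

section Runs

variable {Loc Val S : Type*} [LinearOrder Loc]

theorem run_skip {s s' : S} {t : List (Label Loc Val)} :
    Run .skip s t s' ↔ t = [] ∧ s' = s := by
  constructor
  · intro h; cases h; simp
  · rintro ⟨rfl, rfl⟩; exact .skip _

theorem run_upd {f : S → S} {s s' : S} {t : List (Label Loc Val)} :
    Run (.upd f) s t s' ↔ t = [] ∧ s' = f s := by
  constructor
  · intro h; cases h; simp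
  · rintro ⟨rfl, rfl⟩; exact .upd _ _

theorem run_load {x : Loc} {k : S → Val → S} {s s' : S} {t : List (Label Loc Val)} :
    Run (.load x k) s t s' ↔ ∃ v, t = [.R x v] ∧ s' = k s v := by
  constructor
  · intro h; cases h; simp
  · rintro ⟨v, rfl, rfl⟩; exact .load _ _ _ _

theorem run_store {x : Loc} {e : S → Val} {s s' : S} {t : List (Label Loc Val)} :
    Run (.store x e) s t s' ↔ t = [.W x (e s)] ∧ s' = s := by
  constructor
  · intro h; cases h; simp
  · rintro ⟨rfl, rfl⟩; exact .store _ _ _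

theorem run_lockR {x : Loc} {s s' : S} {t : List (Label Loc Val)} :
    Run (.lockR x) s t s' ↔ t = [.RL x] ∧ s' = s := by
  constructor
  · intro h; cases h; simp
  · rintro ⟨rfl, rfl⟩; exact .lockR _ _

theorem run_unlockR {x : Loc} {s s' : S} {t : List (Label Loc Val)} :
    Run (.unlockR x) s t s' ↔ t = [.RU x] ∧ s' = s := by
  constructor
  · intro h; cases h; simp
  · rintro ⟨rfl, rfl⟩; exact .unlockR _ _

theorem run_unlockW {x : Loc} {s s' : S} {t : List (Label Loc Val)} :
    Run (.unlockW x) s t s' ↔ t = [.WU x] ∧ s' = s := by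
  constructor
  · intro h; cases h; simp
  · rintro ⟨rfl, rfl⟩; exact .unlockW _ _

theorem run_canPromote {x : Loc} {k : S → Bool → S} {s s' : S} {t : List (Label Loc Val)} :
    Run (.canPromote x k) s t s' ↔
      (t = [.PL x] ∧ s' = k s true) ∨ (t = [] ∧ s' = k s false) := by
  constructor
  · intro h; cases h <;> simp
  · rintro (⟨rfl, rfl⟩ | ⟨rfl, rfl⟩)
    · exact .promoted _ _ _
    · exact .not_promoted _ _ _

theorem run_seq {c d : Com S Loc Val} {s s' : S} {t : List (Label Loc Val)} :
    Run (.seq c d) s t s' ↔ ∃ t₁ s₁ t₂, Run c s t₁ s₁ ∧ Run d s₁ t₂ s' ∧ t = t₁ ++ t₂ := by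
  constructor
  · intro h; cases h with | seq h₁ h₂ => exact ⟨_, _, _, h₁, h₂, rfl⟩
  · rintro ⟨t₁, s₁, t₂, h₁, h₂, rfl⟩; exact .seq h₁ h₂

theorem run_cond {b : S → Prop} {c d : Com S Loc Val} {s s' : S} {t : List (Label Loc Val)} :
    Run (.cond b c d) s t s' ↔ (b s ∧ Run c s t s') ∨ (¬ b s ∧ Run d s t s') := by
  constructor
  · intro h; cases h <;> simp_all
  · rintro (⟨hb, h⟩ | ⟨hb, h⟩)
    · exact .cond_true hb h
    · exact .cond_false hb h

/-- `c x` for the elements `x` of a list, in order. -/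
abbrev eachList (l : List Loc) (c : Loc → Com S Loc Val) : Com S Loc Val :=
  l.foldr (fun x d => Com.seq (c x) d) .skip

theorem run_each {A : S → Finset Loc} {c : Loc → Com S Loc Val} {s s' : S}
    {t : List (Label Loc Val)} :
    Run (.each A c) s t s' ↔ Run (eachList ((A s).sort (· ≤ ·)) c) s t s' := by
  constructor
  · intro h; cases h; assumption
  · exact .each

/-- Induction along a loop: the invariant `I` holds of the state and of the trace of the iterations
so far. -/
theorem Run.loop_induction {b : S → Prop} {c : Com S Loc Val}
    {I : S → List (Label Loc Val) → S → Prop} (h0 : ∀ s, ¬ b s → I s [] s)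
    (h1 : ∀ s₁ s₂ s₃ t₁ t₂, b s₁ → Run c s₁ t₁ s₂ → I s₂ t₂ s₃ → I s₁ (t₁ ++ t₂) s₃)
    {s s' : S} {t : List (Label Loc Val)} (h : Run (.loop b c) s t s') : I s t s' := by
  generalize hp : Com.loop b c = p at h
  induction h with
  | loop_false hb => cases hp; exact h0 _ hb
  | loop_true hb hc _ _ ih => cases hp; exact h1 _ _ _ _ _ hb hc (ih rfl)
  | _ => cases hp

/-- Commands that generate a fixed label and leave the state alone, performed in sequence. -/
theorem run_eachList_emit {c : Loc → Com S Loc Val} {g : Loc → Label Loc Val} {s : S}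
    (hc : ∀ x s' t, Run (c x) s t s' ↔ t = [g x] ∧ s' = s) (l : List Loc) {s' : S}
    {t : List (Label Loc Val)} :
    Run (eachList l c) s t s' ↔ t = l.map g ∧ s' = s := by
  induction l generalizing t with
  | nil => simp [eachList, run_skip]
  | cons x l ih =>
    simp only [eachList, List.foldr_cons, run_seq, hc] at ih ⊢
    constructor
    · rintro ⟨_, _, t₂, ⟨rfl, rfl⟩, h, rfl⟩
      obtain ⟨rfl, rfl⟩ := ih.1 h
      simp
    · rintro ⟨rfl, rfl⟩
      exact ⟨_, _, _, ⟨rfl, rfl⟩, ih.2 ⟨rfl, rfl⟩, by simp⟩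

/-- The elements of a finite set, in increasing order, as arguments of a label constructor. -/
def labels (g : Loc → Label Loc Val) (A : Finset Loc) : List (Label Loc Val) :=
  (A.sort (· ≤ ·)).map g

theorem run_each_emit {A : S → Finset Loc} {c : Loc → Com S Loc Val} {g : Loc → Label Loc Val}
    {s : S} (hc : ∀ x s' t, Run (c x) s t s' ↔ t = [g x] ∧ s' = s) {s' : S}
    {t : List (Label Loc Val)} :
    Run (.each A c) s t s' ↔ t = labels g (A s) ∧ s' = s := by
  rw [run_each, run_eachList_emit hc]; rfl

theorem mem_labels {g : Loc → Label Loc Val} {A : Finset Loc} {l : Label Loc Val} :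
    l ∈ labels g A ↔ ∃ x ∈ A, g x = l := by
  simp [labels]

end Runs

/-! ### Snapshots, promotions and retry loops -/

section Impl

variable {Reg Loc Val : Type*} [LinearOrder Loc]

/-- Recording the values of distinct locations in the snapshot; `m₀` provides the values of all
other locations, about which the run says nothing. -/
theorem run_loads {l : List Loc} (hl : l.Nodup) (m₀ : Loc → Val)
    {s s' : LState Reg Loc Val}
    {t : List (Label Loc Val)} :
    Run (eachList l fun x => .load x fun s v =>
      { s with snap := Function.update s.snap x (some v) }) s t s' ↔
    ∃ m : Loc → Val, t = l.map (fun x => .R x (m x)) ∧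
      s' = { s with snap := fun x => if x ∈ l then some (m x) else s.snap x } := by
  induction l generalizing s t with
  | nil =>
    simp only [eachList, List.foldr_nil, run_skip, List.map_nil, List.not_mem_nil, if_false]
    exact ⟨fun h => ⟨fun x => m₀ x, h.1, h.2⟩, fun ⟨_, h⟩ => h⟩
  | cons y l ih =>
    have hy : y ∉ l := (List.nodup_cons.1 hl).1
    simp only [eachList, List.foldr_cons, run_seq, run_load] at ih ⊢
    constructor
    · rintro ⟨_, _, t₂, ⟨v, rfl, rfl⟩, h, rfl⟩
      obtain ⟨m, rfl, rfl⟩ := (ih (List.nodup_cons.1 hl).2).1 h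
      refine ⟨Function.update m y v, ?_, ?_⟩
      · simp only [List.map_cons, Function.update_self, List.cons_append, List.nil_append,
          List.cons.injEq, true_and, List.map_inj_left]
        intro x hx
        rw [Function.update_of_ne (by rintro rfl; exact hy hx)]
      · congr 1
        funext x
        by_cases hxy : x = y
        · subst hxy; simp [hy]
        · simp [hxy]
    · rintro ⟨m, rfl, rfl⟩
      refine ⟨_, _, _, ⟨m y, rfl, rfl⟩, (ih (List.nodup_cons.1 hl).2).2 ⟨m, rfl, ?_⟩, by simp⟩
      congr 1
      funext x
      by_cases hxy : x = y
      · subst hxy; simp [hy]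
      · simp [hxy]

/-- States that agree up to the set of promoted locks and the flag. -/
def LState.Sim {Loc : Type*} (s s' : LState Reg Loc Val) : Prop :=
  s'.regs = s.regs ∧ s'.saved = s.saved ∧ s'.snap = s.snap ∧ s'.RS = s.RS ∧ s'.WS = s.WS

theorem LState.Sim.trans {Loc : Type*} {a b c : LState Reg Loc Val} (h : a.Sim b)
    (h' : b.Sim c) : a.Sim c := by
  simp_all [LState.Sim]

/-- One step of `promoteAll`. -/
abbrev promoteOne (ws : LState Reg Loc Val → Finset Loc) (x : Loc) :
    Com (LState Reg Loc Val) Loc Val :=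
  .cond (fun s => s.ok = true)
    (.seq
      (.canPromote x fun s b => if b then { s with LS := insert x s.LS } else
        { s with ok := false })
      (.cond (fun s => s.ok = true) .skip
        (.seq (.each (fun s => s.LS) .unlockW) (.each (fun s => ws s \ s.LS) .unlockR))))
    .skip

theorem run_promoteOne {ws : LState Reg Loc Val → Finset Loc} {x : Loc} {s s' : LState Reg Loc Val}
    {t : List (Label Loc Val)} (h : Run (promoteOne ws x) s t s') :
    s.Sim s' ∧ (∀ l ∈ t, l.valR = none ∧ l.valW = none) ∧
      (s'.ok = true → s.ok = true ∧ t = [.PL x]) := by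
  rcases run_cond.1 h with ⟨hb, h⟩ | ⟨hb, h⟩
  · obtain ⟨t₁, s₁, t₂, h₁, h₂, rfl⟩ := run_seq.1 h
    rcases run_canPromote.1 h₁ with ⟨rfl, rfl⟩ | ⟨rfl, rfl⟩
    · rcases run_cond.1 h₂ with ⟨hb', h₂⟩ | ⟨hb', h₂⟩
      · obtain ⟨rfl, rfl⟩ := run_skip.1 h₂
        simp [LState.Sim, hb, Label.valR, Label.valW]
      · simp [hb] at hb'
    · rcases run_cond.1 h₂ with ⟨hb', h₂⟩ | ⟨hb', h₂⟩
      · simp at hb'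
      · obtain ⟨t₃, s₃, t₄, h₃, h₄, rfl⟩ := run_seq.1 h₂
        obtain ⟨rfl, rfl⟩ := (run_each_emit (g := .WU) fun _ _ _ => run_unlockW).1 h₃
        obtain ⟨rfl, rfl⟩ := (run_each_emit (g := .RU) fun _ _ _ => run_unlockR).1 h₄
        refine ⟨by simp [LState.Sim], ?_, by simp⟩
        simp only [List.nil_append, List.mem_append, mem_labels]
        rintro l (⟨x, -, rfl⟩ | ⟨x, -, rfl⟩) <;> simp [Label.valR, Label.valW]
  · obtain ⟨rfl, rfl⟩ := run_skip.1 h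
    simp [LState.Sim, hb]

theorem run_promoteList {ws : LState Reg Loc Val → Finset Loc} {l : List Loc}
    {s s' : LState Reg Loc Val} {t : List (Label Loc Val)}
    (h : Run (eachList l (promoteOne ws)) s t s') :
    s.Sim s' ∧ (∀ l ∈ t, l.valR = none ∧ l.valW = none) ∧
      (s'.ok = true → s.ok = true ∧ t = l.map .PL) := by
  induction l generalizing s t with
  | nil =>
    obtain ⟨rfl, rfl⟩ := run_skip.1 h
    simp [LState.Sim]
  | cons x l ih =>
    obtain ⟨t₁, s₁, t₂, h₁, h₂, rfl⟩ := run_seq.1 h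
    obtain ⟨a₁, b₁, c₁⟩ := run_promoteOne h₁
    obtain ⟨a₂, b₂, c₂⟩ := ih h₂
    refine ⟨a₁.trans a₂, ?_, fun hk => ?_⟩
    · intro l hl
      rcases List.mem_append.1 hl with hl | hl
      · exact b₁ l hl
      · exact b₂ l hl
    · obtain ⟨hk, rfl⟩ := c₂ hk
      obtain ⟨hk, rfl⟩ := c₁ hk
      simp [hk]

/-- Promotions do not access the memory; if all of them succeed then they generate just the
promotion events. -/
theorem run_promoteAll {ws : LState Reg Loc Val → Finset Loc} {s s' : LState Reg Loc Val}
    {t : List (Label Loc Val)} (h : Run (promoteAll ws) s t s') :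
    s.Sim s' ∧ (∀ l ∈ t, l.valR = none ∧ l.valW = none) ∧
      (s'.ok = true → t = labels .PL (ws s)) := by
  obtain ⟨a, b, c⟩ := run_promoteList (run_each.1 h)
  exact ⟨a, b, fun hk => (c hk).2⟩

theorem promoteAll_success (ws : LState Reg Loc Val → Finset Loc) {s : LState Reg Loc Val}
    (hs : s.ok = true) :
    ∃ s', Run (promoteAll ws) s (labels .PL (ws s)) s' ∧ s.Sim s' ∧ s'.ok = true := by
  have key : ∀ (l : List Loc) (s : LState Reg Loc Val), s.ok = true →
      ∃ s', Run (eachList l (promoteOne ws)) s (l.map .PL) s' ∧ s.Sim s' ∧ s'.ok = true := by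
    intro l
    induction l with
    | nil => exact fun s hs => ⟨s, .skip _, by simp [LState.Sim], hs⟩
    | cons x l ih =>
      intro s hs
      obtain ⟨s', h, hs', hk⟩ := ih { s with LS := insert x s.LS } hs
      refine ⟨s', run_seq.2 ⟨[.PL x], { s with LS := insert x s.LS }, _, ?_, h, by simp⟩,
        .trans (by simp [LState.Sim]) hs', hk⟩
      exact .cond_true hs (run_seq.2 ⟨[.PL x], _, [], .promoted _ _ _,
        .cond_true (by simpa using hs) (run_skip.2 ⟨rfl, rfl⟩), by simp⟩)
  obtain ⟨s', h, hs', hk⟩ := key ((ws s).sort (· ≤ ·)) s hs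
  exact ⟨s', run_each.2 h, hs', hk⟩

/-- A run of a retry loop consists of unsuccessful attempts and a final successful one. -/
theorem run_retry {c : Com (LState Reg Loc Val) Loc Val} {I : LState Reg Loc Val → Prop}
    {Q : Label Loc Val → Prop}
    (hc : ∀ s t s', I s → Run c s t s' → I s' ∧ ∀ l ∈ t, Q l)
    {s s' : LState Reg Loc Val} {t : List (Label Loc Val)} (hs : s.ok = false) (hI : I s)
    (h : Run (.loop (fun s => s.ok = false) c) s t s') :
    ∃ F s₁ w, t = F ++ w ∧ (∀ l ∈ F, Q l) ∧ I s₁ ∧ Run c s₁ w s' ∧ s'.ok = true := by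
  have key := Run.loop_induction (I := fun s t s' => I s →
    (s.ok = false ∧
      ∃ F s₁ w, t = F ++ w ∧ (∀ l ∈ F, Q l) ∧ I s₁ ∧ Run c s₁ w s' ∧ s'.ok = true) ∨
    (s.ok = true ∧ t = [] ∧ s' = s)) (fun s h _ => .inr ⟨by simpa using h, rfl, rfl⟩) ?_ h hI
  · rcases key with ⟨-, h⟩ | ⟨h, -⟩
    · exact h
    · simp [hs] at h
  · intro s₁ s₂ s₃ t₁ t₂ hb hr ih hI
    obtain ⟨hI', hQ⟩ := hc _ _ _ hI hr
    refine .inl ⟨hb, ?_⟩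
    rcases ih hI' with ⟨-, F, s₄, w, rfl, hF, hI₄, hw, hk⟩ | ⟨hk, rfl, rfl⟩
    · refine ⟨t₁ ++ F, s₄, w, by simp, ?_, hI₄, hw, hk⟩
      intro l hl
      rcases List.mem_append.1 hl with hl | hl
      · exact hQ l hl
      · exact hF l hl
    · exact ⟨[], s₁, t₁, by simp, by simp, hI, hr, hk⟩

theorem retry_success {c : Com (LState Reg Loc Val) Loc Val} {s s' : LState Reg Loc Val}
    {t : List (Label Loc Val)} (hs : s.ok = false) (h : Run c s t s') (hk : s'.ok = true) :
    Run (.loop (fun s => s.ok = false) c) s t s' := by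
  have := Run.loop_true (b := fun s : LState Reg Loc Val => s.ok = false) hs h
    (.loop_false (by simp [hk]))
  simpa using this

end Impl

/-! ### The stages of a block -/

section Layers

variable {Loc Val : Type*}

/-- The accesses that store to memory. -/
def stores (t : List (Label Loc Val)) : List (Label Loc Val) :=
  t.filter fun l => match l with | .W _ _ => true | _ => false

theorem mem_stores {t : List (Label Loc Val)} {l : Label Loc Val} :
    l ∈ stores t ↔ l ∈ t ∧ ∃ x v, l = .W x v := by
  cases l <;> simp [stores]

theorem stores_append (t₁ t₂ : List (Label Loc Val)) :
    stores (t₁ ++ t₂) = stores t₁ ++ stores t₂ := by simp [stores]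

theorem writesOf_stores (t : List (Label Loc Val)) : writesOf (stores t) = writesOf t := by
  ext x; simp [writesOf, mem_stores]

theorem writesOf_eq_empty {t : List (Label Loc Val)} (h : ∀ l ∈ t, l.valW = none) :
    writesOf t = ∅ := by
  ext x
  simp only [writesOf, Set.mem_ofPred_eq, Set.mem_empty_iff_false, iff_false, not_exists]
  intro v hv
  simpa [Label.valW] using h _ hv

theorem BRun.labels {Reg : Type*} [DecidableEq Reg] {T : Body Reg Loc Val} {σ σ' : Reg → Val}
    {t : List (Label Loc Val)} (h : BRun T σ t σ') : ∀ l ∈ t, ∃ x v, l = .R x v ∨ l = .W x v := by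
  induction h with
  | skip | assign | loop_false => simp
  | rd | wr => simp
  | seq _ _ h₁ h₂ | loop_true _ _ _ h₁ h₂ =>
    intro l hl
    rcases List.mem_append.1 hl with hl | hl
    · exact h₁ l hl
    · exact h₂ l hl
  | cond_true _ _ ih | cond_false _ _ ih => exact ih

section

variable [DecidableEq Loc]

theorem memAfter_stores (m : Loc → Val) (t : List (Label Loc Val)) :
    memAfter m (stores t) = memAfter m t := by
  induction t generalizing m with
  | nil => rfl
  | cons l t ih => cases l <;> simp_all [stores, memAfter]

theorem memAfter_eq_self {t : List (Label Loc Val)} (h : ∀ l ∈ t, l.valW = none)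
    (m : Loc → Val) : memAfter m t = m := by
  funext x
  exact memAfter_of_notMem (by simp [writesOf_eq_empty h]) m

end

variable [LinearOrder Loc]

/-- The blocks generated by implementations consist of what their stages generate: lock
acquisitions and loads `A`, reader lock releases, promotions, stores `B`, and writer lock
releases. -/
def layers (A : List (Label Loc Val)) (ru ws : Finset Loc) (B : List (Label Loc Val)) :
    List (Label Loc Val) :=
  A ++ (labels .RU ru ++ (labels .PL ws ++ (B ++ labels .WU ws)))

theorem valW_of_mem_labels {g : Loc → Label Loc Val} (hg : ∀ x, (g x).valW = none)
    {A : Finset Loc} : ∀ l ∈ labels g A, l.valW = none := by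
  intro l hl
  obtain ⟨x, -, rfl⟩ := mem_labels.1 hl
  exact hg x

theorem labels_distinct (g : Loc → Label Loc Val) (A : Finset Loc) (hg : Function.Injective g) :
    (labels g A).Pairwise fun a b => a.IsLock → a ≠ b := by
  have : (labels g A).Nodup := (A.sort_nodup (· ≤ ·)).map hg
  refine List.Pairwise.imp ?_ this
  exact fun hab _ => hab

/-- The stages of an attempt that has acquired the locks and loaded the values in `A`, and that
stores `B`, form a block if they have the effect of the accesses `t`. -/
theorem layers_block {m : Loc → Val} {t A B : List (Label Loc Val)} {ru ws : Finset Loc}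
    (hl : Legal m t) (hA : ∀ l ∈ A, ∃ x v, l = .RL x ∨ l = .R x v)
    (hB : ∀ l ∈ B, ∃ x v, l = .W x v) (hmem : ∀ m', memAfter m' B = memAfter m' t)
    (hw : writesOf B = writesOf t) (hrl : ∀ x ∈ accessed t, Label.RL x ∈ A)
    (hload : ∀ x ∈ readsFirst t, ∃ v₁ v₂, A = v₁ ++ Label.R x (m x) :: v₂ ∧ Label.RL x ∈ v₁)
    (hws : ∀ x ∈ writesOf t, x ∈ ws ∧ x ∉ ru) : Block m t (layers A ru ws B) := by
  have hA' : ∀ l ∈ A, l.valW = none := by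
    intro l hl
    obtain ⟨x, v, rfl | rfl⟩ := hA l hl <;> rfl
  refine ⟨hl, ?_, ?_, ?_, ?_, ?_, ?_, ?_⟩
  · have sA : ∀ l ∈ A, l.stage = 0 := by
      intro l hl
      obtain ⟨x, v, rfl | rfl⟩ := hA l hl <;> rfl
    have sB : ∀ l ∈ B, l.stage = 3 := by
      intro l hl
      obtain ⟨x, v, rfl⟩ := hB l hl; rfl
    have const : ∀ (l : List (Label Loc Val)) (k : ℕ), (∀ a ∈ l, a.stage = k) →
        l.Pairwise fun a b => a.stage ≤ b.stage := by
      intro l k h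
      exact List.pairwise_iff_forall_sublist.2 fun {a b} hs => by
        have hs := hs.subset
        rw [h a (hs (by simp)), h b (hs (by simp))]
    have slab : ∀ (g : Loc → Label Loc Val) (k : ℕ) (A : Finset Loc), (∀ x, (g x).stage = k) →
        ∀ l ∈ labels g A, l.stage = k := by
      intro g k A hg l hl
      obtain ⟨x, -, rfl⟩ := mem_labels.1 hl
      exact hg x
    have s1 := slab .RU 1 ru fun _ => rfl
    have s2 := slab .PL 2 ws fun _ => rfl
    have s4 := slab .WU 4 ws fun _ => rfl
    simp only [layers, List.pairwise_append]
    refine ⟨const _ _ sA, ⟨const _ _ s1, ⟨const _ _ s2, ⟨const _ _ sB, const _ _ s4, ?_⟩, ?_⟩,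
      ?_⟩, ?_⟩
    · intro a ha b hb; rw [sB a ha, s4 b hb]; omega
    · intro a ha b hb; rw [s2 a ha]
      rcases List.mem_append.1 hb with hb | hb
      · rw [sB b hb]; omega
      · rw [s4 b hb]; omega
    · intro a ha b hb; rw [s1 a ha]
      simp only [List.mem_append] at hb
      rcases hb with hb | hb | hb
      · rw [s2 b hb]; omega
      · rw [sB b hb]; omega
      · rw [s4 b hb]; omega
    · intro a ha b hb; rw [sA a ha]; omega
  · intro x a b h
    simp only [layers, List.mem_append, mem_labels] at h
    rcases h with h | ⟨_, _, h⟩ | ⟨_, _, h⟩ | h | ⟨_, _, h⟩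
    · obtain ⟨_, _, h | h⟩ := hA _ h <;> simp at h
    · simp at h
    · simp at h
    · obtain ⟨_, _, h⟩ := hB _ h; simp at h
    · simp at h
  · intro m'
    simp only [layers, memAfter_append]
    rw [memAfter_eq_self hA', memAfter_eq_self (valW_of_mem_labels fun _ => rfl),
      memAfter_eq_self (valW_of_mem_labels fun _ => rfl), hmem,
      memAfter_eq_self (valW_of_mem_labels fun _ => rfl)]
  · ext x
    simp only [layers, mem_writesOf_append, writesOf_eq_empty hA', hw]
    rw [writesOf_eq_empty (valW_of_mem_labels (g := .RU) fun _ => rfl),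
      writesOf_eq_empty (valW_of_mem_labels (g := .PL) fun _ => rfl),
      writesOf_eq_empty (valW_of_mem_labels (g := .WU) fun _ => rfl)]
    simp
  · intro x hx
    simp [layers, hrl x hx]
  · intro x hx
    obtain ⟨v₁, v₂, h, h'⟩ := hload x hx
    exact ⟨v₁, v₂ ++ (labels .RU ru ++ (labels .PL ws ++ (B ++ labels .WU ws))),
      by simp [layers, h], h'⟩
  · intro x hx
    obtain ⟨h₁, h₂⟩ := hws x hx
    constructor
    · simp [layers, mem_labels, h₁]
    · simp only [layers, List.mem_append, mem_labels]
      rintro (h | ⟨_, h3, h⟩ | ⟨_, _, h⟩ | h | ⟨_, _, h⟩)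
      · obtain ⟨_, _, h | h⟩ := hA _ h <;> simp at h
      · simp only [Label.RU.injEq] at h; subst h; exact h₂ h3
      · simp at h
      · obtain ⟨_, _, h⟩ := hB _ h; simp at h
      · simp at h

/-- A block without superfluous lock calls arises if the locks in `A` and the sets of locks to be
released and to be promoted are exactly those that `t` requires. -/
theorem layers_exactBlock {m : Loc → Val} {t A B : List (Label Loc Val)} {ru ws : Finset Loc}
    (h : Block m t (layers A ru ws B)) (hA : ∀ l ∈ A, ∃ x v, l = .RL x ∨ l = .R x v)
    (hB : ∀ l ∈ B, ∃ x v, l = .W x v) (hd : A.Pairwise fun a b => a.IsLock → a ≠ b)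
    (hrl : ∀ x, Label.RL x ∈ A → x ∈ accessed t)
    (hload : ∀ x y, Label.R x y ∈ A → y = m x ∧ x ∈ accessed t)
    (hws : ∀ x, x ∈ ws ↔ x ∈ writesOf t)
    (hru : ∀ x, x ∈ ru ↔ x ∈ accessed t ∧ x ∉ writesOf t) :
    ExactBlock m t (layers A ru ws B) := by
  have hAn : ∀ l ∈ A, ∀ x, l ≠ .RU x ∧ l ≠ .PL x ∧ l ≠ .WU x ∧ l ≠ .WL x := by
    intro l hl x
    obtain ⟨x, v, rfl | rfl⟩ := hA l hl <;> simp
  have hBn : ∀ l ∈ B, ∀ x y, l ≠ .RU x ∧ l ≠ .PL x ∧ l ≠ .WU x ∧ l ≠ .WL x ∧ l ≠ .RL x ∧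
      l ≠ .R x y := by
    intro l hl x
    obtain ⟨x, v, rfl⟩ := hB l hl; simp
  refine ⟨h, ?_, ?_, ?_, ?_, ?_, ?_, ?_⟩
  · have dlab := @labels_distinct Loc Val _
    have nB : ∀ l ∈ B, ¬ l.IsLock := by
      intro l hl
      obtain ⟨x, v, rfl⟩ := hB l hl
      simp [Label.IsLock, Label.IsRLock, Label.IsWLock]
    simp only [layers, List.pairwise_append]
    refine ⟨hd, ⟨dlab _ _ fun _ _ => by simp, ⟨dlab _ _ fun _ _ => by simp,
      ⟨?_, dlab _ _ fun _ _ => by simp, ?_⟩, ?_⟩, ?_⟩, ?_⟩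
    · exact List.pairwise_iff_forall_sublist.2 fun {a b} hs h =>
        (nB a (hs.subset (by simp)) h).elim
    · intro a ha b _ h; exact (nB a ha h).elim
    · rintro a ha b hb - rfl
      obtain ⟨x, -, rfl⟩ := mem_labels.1 ha
      simp only [List.mem_append, mem_labels] at hb
      rcases hb with hb | ⟨_, _, hb⟩
      · exact (hBn _ hb x (m x)).2.1 rfl
      · simp at hb
    · rintro a ha b hb - rfl
      obtain ⟨x, -, rfl⟩ := mem_labels.1 ha
      simp only [List.mem_append, mem_labels] at hb
      rcases hb with ⟨_, _, hb⟩ | hb | ⟨_, _, hb⟩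
      · simp at hb
      · exact (hBn _ hb x (m x)).1 rfl
      · simp at hb
    · rintro a ha b hb - rfl
      have := hAn a ha
      simp only [List.mem_append, mem_labels] at hb
      rcases hb with ⟨x, _, rfl⟩ | ⟨x, _, rfl⟩ | hb | ⟨x, _, rfl⟩
      · exact (this x).1 rfl
      · exact (this x).2.1 rfl
      · obtain ⟨x, v, rfl⟩ := hB a hb
        obtain ⟨_, _, h | h⟩ := hA _ ha <;> simp at h
      · exact (this x).2.2.1 rfl
  · intro x y hxy
    simp only [layers, List.mem_append, mem_labels] at hxy
    rcases hxy with h | ⟨_, _, h⟩ | ⟨_, _, h⟩ | h | ⟨_, _, h⟩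
    · exact hload _ _ h
    · simp at h
    · simp at h
    · exact ((hBn _ h x y).2.2.2.2.2 rfl).elim
    · simp at h
  · intro x hx
    simp only [layers, List.mem_append, mem_labels] at hx
    rcases hx with h | ⟨_, _, h⟩ | ⟨_, _, h⟩ | h | ⟨_, _, h⟩
    · exact hrl _ h
    · simp at h
    · simp at h
    · exact ((hBn _ h x (m x)).2.2.2.2.1 rfl).elim
    · simp at h
  · intro x
    rw [← hru]
    constructor
    · intro hx
      simp only [layers, List.mem_append, mem_labels] at hx
      rcases hx with h | ⟨_, h1, h⟩ | ⟨_, _, h⟩ | h | ⟨_, _, h⟩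
      · exact ((hAn _ h x).1 rfl).elim
      · cases h; exact h1
      · simp at h
      · exact ((hBn _ h x (m x)).1 rfl).elim
      · simp at h
    · intro hx
      simp [layers, mem_labels, hx]
  · intro x hx
    rw [← hws]
    simp only [layers, List.mem_append, mem_labels] at hx
    rcases hx with h | ⟨_, _, h⟩ | ⟨_, h1, h⟩ | h | ⟨_, _, h⟩
    · exact ((hAn _ h x).2.1 rfl).elim
    · simp at h
    · cases h; exact h1
    · exact ((hBn _ h x (m x)).2.1 rfl).elim
    · simp at h
  · intro x
    rw [← hws]
    constructor
    · intro hx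
      simp only [layers, List.mem_append, mem_labels] at hx
      rcases hx with h | ⟨_, _, h⟩ | ⟨_, h1, h⟩ | h | ⟨_, h1, h⟩
      · exact ((hAn _ h x).2.2.1 rfl).elim
      · simp at h
      · simp at h
      · exact ((hBn _ h x (m x)).2.2.1 rfl).elim
      · cases h; exact h1
    · intro hx
      simp [layers, mem_labels, hx]
  · intro x hx
    simp only [layers, List.mem_append, mem_labels] at hx
    rcases hx with h | ⟨_, _, h⟩ | ⟨_, h1, h⟩ | h | ⟨_, h1, h⟩
    · exact ((hAn _ h x).2.2.2 rfl).elim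
    · simp at h
    · simp at h
    · exact ((hBn _ h x (m x)).2.2.2.1 rfl).elim
    · simp at h

end Layers

/-! ### The eager translation of transaction bodies -/

section Translation

variable {Reg Loc Val : Type*} [LinearOrder Loc] [DecidableEq Reg] [Zero Val]

/-- The snapshot as a total function; the default value `0` is what implementations read from
an entry that has not been recorded. -/
def LState.val (s : LState Reg Loc Val) (x : Loc) : Val := (s.snap x).getD 0

/-- What a run of the eager translation of a body has in common with a run of the body. -/
def EagerSim (T : Body Reg Loc Val) (s : LState Reg Loc Val) (u : List (Label Loc Val))
    (s' : LState Reg Loc Val) : Prop :=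
  ∃ t, BRun T s.regs t s'.regs ∧ u = stores t ∧ Legal s.val t ∧ s'.val = memAfter s.val t

/-- The eager translation of a body accesses shared memory only by the stores of the body; its reads
are served by the snapshot, which is kept up to date with these stores. -/
theorem eagerBody_sound {T : Body Reg Loc Val} {s s' : LState Reg Loc Val}
    {u : List (Label Loc Val)} (h : Run (eagerBody T) s u s') : EagerSim T s u s' := by
  induction T generalizing s u s' with
  | skip =>
    obtain ⟨rfl, rfl⟩ := run_skip.1 h
    exact ⟨[], .skip _, rfl, legal_nil _, rfl⟩
  | assign r e =>
    obtain ⟨rfl, rfl⟩ := run_upd.1 h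
    exact ⟨[], .assign _ _ _, rfl, legal_nil _, rfl⟩
  | rd r x =>
    obtain ⟨rfl, rfl⟩ := run_upd.1 h
    exact ⟨[.R x (s.val x)], .rd _ _ _ _, rfl, legal_R.2 rfl, rfl⟩
  | wr x e =>
    obtain ⟨t₁, s₁, t₂, h₁, h₂, rfl⟩ := run_seq.1 h
    obtain ⟨rfl, rfl⟩ := run_store.1 h₁
    obtain ⟨rfl, rfl⟩ := run_upd.1 h₂
    refine ⟨[.W x (e s₁.regs)], .wr _ _ _, rfl, legal_W, ?_⟩
    funext y
    by_cases hy : y = x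
    · subst hy; simp [LState.val, memAfter]
    · simp [LState.val, memAfter, hy]
  | seq c d ihc ihd =>
    obtain ⟨t₁, s₁, t₂, h₁, h₂, rfl⟩ := run_seq.1 h
    obtain ⟨t, ht, rfl, hl, hm⟩ := ihc h₁
    obtain ⟨t', ht', rfl, hl', hm'⟩ := ihd h₂
    exact ⟨t ++ t', .seq ht ht', (stores_append _ _).symm, legal_append.2 ⟨hl, hm ▸ hl'⟩,
      by rw [hm', hm, memAfter_append]⟩
  | cond b c d ihc ihd =>
    rcases run_cond.1 h with ⟨hb, h⟩ | ⟨hb, h⟩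
    · obtain ⟨t, ht, h⟩ := ihc h
      exact ⟨t, .cond_true hb ht, h⟩
    · obtain ⟨t, ht, h⟩ := ihd h
      exact ⟨t, .cond_false hb ht, h⟩
  | loop b c ih =>
    refine Run.loop_induction (fun s hs => ⟨[], .loop_false hs, rfl, legal_nil _, rfl⟩) ?_ h
    rintro s₁ s₂ s₃ t₁ t₂ hb h₁ ⟨t', ht', rfl, hl', hm'⟩
    obtain ⟨t, ht, rfl, hl, hm⟩ := ih h₁
    exact ⟨t ++ t', .loop_true hb ht ht', (stores_append _ _).symm,
      legal_append.2 ⟨hl, hm ▸ hl'⟩, by rw [hm', hm, memAfter_append]⟩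

/-- A run of a body whose reads agree with the snapshot can be followed by the eager translation. -/
theorem eagerBody_complete {T : Body Reg Loc Val} {σ σ' : Reg → Val} {t : List (Label Loc Val)}
    (h : BRun T σ t σ') (s : LState Reg Loc Val) (hs : s.regs = σ) (hl : Legal s.val t) :
    ∃ s', Run (eagerBody T) s (stores t) s' ∧ s'.regs = σ' ∧ s'.val = memAfter s.val t := by
  induction h generalizing s with
  | skip => exact ⟨s, .skip _, hs, rfl⟩
  | assign r e σ => subst hs; exact ⟨_, .upd _ _, rfl, rfl⟩
  | rd r x v σ =>
    subst hs
    refine ⟨_, .upd _ _, ?_, rfl⟩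
    rw [legal_R.1 hl]; rfl
  | wr x e σ =>
    subst hs
    refine ⟨_, .seq (.store _ _ _) (.upd _ _), rfl, ?_⟩
    funext y
    by_cases hy : y = x
    · subst hy; simp [LState.val, memAfter]
    · simp [LState.val, memAfter, hy]
  | seq _ _ ih₁ ih₂ =>
    obtain ⟨hl₁, hl₂⟩ := legal_append.1 hl
    obtain ⟨s₁, r₁, e₁, m₁⟩ := ih₁ s hs hl₁
    obtain ⟨s₂, r₂, e₂, m₂⟩ := ih₂ s₁ e₁ (m₁ ▸ hl₂)
    exact ⟨s₂, by rw [stores_append]; exact .seq r₁ r₂, e₂, by rw [m₂, m₁, memAfter_append]⟩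
  | cond_true hb _ ih =>
    subst hs
    obtain ⟨s', h, h'⟩ := ih s rfl hl
    exact ⟨s', .cond_true hb h, h'⟩
  | cond_false hb _ ih =>
    subst hs
    obtain ⟨s', h, h'⟩ := ih s rfl hl
    exact ⟨s', .cond_false hb h, h'⟩
  | loop_false hb => subst hs; exact ⟨s, .loop_false hb, rfl, rfl⟩
  | loop_true hb _ _ ih₁ ih₂ =>
    obtain ⟨hl₁, hl₂⟩ := legal_append.1 hl
    obtain ⟨s₁, r₁, e₁, m₁⟩ := ih₁ s hs hl₁
    obtain ⟨s₂, r₂, e₂, m₂⟩ := ih₂ s₁ e₁ (m₁ ▸ hl₂)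
    subst hs
    exact ⟨s₂, by rw [stores_append]; exact .loop_true hb r₁ r₂, e₂,
      by rw [m₂, m₁, memAfter_append]⟩

end Translation

/-! ### The eager implementation of transactions -/

section Eager

variable {Loc Val : Type*}

theorem mem_stores_isWrite {t : List (Label Loc Val)} : ∀ l ∈ stores t, ∃ x v, l = .W x v :=
  fun _ hl => (mem_stores.1 hl).2

variable [LinearOrder Loc]

/-- The trace `u` is that of failed attempts, which do not store anything, followed by a
successful attempt to execute a transaction with accesses `t`. -/
def Committed (t u : List (Label Loc Val)) : Prop :=
  ∃ m F v, u = F ++ v ∧ (∀ l ∈ F, l.valW = none) ∧ Block m t v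

theorem layers_eager_labels {rs ws : Finset Loc} {m : Loc → Val} :
    ∀ l ∈ labels .RL (rs ∪ ws) ++ labels (fun x => .R x (m x)) rs,
      ∃ x v, l = Label.RL x ∨ l = .R x v := by
  intro l hl
  simp only [List.mem_append, mem_labels] at hl
  rcases hl with ⟨x, -, rfl⟩ | ⟨x, -, rfl⟩
  · exact ⟨x, m x, .inl rfl⟩
  · exact ⟨x, m x, .inr rfl⟩

theorem eager_block {t : List (Label Loc Val)} {rs ws : Finset Loc} {m : Loc → Val}
    (hl : Legal m t) (hr : readsFirst t ⊆ ↑rs) (hw : writesOf t ⊆ ↑ws) :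
    Block m t (layers (labels .RL (rs ∪ ws) ++ labels (fun x => .R x (m x)) rs)
      (rs \ ws) ws (stores t)) := by
  refine layers_block hl layers_eager_labels mem_stores_isWrite (fun m' => memAfter_stores m' t)
    (writesOf_stores t) ?_ ?_ ?_
  · rintro x (hx | hx)
    · exact List.mem_append_left _ (mem_labels.2 ⟨x, Finset.mem_union_left _ (hr hx), rfl⟩)
    · exact List.mem_append_left _ (mem_labels.2 ⟨x, Finset.mem_union_right _ (hw hx), rfl⟩)
  · intro x hx
    obtain ⟨a, b, hab⟩ := List.append_of_mem
      (mem_labels (g := fun x => Label.R x (m x)).2 ⟨x, hr hx, rfl⟩)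
    refine ⟨labels .RL (rs ∪ ws) ++ a, b, by simp [hab], ?_⟩
    exact List.mem_append_left _ (mem_labels.2 ⟨x, Finset.mem_union_left _ (hr hx), rfl⟩)
  · intro x hx
    have := hw hx
    simp_all

variable {Reg : Type*} [Zero Val]

/-- An attempt of the eager implementation to take the snapshot and to lock the write set. -/
abbrev eagerAttempt (rs ws : Finset Loc) : Com (LState Reg Loc Val) Loc Val :=
  .seq (.upd fun s => { s with LS := ∅, ok := true }) <|
  .seq (.each (fun _ => rs ∪ ws) .lockR) <|
  .seq (.each (fun _ => rs) fun x =>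
    .load x fun s v => { s with snap := Function.update s.snap x (some v) }) <|
  .seq (.each (fun _ => rs \ ws) .unlockR) <|
  promoteAll fun _ => ws

theorem eagerAttempt_sound {rs ws : Finset Loc} {s s' : LState Reg Loc Val}
    {u : List (Label Loc Val)} (h : Run (eagerAttempt rs ws) s u s') :
    s'.regs = s.regs ∧ (∀ l ∈ u, l.valW = none) ∧
      (s'.ok = true → ∃ m : Loc → Val, (∀ x ∈ rs, s'.val x = m x) ∧
        u = labels .RL (rs ∪ ws) ++ (labels (fun x => .R x (m x)) rs ++
          (labels .RU (rs \ ws) ++ labels .PL ws))) := by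
  obtain ⟨_, _, _, h₁, h, rfl⟩ := run_seq.1 h
  obtain ⟨rfl, rfl⟩ := run_upd.1 h₁
  obtain ⟨_, _, _, h₁, h, rfl⟩ := run_seq.1 h
  obtain ⟨rfl, rfl⟩ := (run_each_emit (g := .RL) fun _ _ _ => run_lockR).1 h₁
  obtain ⟨_, _, _, h₁, h, rfl⟩ := run_seq.1 h
  obtain ⟨m, rfl, rfl⟩ := (run_loads (Finset.sort_nodup _ _) 0).1 (run_each.1 h₁)
  obtain ⟨_, _, _, h₁, h, rfl⟩ := run_seq.1 h
  obtain ⟨rfl, rfl⟩ := (run_each_emit (g := .RU) fun _ _ _ => run_unlockR).1 h₁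
  obtain ⟨⟨h₁, h₂, h₃, h₄, h₅⟩, hl, hk⟩ := run_promoteAll h
  refine ⟨h₁, ?_, fun hk' => ⟨m, fun x hx => ?_, ?_⟩⟩
  · intro l h
    simp only [List.nil_append, List.mem_append] at h
    rcases h with h | h | h | h
    · exact valW_of_mem_labels (fun _ => rfl) l h
    · exact valW_of_mem_labels (g := fun x => .R x (m x)) (fun _ => rfl) l h
    · exact valW_of_mem_labels (fun _ => rfl) l h
    · exact (hl l h).2
  · simp [LState.val, h₃, hx]
  · rw [hk hk']; rfl

theorem eagerAttempt_complete (rs ws : Finset Loc) (s : LState Reg Loc Val) (m : Loc → Val) :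
    ∃ s', Run (eagerAttempt rs ws) s (labels .RL (rs ∪ ws) ++ (labels (fun x => .R x (m x)) rs ++
          (labels .RU (rs \ ws) ++ labels .PL ws))) s' ∧ s'.regs = s.regs ∧
      (∀ x ∈ rs, s'.val x = m x) ∧ s'.ok = true := by
  obtain ⟨s', h, ⟨h₁, h₂, h₃, h₄, h₅⟩, hk⟩ := promoteAll_success (fun _ => ws)
    (s := { s with
      snap := fun x => if x ∈ rs.sort (· ≤ ·) then some (m x) else s.snap x, LS := ∅, ok := true })
    rfl
  refine ⟨s', ?_, h₁, fun x hx => by simp [LState.val, h₃, hx], hk⟩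
  refine .seq (t₁ := []) (.upd _ _) (.seq ((run_each_emit fun _ _ _ => run_lockR).2 ⟨rfl, rfl⟩)
    (.seq (run_each.2 ((run_loads (Finset.sort_nodup _ _) 0).2 ⟨m, rfl, rfl⟩))
      (.seq ((run_each_emit fun _ _ _ => run_unlockR).2 ⟨rfl, rfl⟩) h)))


variable [DecidableEq Reg]

/-- If the supplied sets cover the accesses of `T`, then a run of the eager implementation consists
of failed attempts and a block for a run of `T`. -/
theorem eagerTx_sound {T : Body Reg Loc Val} {rs ws : Finset Loc}
    (hc : ∀ σ t σ', BRun T σ t σ' → readsFirst t ⊆ ↑rs ∧ writesOf t ⊆ ↑ws)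
    {s s' : LState Reg Loc Val} {u : List (Label Loc Val)} (h : Run (eagerTx T rs ws) s u s') :
    ∃ t, BRun T s.regs t s'.regs ∧ Committed t u := by
  obtain ⟨_, _, _, h₀, h', rfl⟩ := run_seq.1 h
  obtain ⟨rfl, rfl⟩ := run_upd.1 h₀
  obtain ⟨_, s₁, _, h₁, h₂, rfl⟩ := run_seq.1 h'
  obtain ⟨F, s₂, w, rfl, hF, hI, hw, hk⟩ := run_retry (c := eagerAttempt rs ws)
    (s := { s with ok := false })
    (I := fun s₁ => s₁.regs = s.regs) (Q := fun l => l.valW = none)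
    (fun s₁ t s₂ hI hr => by
      obtain ⟨a, b, -⟩ := eagerAttempt_sound hr
      exact ⟨a.trans hI, b⟩) rfl rfl h₁
  obtain ⟨e, -, hm'⟩ := eagerAttempt_sound hw
  obtain ⟨m, hm, rfl⟩ := hm' hk
  obtain ⟨_, _, _, h₃, h₄, rfl⟩ := run_seq.1 h₂
  obtain ⟨t, ht, rfl, hl, -⟩ := eagerBody_sound h₃
  obtain ⟨rfl, rfl⟩ := (run_each_emit (g := .WU) fun _ _ _ => run_unlockW).1 h₄
  obtain ⟨hr, hw⟩ := hc _ _ _ ht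
  refine ⟨t, by rw [← hI, ← e]; exact ht, m, F, _, ?_, hF,
    eager_block (hl.congr fun x hx => hm x (hr hx)) hr hw⟩
  simp [layers]

/-- If the supplied sets are exact, then a run of `T` can be followed by one successful attempt of
the eager implementation. Exactness excludes superfluous lock calls. -/
theorem eagerTx_complete {T : Body Reg Loc Val} {rs ws : Finset Loc} {t : List (Label Loc Val)}
    (hc : readsFirst t ⊆ ↑rs ∧ ↑rs ⊆ readsOf t ∧ writesOf t = ↑ws) {σ σ' : Reg → Val}
    (h : BRun T σ t σ') {m : Loc → Val} (hl : Legal m t) (s : LState Reg Loc Val)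
    (hs : s.regs = σ) :
    ∃ u s', Run (eagerTx T rs ws) s u s' ∧ s'.regs = σ' ∧ ExactBlock m t u := by
  obtain ⟨hr, hr', hw⟩ := hc
  obtain ⟨s₁, h₁, e₁, hm₁, hk⟩ := eagerAttempt_complete rs ws { s with ok := false } m
  obtain ⟨s₂, h₂, e₂, -⟩ := eagerBody_complete h s₁ (e₁.trans hs)
    (hl.congr fun x hx => (hm₁ x (hr hx)).symm)
  have hb := eager_block (rs := rs) hl hr hw.subset
  have hmem : ∀ x, x ∈ rs ∪ ws ↔ x ∈ accessed t := by
    intro x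
    have h1 : x ∈ ws ↔ x ∈ writesOf t := by rw [hw]; simp
    simp only [Finset.mem_union, accessed, Set.mem_union, h1]
    constructor
    · rintro (h | h)
      · exact readsOf_subset (hr' h)
      · exact .inr h
    · rintro (h | h)
      · exact .inl (hr h)
      · exact .inr h
  have hws : ∀ x, x ∈ ws ↔ x ∈ writesOf t := fun x => by rw [hw]; simp
  refine ⟨_, s₂, ?_, e₂, layers_exactBlock hb layers_eager_labels mem_stores_isWrite
    ?_ ?_ ?_ hws ?_⟩
  · have : Run (eagerTx T rs ws) s _ s₂ := Run.seq (t₁ := [])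
      (.upd (fun s : LState Reg Loc Val => { s with ok := false }) s)
      (.seq (retry_success rfl h₁ hk) (.seq h₂
        ((run_each_emit (A := fun _ => ws) (g := .WU) fun _ _ _ => run_unlockW).2 ⟨rfl, rfl⟩)))
    simpa [layers] using this
  · have nd := @labels_distinct Loc Val _
    refine List.pairwise_append.2 ⟨nd _ _ fun _ _ => by simp, nd _ _ fun _ _ h => ?_, ?_⟩
    · exact (Label.R.inj h).1
    · rintro a ha b hb - rfl
      obtain ⟨x, -, rfl⟩ := mem_labels.1 ha
      obtain ⟨y, -, h⟩ := mem_labels.1 hb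
      simp at h
  · intro x hx
    simp only [List.mem_append, mem_labels] at hx
    rcases hx with ⟨y, hy, h⟩ | ⟨y, hy, h⟩
    · cases h; exact (hmem x).1 hy
    · simp at h
  · intro x y hx
    simp only [List.mem_append, mem_labels] at hx
    rcases hx with ⟨z, hz, h⟩ | ⟨z, hz, h⟩
    · simp at h
    · cases h; exact ⟨rfl, (hmem x).1 (Finset.mem_union_left _ hz)⟩
  · intro x
    rw [← hmem, ← hws]
    simp only [Finset.mem_sdiff, Finset.mem_union]
    tauto

end Eager

/-! ### The lazy translation of transaction bodies -/

section Lazy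

theorem readsFirst_R {Loc Val : Type*} {x : Loc} {v : Val} {y : Loc} :
    y ∈ readsFirst [Label.R x v] ↔ y = x := by
  constructor
  · intro h
    obtain ⟨w, hw⟩ := readsFirst_subset_readsOf h
    simp at hw; exact hw.1
  · rintro rfl
    exact ⟨[], v, [], rfl, by simp [writesOf]⟩

theorem readsFirst_W {Loc Val : Type*} {x : Loc} {v : Val} {y : Loc} :
    y ∉ readsFirst [Label.W x v] := by
  intro h
  obtain ⟨w, hw⟩ := readsFirst_subset_readsOf h
  simp at hw

variable {Reg Loc Val : Type*} [LinearOrder Loc] [Zero Val]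

/-- The locations that have an entry in the snapshot of the lazy implementation. -/
def LState.known (s : LState Reg Loc Val) : Set Loc := {x | x ∈ s.RS ∨ x ∈ s.WS}

/-- A run of the lazy translation of a body that has the accesses `t`, given that the locations that
it locks have the values `m`. -/
structure LazyRun (s : LState Reg Loc Val) (u : List (Label Loc Val))
    (s' : LState Reg Loc Val) (t : List (Label Loc Val)) (m : Loc → Val) : Prop where
  saved : s'.saved = s.saved
  ok : s'.ok = s.ok
  mem_RS : ∀ x, x ∈ s'.RS ↔ x ∈ s.RS ∨ (x ∉ s.WS ∧ x ∈ readsFirst t)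
  mem_WS : ∀ x, x ∈ s'.WS ↔ x ∈ s.WS ∨ x ∈ writesOf t
  val' : ∀ x ∈ s'.known, s'.val x = memAfter m t x
  shape : ∀ l ∈ u, ∃ x v, l = .RL x ∨ l = .R x v
  rl_iff : ∀ x, Label.RL x ∈ u ↔ x ∈ accessed t ∧ x ∉ s.known
  loads : ∀ x y, Label.R x y ∈ u → y = m x ∧ x ∈ accessed t ∧ x ∉ s.known
  load : ∀ x ∈ readsFirst t, x ∉ s.known →
    ∃ u₁ u₂, u = u₁ ++ Label.R x (m x) :: u₂ ∧ Label.RL x ∈ u₁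
  distinct : u.Pairwise fun a b => a.IsLock → a ≠ b

theorem LazyRun.mem_known {s s' : LState Reg Loc Val} {u t : List (Label Loc Val)} {m : Loc → Val}
    (h : LazyRun s u s' t m) {x : Loc} : x ∈ s'.known ↔ x ∈ s.known ∨ x ∈ accessed t := by
  have h₁ : x ∈ s'.known ↔ x ∈ s'.RS ∨ x ∈ s'.WS := Iff.rfl
  have h₂ : x ∈ s.known ↔ x ∈ s.RS ∨ x ∈ s.WS := Iff.rfl
  have h₃ : x ∈ accessed t ↔ x ∈ readsFirst t ∨ x ∈ writesOf t := Iff.rfl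
  rw [h₁, h₂, h₃, h.mem_RS, h.mem_WS]
  tauto

theorem lazyRun_id {s s' : LState Reg Loc Val} {m : Loc → Val} (hm : ∀ x ∈ s.known, s.val x = m x)
    (h₁ : s'.saved = s.saved) (h₂ : s'.snap = s.snap) (h₃ : s'.RS = s.RS) (h₄ : s'.WS = s.WS)
    (h₅ : s'.ok = s.ok) : LazyRun s [] s' [] m where
  saved := h₁
  ok := h₅
  mem_RS := by simp [h₃, readsFirst]
  mem_WS := by simp [h₄, writesOf]
  val' := by
    intro x hx
    have := hm x (by simpa [LState.known, h₃, h₄] using hx)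
    simpa [LState.val, h₂, memAfter] using this
  shape := by simp
  rl_iff := by simp [accessed, readsFirst, writesOf]
  loads := by simp
  load := by simp [readsFirst]
  distinct := .nil

theorem LazyRun.seq {s₁ s₂ s₃ : LState Reg Loc Val}
    {u₁ u₂ t₁ t₂ : List (Label Loc Val)} {m : Loc → Val} (h₁ : LazyRun s₁ u₁ s₂ t₁ m)
    (h₂ : LazyRun s₂ u₂ s₃ t₂ (memAfter m t₁)) : LazyRun s₁ (u₁ ++ u₂) s₃ (t₁ ++ t₂) m := by
  have hm : ∀ x, x ∉ s₂.known → memAfter m t₁ x = m x := fun x hx =>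
    memAfter_of_notMem (fun h => hx (h₁.mem_known.2 (.inr (.inr h)))) m
  refine ⟨h₂.saved.trans h₁.saved, h₂.ok.trans h₁.ok, ?_, ?_, ?_, ?_, ?_, ?_, ?_, ?_⟩
  · intro x
    rw [h₂.mem_RS, h₁.mem_RS, h₁.mem_WS, mem_readsFirst_append]
    tauto
  · intro x
    rw [h₂.mem_WS, h₁.mem_WS, mem_writesOf_append, or_assoc]
  · intro x hx
    rw [memAfter_append]
    exact h₂.val' x hx
  · intro l hl
    rcases List.mem_append.1 hl with hl | hl
    · exact h₁.shape l hl
    · exact h₂.shape l hl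
  · intro x
    rw [List.mem_append, h₁.rl_iff, h₂.rl_iff, h₁.mem_known, accessed_append]
    tauto
  · intro x y hx
    rcases List.mem_append.1 hx with hx | hx
    · obtain ⟨a, b, c⟩ := h₁.loads x y hx
      exact ⟨a, accessed_append.2 (.inl b), c⟩
    · obtain ⟨a, b, c⟩ := h₂.loads x y hx
      exact ⟨a.trans (hm x c), accessed_append.2 (.inr b), fun h => c (h₁.mem_known.2 (.inl h))⟩
  · intro x hx hk
    by_cases hx' : x ∈ readsFirst t₁
    · obtain ⟨a, b, rfl, hl⟩ := h₁.load x hx' hk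
      exact ⟨a, b ++ u₂, by simp, hl⟩
    · obtain ⟨hw, hr⟩ := (mem_readsFirst_append.1 hx).resolve_left hx'
      have hk₂ : x ∉ s₂.known := fun h => by
        rcases h₁.mem_known.1 h with h | h | h
        · exact hk h
        · exact hx' h
        · exact hw h
      obtain ⟨a, b, rfl, hl⟩ := h₂.load x hr hk₂
      exact ⟨u₁ ++ a, b, by simp [hm x hk₂], List.mem_append_right _ hl⟩
  · refine List.pairwise_append.2 ⟨h₁.distinct, h₂.distinct, ?_⟩
    rintro a ha b hb hlock rfl
    obtain ⟨x, v, rfl | rfl⟩ := h₁.shape a ha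
    · exact ((h₂.rl_iff x).1 hb).2 (h₁.mem_known.2 (.inr ((h₁.rl_iff x).1 ha).1))
    · simp [Label.IsLock, Label.IsRLock, Label.IsWLock] at hlock

variable [DecidableEq Reg]

/-- What a run of the lazy translation of a body has in common with a run of the body. The function
`m` assigns to every location the value that it had (or would have had) when it was locked. -/
structure LazySim (T : Body Reg Loc Val) (s : LState Reg Loc Val) (u : List (Label Loc Val))
    (s' : LState Reg Loc Val) (t : List (Label Loc Val)) (m : Loc → Val) : Prop where
  run : BRun T s.regs t s'.regs
  saved : s'.saved = s.saved
  mem_WS : ∀ x, x ∈ s'.WS ↔ x ∈ s.WS ∨ x ∈ writesOf t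
  RS_mono : ∀ x ∈ s.RS, x ∈ s'.RS
  shape : ∀ l ∈ u, ∃ x v, l = .RL x ∨ l = .R x v
  val : ∀ x ∈ s.known, s.val x = m x
  legal : Legal m t
  val' : ∀ x ∈ s'.known, s'.val x = memAfter m t x
  load : ∀ x ∈ s'.RS, x ∈ s.RS ∨
    (x ∉ s.WS ∧ ∃ u₁ u₂, u = u₁ ++ Label.R x (m x) :: u₂ ∧ Label.RL x ∈ u₁)
  lock : ∀ x ∈ s'.known, x ∈ s.known ∨ Label.RL x ∈ u
  reads : ∀ x ∈ readsFirst t, x ∈ s'.RS ∨ x ∈ s.WS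

theorem LazySim.known_mono {T : Body Reg Loc Val} {s : LState Reg Loc Val}
    {u : List (Label Loc Val)} {s' : LState Reg Loc Val} {t : List (Label Loc Val)}
    {m : Loc → Val} (h : LazySim T s u s' t m) {x : Loc} (hx : x ∈ s.known) : x ∈ s'.known := by
  rcases hx with hx | hx
  · exact .inl (h.RS_mono x hx)
  · exact .inr ((h.mem_WS x).2 (.inl hx))

theorem lazySim_id {T : Body Reg Loc Val} {s s' : LState Reg Loc Val} (h : BRun T s.regs [] s'.regs)
    (h₁ : s'.saved = s.saved) (h₂ : s'.snap = s.snap) (h₃ : s'.RS = s.RS) (h₄ : s'.WS = s.WS) :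
    LazySim T s [] s' [] s.val where
  run := h
  saved := h₁
  mem_WS := by simp [h₄, writesOf]
  RS_mono := by simp [h₃]
  shape := by simp
  val := by simp
  legal := legal_nil _
  val' := by simp [LState.val, h₂, memAfter]
  load := by intro x hx; exact .inl (h₃ ▸ hx)
  lock := by simp [LState.known, h₃, h₄]
  reads := by simp [readsFirst]

theorem LazySim.seq {T c d : Body Reg Loc Val} {s₁ s₂ s₃ : LState Reg Loc Val}
    {u₁ u₂ t₁ t₂ : List (Label Loc Val)} {m₁ m₂ : Loc → Val} (h₁ : LazySim c s₁ u₁ s₂ t₁ m₁)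
    (h₂ : LazySim d s₂ u₂ s₃ t₂ m₂) (hT : BRun T s₁.regs (t₁ ++ t₂) s₃.regs) :
    ∃ m, LazySim T s₁ (u₁ ++ u₂) s₃ (t₁ ++ t₂) m := by
  classical
  -- Locations locked by the second part have not been touched by the first one.
  let m : Loc → Val := fun x => if x ∈ s₂.known then m₁ x else m₂ x
  have hr : ∀ x ∈ readsFirst t₁, x ∈ s₂.known := by
    intro x hx
    rcases h₁.reads x hx with h | h
    · exact .inl h
    · exact .inr ((h₁.mem_WS x).2 (.inl h))
  have hw : ∀ x ∈ writesOf t₁, x ∈ s₂.known := fun x hx => .inr ((h₁.mem_WS x).2 (.inr hx))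
  have hm : memAfter m t₁ = m₂ := by
    funext x
    by_cases hx : x ∈ s₂.known
    · rw [← h₂.val x hx, h₁.val' x hx]
      exact memAfter_congr fun _ => by simp [m, hx]
    · rw [memAfter_of_notMem fun h => hx (hw x h)]
      simp [m, hx]
  refine ⟨m, hT, h₂.saved.trans h₁.saved, ?_, fun x hx => h₂.RS_mono x (h₁.RS_mono x hx), ?_, ?_,
    ?_, ?_, ?_, ?_, ?_⟩
  · intro x
    rw [h₂.mem_WS, h₁.mem_WS, mem_writesOf_append, or_assoc]
  · intro l hl
    rcases List.mem_append.1 hl with hl | hl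
    · exact h₁.shape l hl
    · exact h₂.shape l hl
  · intro x hx
    have := h₁.known_mono hx
    simp [m, this, h₁.val x hx]
  · refine legal_append.2 ⟨h₁.legal.congr fun x hx => by simp [m, hr x hx], ?_⟩
    rw [hm]; exact h₂.legal
  · intro x hx
    rw [memAfter_append, hm]
    exact h₂.val' x hx
  · intro x hx
    rcases h₂.load x hx with hx | ⟨hx, a, b, rfl, hl⟩
    · rcases h₁.load x hx with hx' | ⟨hx', a, b, rfl, hl⟩
      · exact .inl hx'
      · have : m x = m₁ x := by simp [m, show x ∈ s₂.known from .inl hx]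
        exact .inr ⟨hx', a, b ++ u₂, by simp [this], hl⟩
    · by_cases hx' : x ∈ s₂.RS
      · rcases h₁.load x hx' with hx' | ⟨hx₁, a', b', rfl, hl'⟩
        · exact .inl hx'
        · have : m x = m₁ x := by simp [m, show x ∈ s₂.known from .inl hx']
          exact .inr ⟨hx₁, a', _, by
            rw [this]; simp only [List.append_assoc, List.cons_append]; rfl, hl'⟩
      · have : m x = m₂ x := by simp [m, LState.known, hx, hx']
        exact .inr ⟨fun h => hx ((h₁.mem_WS x).2 (.inl h)), u₁ ++ a, b, by simp [this],
          List.mem_append_right _ hl⟩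
  · intro x hx
    rcases h₂.lock x hx with hx | hx
    · rcases h₁.lock x hx with hx | hx
      · exact .inl hx
      · exact .inr (List.mem_append_left _ hx)
    · exact .inr (List.mem_append_right _ hx)
  · intro x hx
    rcases mem_readsFirst_append.1 hx with hx | ⟨hn, hx⟩
    · rcases h₁.reads x hx with h | h
      · exact .inl (h₂.RS_mono x h)
      · exact .inr h
    · rcases h₂.reads x hx with h | h
      · exact .inl h
      · exact .inr (((h₁.mem_WS x).1 h).resolve_right hn)

/-- The reads of the lazy translation are the reads of a run of the body on a memory `m` that is
assembled from the values loaded at different moments. -/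
theorem lazyBody_sound {T : Body Reg Loc Val} {s s' : LState Reg Loc Val}
    {u : List (Label Loc Val)} (h : Run (lazyBody T) s u s') : ∃ t m, LazySim T s u s' t m := by
  induction T generalizing s u s' with
  | skip =>
    obtain ⟨rfl, rfl⟩ := run_skip.1 h
    exact ⟨_, _, lazySim_id (.skip _) rfl rfl rfl rfl⟩
  | assign r e =>
    obtain ⟨rfl, rfl⟩ := run_upd.1 h
    exact ⟨_, _, lazySim_id (.assign _ _ _) rfl rfl rfl rfl⟩
  | rd r x =>
    obtain ⟨_, s₁, _, h₁, h₂, rfl⟩ := run_seq.1 h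
    obtain ⟨rfl, rfl⟩ := run_upd.1 h₂
    rcases run_cond.1 h₁ with ⟨hb, h₃⟩ | ⟨hb, h₃⟩
    · obtain ⟨_, s₂, _, h₄, h₅, rfl⟩ := run_seq.1 h₃
      obtain ⟨rfl, rfl⟩ := run_lockR.1 h₄
      obtain ⟨_, _, _, h₆, h₇, rfl⟩ := run_seq.1 h₅
      obtain ⟨rfl, rfl⟩ := run_upd.1 h₆
      obtain ⟨v, rfl, rfl⟩ := run_load.1 h₇
      simp only [Finset.mem_union] at hb
      -- The value `v` loaded takes the place of the default value in the snapshot.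
      refine ⟨[.R x v], Function.update s₂.val x v, ?_, rfl, ?_, ?_, ?_, ?_, ?_, ?_, ?_, ?_, ?_⟩
      · have := BRun.rd r x v s₂.regs
        simpa using this
      · simp [writesOf]
      · intro y hy; simp [hy]
      · intro l hl
        simp only [List.append_nil, List.cons_append, List.nil_append, List.mem_cons,
          List.not_mem_nil, or_false] at hl
        rcases hl with rfl | rfl
        · exact ⟨x, v, .inl rfl⟩
        · exact ⟨x, v, .inr rfl⟩
      · intro y hy
        have : y ≠ x := by rintro rfl; exact hb hy
        simp [this]
      · rw [legal_R]; simp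
      · intro y hy
        by_cases hyx : y = x
        · subst hyx; simp [LState.val, memAfter]
        · simp [LState.val, memAfter, hyx]
      · intro y hy
        simp only [Finset.mem_insert] at hy
        rcases hy with rfl | hy
        · exact .inr ⟨fun h => hb (.inr h), [.RL y], [], by simp, by simp⟩
        · exact .inl hy
      · intro y hy
        simp only [LState.known, Finset.mem_insert] at hy
        rcases hy with (rfl | hy) | hy
        · simp
        · exact .inl (.inl hy)
        · exact .inl (.inr hy)
      · intro y hy
        rw [readsFirst_R] at hy
        simp [hy]
    · obtain ⟨rfl, rfl⟩ := run_skip.1 h₃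
      simp only [Finset.mem_union, not_not] at hb
      refine ⟨[.R x (s₁.val x)], s₁.val, ?_, rfl, ?_, ?_, ?_, ?_, ?_, ?_, ?_, ?_, ?_⟩
      · exact BRun.rd r x _ s₁.regs
      · simp [writesOf]
      · intro y hy; exact hy
      · simp
      · intro y hy; rfl
      · rw [legal_R]
      · intro y hy; rfl
      · intro y hy; exact .inl hy
      · intro y hy; exact .inl hy
      · intro y hy
        rw [readsFirst_R] at hy
        subst hy; exact hb
  | wr x e =>
    obtain ⟨u₁, s₁, _, h₁, h₂, rfl⟩ := run_seq.1 h
    obtain ⟨rfl, rfl⟩ := run_upd.1 h₂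
    obtain ⟨rfl, hu, hk⟩ : s₁ = s ∧ (∀ l ∈ u₁, ∃ x v, l = .RL x ∨ l = Label.R x v) ∧
        (x ∈ s.known ∨ Label.RL x ∈ u₁) := by
      rcases run_cond.1 h₁ with ⟨hb, h₁⟩ | ⟨hb, h₁⟩
      · obtain ⟨rfl, rfl⟩ := run_lockR.1 h₁
        refine ⟨rfl, ?_, by simp⟩
        rintro l hl
        exact ⟨x, 0, .inl (by simpa using hl)⟩
      · obtain ⟨rfl, rfl⟩ := run_skip.1 h₁
        refine ⟨rfl, by simp, .inl ?_⟩
        simpa [LState.known, imp_iff_not_or] using hb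
    refine ⟨[.W x (e s₁.regs)], s₁.val, .wr _ _ _, rfl, ?_, fun y hy => hy, by simpa using hu,
      fun y hy => rfl, legal_W, ?_, fun y hy => .inl hy, ?_, ?_⟩
    · intro y
      simp [writesOf, or_comm]
    · intro y hy
      by_cases hyx : y = x
      · subst hyx; simp [LState.val, memAfter]
      · simp [LState.val, memAfter, hyx]
    · intro y hy
      simp only [LState.known, Finset.mem_insert] at hy
      rcases hy with hy | rfl | hy
      · exact .inl (.inl hy)
      · simpa using hk
      · exact .inl (.inr hy)
    · intro y hy
      exact (readsFirst_W hy).elim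
  | seq c d ihc ihd =>
    obtain ⟨t₁, s₁, t₂, h₁, h₂, rfl⟩ := run_seq.1 h
    obtain ⟨t, m, ht⟩ := ihc h₁
    obtain ⟨t', m', ht'⟩ := ihd h₂
    exact ⟨_, ht.seq ht' (.seq ht.run ht'.run)⟩
  | cond b c d ihc ihd =>
    rcases run_cond.1 h with ⟨hb, h⟩ | ⟨hb, h⟩
    · obtain ⟨t, m, ht⟩ := ihc h
      exact ⟨t, m, { ht with run := .cond_true hb ht.run }⟩
    · obtain ⟨t, m, ht⟩ := ihd h
      exact ⟨t, m, { ht with run := .cond_false hb ht.run }⟩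
  | loop b c ih =>
    refine Run.loop_induction (I := fun s u s' => ∃ t m, LazySim (.loop b c) s u s' t m)
      (fun s hs => ⟨_, _, lazySim_id (.loop_false hs) rfl rfl rfl rfl⟩) ?_ h
    rintro s₁ s₂ s₃ t₁ t₂ hb h₁ ⟨t', m', ht'⟩
    obtain ⟨t, m, ht⟩ := ih h₁
    exact ⟨_, ht.seq ht' (.loop_true hb ht.run ht'.run)⟩

/-- A run of a body on the memory `m` can be followed by the lazy translation, if the entries that
the snapshot has already agree with `m`. -/
theorem lazyBody_complete {T : Body Reg Loc Val} {σ σ' : Reg → Val} {t : List (Label Loc Val)}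
    (h : BRun T σ t σ') (s : LState Reg Loc Val) (hs : s.regs = σ) (m : Loc → Val)
    (hl : Legal m t) (hm : ∀ x ∈ s.known, s.val x = m x) :
    ∃ u s', Run (lazyBody T) s u s' ∧ s'.regs = σ' ∧ LazyRun s u s' t m := by
  induction h generalizing s m with
  | skip => exact ⟨_, s, .skip _, hs, lazyRun_id hm rfl rfl rfl rfl rfl⟩
  | assign r e σ => subst hs; exact ⟨_, _, .upd _ _, rfl, lazyRun_id hm rfl rfl rfl rfl rfl⟩
  | rd r x v σ =>
    subst hs
    obtain rfl := legal_R.1 hl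
    by_cases hx : x ∈ s.known
    · refine ⟨_, _, .seq (.cond_false (by simpa [LState.known, imp_iff_not_or] using hx) (.skip _))
        (.upd _ _), ?_, ?_⟩
      · have := hm x hx
        simp only [LState.val] at this
        simp [this]
      · refine ⟨rfl, rfl, ?_, ?_, ?_, by simp, ?_, by simp, ?_, .nil⟩
        · intro y
          rw [readsFirst_R]
          simp only [LState.known, Set.mem_ofPred_eq] at hx
          constructor
          · exact .inl
          · rintro (h | ⟨h, rfl⟩)
            · exact h
            · tauto
        · simp [writesOf]
        · intro y hy; exact hm y hy
        · intro y
          simp only [List.append_nil, List.not_mem_nil, false_iff, not_and, not_not, accessed,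
            Set.mem_union, readsFirst_R]
          rintro (rfl | hy)
          · exact hx
          · simp [writesOf] at hy
        · intro y hy hy'
          rw [readsFirst_R] at hy
          subst hy
          exact (hy' hx).elim
    · have hx' := hx
      simp only [LState.known, Set.mem_ofPred_eq, not_or] at hx'
      refine ⟨_, _, .seq (.cond_true (by simpa using hx') (.seq (.lockR _ _) (.seq (.upd _ _)
        (.load _ _ (m x) _)))) (.upd _ _), ?_, ?_⟩
      · simp
      · refine ⟨rfl, rfl, ?_, ?_, ?_, ?_, ?_, ?_, ?_, ?_⟩
        · intro y
          rw [readsFirst_R]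
          simp only [Finset.mem_insert]
          constructor
          · rintro (rfl | h)
            · exact .inr ⟨hx'.2, rfl⟩
            · exact .inl h
          · rintro (h | ⟨-, h⟩)
            · exact .inr h
            · exact .inl h
        · simp [writesOf]
        · intro y hy
          by_cases hyx : y = x
          · subst hyx; simp [LState.val, memAfter]
          · have : y ∈ s.known := by
              simpa [LState.known, hyx] using hy
            simpa [LState.val, memAfter, hyx] using hm y this
        · simp
        · intro y
          simp [accessed, readsFirst_R, writesOf]
          rintro rfl; exact hx
        · intro y z hy
          simp at hy
          obtain ⟨rfl, rfl⟩ := hy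
          exact ⟨rfl, .inl (readsFirst_R.2 rfl), hx⟩
        · intro y hy _
          rw [readsFirst_R] at hy
          subst hy
          exact ⟨[.RL y], [], by simp, by simp⟩
        · simp
  | wr x e σ =>
    subst hs
    have hval : ∀ y, (y = x ∨ y ∈ s.known) →
        ((Function.update s.snap x (some (e s.regs)) y).getD 0) =
          memAfter m [.W x (e s.regs)] y := by
      intro y hy
      by_cases hyx : y = x
      · subst hyx; simp [memAfter]
      · have := hm y (hy.resolve_left hyx)
        simp only [LState.val] at this
        simp [memAfter, hyx, this]
    have hacc : ∀ y, y ∈ accessed [Label.W x (e s.regs)] ↔ y = x := by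
      intro y
      simp [accessed, readsFirst_W, writesOf]
    have h1 : ∀ y, y ∈ ({ s with
        WS := insert x s.WS
        snap := Function.update s.snap x (some (e s.regs)) } : LState Reg Loc Val).known →
        y = x ∨ y ∈ s.known := by
      intro y hy
      simp only [LState.known, Finset.mem_insert, Set.mem_ofPred_eq] at hy ⊢
      tauto
    by_cases hx : x ∈ s.known
    · refine ⟨_, _, .seq (.cond_false (by simpa [LState.known, imp_iff_not_or] using hx) (.skip _))
        (.upd _ _), rfl, ?_⟩
      refine ⟨rfl, rfl, ?_, ?_, fun y hy => hval y (h1 y hy), by simp, ?_, by simp, ?_, .nil⟩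
      · simp [readsFirst_W]
      · intro y; simp [writesOf, or_comm]
      · intro y; rw [hacc]; simp; rintro rfl; exact hx
      · intro y hy; exact (readsFirst_W hy).elim
    · have hx' := hx
      simp only [LState.known, Set.mem_ofPred_eq, not_or] at hx'
      refine ⟨_, _, .seq (.cond_true (by simpa using hx') (.lockR _ _)) (.upd _ _), rfl, ?_⟩
      refine ⟨rfl, rfl, ?_, ?_, fun y hy => hval y (h1 y hy), ?_, ?_, by simp, ?_, by simp⟩
      · simp [readsFirst_W]
      · intro y; simp [writesOf, or_comm]
      · intro l hl
        exact ⟨x, m x, .inl (by simpa using hl)⟩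
      · intro y; rw [hacc]; simp; rintro rfl; exact hx
      · intro y hy; exact (readsFirst_W hy).elim
  | seq _ _ ih₁ ih₂ =>
    obtain ⟨hl₁, hl₂⟩ := legal_append.1 hl
    obtain ⟨u₁, s₁, r₁, e₁, h₁⟩ := ih₁ s hs m hl₁ hm
    obtain ⟨u₂, s₂, r₂, e₂, h₂⟩ := ih₂ s₁ e₁ _ hl₂ h₁.val'
    exact ⟨_, s₂, .seq r₁ r₂, e₂, h₁.seq h₂⟩
  | cond_true hb _ ih =>
    subst hs
    obtain ⟨u, s', h, h'⟩ := ih s rfl m hl hm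
    exact ⟨u, s', .cond_true hb h, h'⟩
  | cond_false hb _ ih =>
    subst hs
    obtain ⟨u, s', h, h'⟩ := ih s rfl m hl hm
    exact ⟨u, s', .cond_false hb h, h'⟩
  | loop_false hb =>
    subst hs; exact ⟨_, s, .loop_false hb, rfl, lazyRun_id hm rfl rfl rfl rfl rfl⟩
  | loop_true hb _ _ ih₁ ih₂ =>
    obtain ⟨hl₁, hl₂⟩ := legal_append.1 hl
    obtain ⟨u₁, s₁, r₁, e₁, h₁⟩ := ih₁ s hs m hl₁ hm
    obtain ⟨u₂, s₂, r₂, e₂, h₂⟩ := ih₂ s₁ e₁ _ hl₂ h₁.val'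
    subst hs
    exact ⟨_, s₂, .loop_true hb r₁ r₂, e₂, h₁.seq h₂⟩

end Lazy

/-! ### The lazy implementation of transactions -/

section LazyTx

variable {Reg Loc Val : Type*}

/-- The initial state of an attempt of the lazy implementation. -/
abbrev LState.fresh (s : LState Reg Loc Val) : LState Reg Loc Val :=
  { s with regs := s.saved, snap := fun _ => none, RS := ∅, WS := ∅, LS := ∅, ok := true }

theorem LState.val_known_fresh (s : LState Reg Loc Val) : s.fresh.known = ∅ := by
  ext x; simp [LState.known]

variable [LinearOrder Loc]

/-- The effect of the final stores of the lazy implementation. -/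
theorem memAfter_labels_W (g : Loc → Val) (A : Finset Loc) (m : Loc → Val) (x : Loc) :
    memAfter m (labels (fun x => .W x (g x)) A) x = if x ∈ A then g x else m x := by
  have key : ∀ (l : List Loc) (m : Loc → Val),
      memAfter m (l.map fun x => .W x (g x)) x = if x ∈ l then g x else m x := by
    intro l
    induction l with
    | nil => simp [memAfter]
    | cons y l ih =>
      intro m
      simp only [List.map_cons, memAfter, ih, List.mem_cons]
      by_cases hx : x ∈ l
      · simp [hx]
      · by_cases hxy : x = y
        · subst hxy; simp
        · simp [hx, hxy]
  rw [labels, key]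
  simp

theorem lazy_block {t A : List (Label Loc Val)} {RS WS : Finset Loc} {m v : Loc → Val}
    (hl : Legal m t) (hA : ∀ l ∈ A, ∃ x v, l = .RL x ∨ l = .R x v)
    (hW : ∀ x, x ∈ WS ↔ x ∈ writesOf t) (hv : ∀ x ∈ WS, v x = memAfter m t x)
    (hrl : ∀ x ∈ accessed t, Label.RL x ∈ A)
    (hload : ∀ x ∈ readsFirst t, ∃ v₁ v₂, A = v₁ ++ Label.R x (m x) :: v₂ ∧ Label.RL x ∈ v₁) :
    Block m t (layers A (RS \ WS) WS (labels (fun x => .W x (v x)) WS)) := by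
  refine layers_block hl hA ?_ ?_ ?_ hrl hload ?_
  · intro l h
    obtain ⟨x, -, rfl⟩ := mem_labels.1 h
    exact ⟨x, v x, rfl⟩
  · intro m'
    funext x
    rw [memAfter_labels_W]
    split_ifs with hx
    · rw [hv x hx]
      exact memAfter_of_mem ((hW x).1 hx) _ _
    · exact (memAfter_of_notMem (fun h => hx ((hW x).2 h)) m').symm
  · ext x
    rw [← hW]
    simp only [writesOf, Set.mem_ofPred_eq, mem_labels, Label.W.injEq]
    constructor
    · rintro ⟨_, _, h, rfl, _⟩; exact h
    · intro h; exact ⟨_, x, h, rfl, rfl⟩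
  · intro x hx
    rw [← hW] at hx
    simp [hx]

variable [DecidableEq Reg] [Zero Val]

/-- An attempt of the lazy implementation to execute `T` on a snapshot and to lock the locations
that are written. -/
abbrev lazyAttempt (T : Body Reg Loc Val) : Com (LState Reg Loc Val) Loc Val :=
  .seq (.upd fun s =>
    { s with regs := s.saved, snap := fun _ => none, RS := ∅, WS := ∅, LS := ∅, ok := true }) <|
  .seq (lazyBody T) <|
  .seq (.each (fun s => s.RS \ s.WS) .unlockR) <|
  promoteAll fun s => s.WS

theorem lazyAttempt_sound {T : Body Reg Loc Val} {s s' : LState Reg Loc Val}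
    {u : List (Label Loc Val)} (h : Run (lazyAttempt T) s u s') :
    s'.saved = s.saved ∧ (∀ l ∈ u, l.valW = none) ∧
      (s'.ok = true → ∃ A t m, LazySim T s.fresh A s' t m ∧
        u = A ++ (labels .RU (s'.RS \ s'.WS) ++ labels .PL s'.WS)) := by
  obtain ⟨_, _, _, h₁, h₂, rfl⟩ := run_seq.1 h
  obtain ⟨rfl, rfl⟩ := run_upd.1 h₁
  obtain ⟨_, s₁, _, h₃, h₄, rfl⟩ := run_seq.1 h₂
  obtain ⟨t, m, ht⟩ := lazyBody_sound h₃
  obtain ⟨_, s₂, _, h₅, h₆, rfl⟩ := run_seq.1 h₄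
  obtain ⟨rfl, rfl⟩ := (run_each_emit (g := .RU) fun _ _ _ => run_unlockR).1 h₅
  obtain ⟨⟨e₁, e₂, e₃, e₄, e₅⟩, hl, hk⟩ := run_promoteAll h₆
  refine ⟨e₂.trans ht.saved, ?_, fun hk' => ⟨_, t, m, ?_, by rw [hk hk', e₄, e₅]; rfl⟩⟩
  · intro l h
    simp only [List.nil_append, List.mem_append] at h
    rcases h with h | h | h
    · obtain ⟨x, v, rfl | rfl⟩ := ht.shape l h <;> rfl
    · exact valW_of_mem_labels (fun _ => rfl) l h
    · exact (hl l h).2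
  · have hkn : s'.known = s₂.known := by simp [LState.known, e₄, e₅]
    have hv : s'.val = s₂.val := by funext x; simp [LState.val, e₃]
    exact ⟨e₁ ▸ ht.run, e₂.trans ht.saved, e₅ ▸ ht.mem_WS, e₄ ▸ ht.RS_mono, ht.shape, ht.val,
      ht.legal, by rw [hkn, hv]; exact ht.val', e₄ ▸ ht.load, by rw [hkn]; exact ht.lock,
      e₄ ▸ ht.reads⟩

/-- A run of the lazy implementation consists of failed attempts, which leave the registers as they
were, and a block for a run of `T`. -/
theorem lazyTx_sound {T : Body Reg Loc Val} {s s' : LState Reg Loc Val}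
    {u : List (Label Loc Val)} (h : Run (lazyTx T) s u s') :
    ∃ t, BRun T s.regs t s'.regs ∧ Committed t u := by
  obtain ⟨_, _, _, h₀, h', rfl⟩ := run_seq.1 h
  obtain ⟨rfl, rfl⟩ := run_upd.1 h₀
  obtain ⟨_, s₁, _, h₁, h₂, rfl⟩ := run_seq.1 h'
  obtain ⟨F, s₂, w, rfl, hF, hI, hw, hk⟩ := run_retry (c := lazyAttempt T)
    (s := { s with saved := s.regs, ok := false })
    (I := fun s₁ => s₁.saved = s.regs) (Q := fun l => l.valW = none)
    (fun s₁ t s₂ hI hr => by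
      obtain ⟨a, b, -⟩ := lazyAttempt_sound hr
      exact ⟨a.trans hI, b⟩) rfl rfl h₁
  obtain ⟨-, -, hm⟩ := lazyAttempt_sound hw
  obtain ⟨A, t, m, ht, rfl⟩ := hm hk
  obtain ⟨_, s₃, _, h₃, h₄, rfl⟩ := run_seq.1 h₂
  obtain ⟨rfl, rfl⟩ :=
    (run_each_emit (s := s₁) (A := fun s => s.WS)
      (c := fun x => .store x fun s => (s.snap x).getD 0)
      (g := fun x => .W x (s₁.val x)) fun _ _ _ => run_store).1 h₃
  obtain ⟨rfl, rfl⟩ := (run_each_emit (g := .WU) fun _ _ _ => run_unlockW).1 h₄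
  have hW : ∀ x, x ∈ s'.WS ↔ x ∈ writesOf t := by
    intro x; rw [ht.mem_WS]; simp
  have hkn : ∀ x ∈ accessed t, x ∈ s'.known := by
    rintro x (hx | hx)
    · rcases ht.reads x hx with h | h
      · exact .inl h
      · simp at h
    · exact .inr ((hW x).2 hx)
  refine ⟨t, ?_, m, F, _, ?_, hF, lazy_block (RS := s'.RS) (WS := s'.WS) (v := s'.val) ht.legal
    ht.shape hW (fun x hx => ht.val' x (.inr hx)) ?_ ?_⟩
  · have := ht.run
    rwa [show s₂.fresh.regs = s.regs from hI] at this
  · simp [layers]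
  · intro x hx
    rcases ht.lock x (hkn x hx) with h | h
    · rw [LState.val_known_fresh] at h; exact h.elim
    · exact h
  · intro x hx
    have : x ∈ s'.RS := (ht.reads x hx).resolve_right (by simp)
    rcases ht.load x this with h | ⟨-, h⟩
    · simp at h
    · exact h

/-- A run of `T` can be followed by one successful attempt of the lazy implementation, which
acquires exactly the locks that the run requires. -/
theorem lazyTx_complete {T : Body Reg Loc Val} {t : List (Label Loc Val)} {σ σ' : Reg → Val}
    (h : BRun T σ t σ') {m : Loc → Val} (hl : Legal m t) (s : LState Reg Loc Val)
    (hs : s.regs = σ) :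
    ∃ u s', Run (lazyTx T) s u s' ∧ s'.regs = σ' ∧ ExactBlock m t u := by
  subst hs
  let s₀ : LState Reg Loc Val := { s with saved := s.regs, ok := false }
  obtain ⟨A, s₁, h₁, e₁, r⟩ := lazyBody_complete h s₀.fresh rfl m hl (by
    rw [LState.val_known_fresh]; simp)
  obtain ⟨s₂, h₂, ⟨e₂, e₃, e₄, e₅, e₆⟩, hk⟩ := promoteAll_success (fun s => s.WS) r.ok
  have hW : ∀ x, x ∈ s₁.WS ↔ x ∈ writesOf t := by
    intro x; rw [r.mem_WS]; simp
  have hR : ∀ x, x ∈ s₁.RS ↔ x ∈ readsFirst t := by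
    intro x; rw [r.mem_RS]; simp
  have hn : ∀ x, x ∉ s₀.fresh.known := by
    rw [LState.val_known_fresh]; simp
  have hv : s₂.val = s₁.val := by funext x; simp [LState.val, e₄]
  have hb := lazy_block (RS := s₁.RS) (WS := s₁.WS) (v := s₁.val) hl r.shape hW
    (fun x hx => r.val' x (.inr hx)) (fun x hx => (r.rl_iff x).2 ⟨hx, hn x⟩)
    (fun x hx => r.load x hx (hn x))
  refine ⟨_, s₂, ?_, e₂.trans e₁, layers_exactBlock hb r.shape ?_ r.distinct
    (fun x hx => ((r.rl_iff x).1 hx).1) (fun x y hx => ⟨(r.loads x y hx).1, (r.loads x y hx).2.1⟩)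
    hW ?_⟩
  · have att : Run (lazyAttempt T) s₀ _ s₂ := Run.seq (t₁ := []) (.upd _ _) (.seq h₁ (.seq
      ((run_each_emit (A := fun s : LState Reg Loc Val => s.RS \ s.WS) (g := .RU)
          fun _ _ _ => run_unlockR).2
        ⟨rfl, rfl⟩) h₂))
    have : Run (lazyTx T) s _ s₂ := Run.seq (t₁ := []) (.upd _ s)
      (.seq (retry_success rfl att hk) (.seq
        ((run_each_emit (A := fun s : LState Reg Loc Val => s.WS)
          (c := fun x => .store x fun s => (s.snap x).getD 0) (g := fun x => .W x (s₂.val x))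
          fun _ _ _ => run_store).2 ⟨rfl, rfl⟩)
        ((run_each_emit (A := fun s : LState Reg Loc Val => s.WS) (g := .WU)
          fun _ _ _ => run_unlockW).2 ⟨rfl, rfl⟩)))
    simpa [layers, hv, e₆] using this
  · intro l h
    obtain ⟨x, -, rfl⟩ := mem_labels.1 h
    exact ⟨x, s₁.val x, rfl⟩
  · intro x
    rw [Finset.mem_sdiff, hW, hR]
    simp only [accessed, Set.mem_union]
    tauto

end LazyTx

/-! ### Runs of implemented programs -/

section Programs

variable {Reg Loc Val : Type*}

theorem Prog.AllTx.imp {p q : Body Reg Loc Val → Finset Loc → Finset Loc → Prop}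
    (h : ∀ T rs ws, p T rs ws → q T rs ws) {c : Prog Reg Loc Val} (hc : c.AllTx p) : c.AllTx q := by
  induction c with
  | skip | assign => trivial
  | seq c d ihc ihd | cond b c d ihc ihd => exact ⟨ihc hc.1, ihd hc.2⟩
  | loop b c ih => exact ih hc
  | tx T rs ws => exact h _ _ _ hc

theorem Prog.allTx_of_forall {p : Body Reg Loc Val → Finset Loc → Finset Loc → Prop}
    (h : ∀ T rs ws, p T rs ws) {c : Prog Reg Loc Val} : c.AllTx p := by
  induction c with
  | skip | assign => trivial
  | seq c d ihc ihd | cond b c d ihc ihd => exact ⟨ihc, ihd⟩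
  | loop b c ih => exact ih
  | tx T rs ws => exact h _ _ _

variable [DecidableEq Reg]

theorem PRun.labels {c : Prog Reg Loc Val} {σ σ' : Reg → Val} {ts : List (List (Label Loc Val))}
    (h : PRun c σ ts σ') : ∀ t ∈ ts, ∀ l ∈ t, ∃ x v, l = .R x v ∨ l = .W x v := by
  induction h with
  | skip | assign | loop_false => simp
  | tx h => simpa using h.labels
  | seq _ _ h₁ h₂ | loop_true _ _ _ h₁ h₂ =>
    intro t ht
    rcases List.mem_append.1 ht with ht | ht
    · exact h₁ t ht
    · exact h₂ t ht
  | cond_true _ _ ih | cond_false _ _ ih => exact ih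

variable [LinearOrder Loc]

/-- Runs of an implementation whose transactions are sound project to runs of the program. -/
theorem implement_sound
    {f : Body Reg Loc Val → Finset Loc → Finset Loc → Com (LState Reg Loc Val) Loc Val}
    {c : Prog Reg Loc Val}
    (hc : c.AllTx fun T rs ws => ∀ s u s', Run (f T rs ws) s u s' →
      ∃ t, BRun T s.regs t s'.regs ∧ Committed t u)
    {s s' : LState Reg Loc Val} {u : List (Label Loc Val)} (h : Run (implement f c) s u s') :
    ∃ ts us, PRun c s.regs ts s'.regs ∧ u = us.flatten ∧ List.Forall₂ Committed ts us := by
  induction c generalizing s u s' with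
  | skip =>
    obtain ⟨rfl, rfl⟩ := run_skip.1 h
    exact ⟨[], [], .skip _, rfl, .nil⟩
  | assign r e =>
    obtain ⟨rfl, rfl⟩ := run_upd.1 h
    exact ⟨[], [], .assign _ _ _, rfl, .nil⟩
  | seq c d ihc ihd =>
    obtain ⟨_, s₁, _, h₁, h₂, rfl⟩ := run_seq.1 h
    obtain ⟨ts, us, p, rfl, q⟩ := ihc hc.1 h₁
    obtain ⟨ts', us', p', rfl, q'⟩ := ihd hc.2 h₂
    exact ⟨_, us ++ us', .seq p p', by simp, List.rel_append q q'⟩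
  | cond b c d ihc ihd =>
    rcases run_cond.1 h with ⟨hb, h⟩ | ⟨hb, h⟩
    · obtain ⟨ts, us, p, q⟩ := ihc hc.1 h
      exact ⟨ts, us, .cond_true hb p, q⟩
    · obtain ⟨ts, us, p, q⟩ := ihd hc.2 h
      exact ⟨ts, us, .cond_false hb p, q⟩
  | loop b c ih =>
    refine Run.loop_induction (b := fun s : LState Reg Loc Val => b s.regs) (c := implement f c)
      (I := fun s u s' => ∃ ts us, PRun (.loop b c) s.regs ts s'.regs ∧
      u = us.flatten ∧ List.Forall₂ Committed ts us)
      (fun s hs => ⟨[], [], .loop_false hs, rfl, .nil⟩) ?_ h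
    rintro s₁ s₂ s₃ t₁ t₂ hb h₁ ⟨ts', us', p', rfl, q'⟩
    obtain ⟨ts, us, p, rfl, q⟩ := ih hc h₁
    exact ⟨_, us ++ us', .loop_true hb p p', by simp, List.rel_append q q'⟩
  | tx T rs ws =>
    obtain ⟨t, p, q⟩ := hc _ _ _ h
    exact ⟨[t], [u], .tx p, by simp, .cons q .nil⟩

/-- Runs of a program can be followed by implementations whose transactions can follow runs of the
transactions. The list `ms` contains the values that the transactions read from others. -/
theorem implement_complete
    {f : Body Reg Loc Val → Finset Loc → Finset Loc → Com (LState Reg Loc Val) Loc Val}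
    {c : Prog Reg Loc Val}
    (hc : c.AllTx fun T rs ws => ∀ σ t σ', BRun T σ t σ' → ∀ m, Legal m t → ∀ s, s.regs = σ →
      ∃ u s', Run (f T rs ws) s u s' ∧ s'.regs = σ' ∧ ExactBlock m t u)
    {σ σ' : Reg → Val} {ts : List (List (Label Loc Val))} (h : PRun c σ ts σ')
    {ms : List (Loc → Val)} (hm : List.Forall₂ Legal ms ts) (s : LState Reg Loc Val)
    (hs : s.regs = σ) :
    ∃ us s', Run (implement f c) s us.flatten s' ∧ s'.regs = σ' ∧
      List.Forall₂ (fun p u => ExactBlock p.1 p.2 u) (ms.zip ts) us := by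
  have split : ∀ {ms : List (Loc → Val)} {t₁ t₂ : List (List (Label Loc Val))},
      List.Forall₂ Legal ms (t₁ ++ t₂) → ∃ m₁ m₂, ms = m₁ ++ m₂ ∧ List.Forall₂ Legal m₁ t₁ ∧
        List.Forall₂ Legal m₂ t₂ ∧ ms.zip (t₁ ++ t₂) = m₁.zip t₁ ++ m₂.zip t₂ := by
    intro ms t₁ t₂ h
    have h₁ := List.forall₂_take_append ms t₁ t₂ h
    have h₂ := List.forall₂_drop_append ms t₁ t₂ h
    refine ⟨_, _, (List.take_append_drop t₁.length ms).symm, h₁, h₂, ?_⟩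
    conv_lhs => rw [← List.take_append_drop t₁.length ms]
    exact List.zip_append h₁.length_eq
  induction h generalizing ms s with
  | skip => cases hm; exact ⟨[], s, .skip _, hs, .nil⟩
  | assign r e σ => subst hs; cases hm; exact ⟨[], _, .upd _ _, rfl, .nil⟩
  | seq _ _ ih₁ ih₂ =>
    obtain ⟨m₁, m₂, rfl, h₁, h₂, e⟩ := split hm
    obtain ⟨u₁, s₁, r₁, e₁, q₁⟩ := ih₁ hc.1 h₁ s hs
    obtain ⟨u₂, s₂, r₂, e₂, q₂⟩ := ih₂ hc.2 h₂ s₁ e₁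
    exact ⟨u₁ ++ u₂, s₂, by rw [List.flatten_append]; exact .seq r₁ r₂, e₂,
      by rw [e]; exact List.rel_append q₁ q₂⟩
  | cond_true hb _ ih =>
    subst hs
    obtain ⟨u, s', r, q⟩ := ih hc.1 hm s rfl
    exact ⟨u, s', .cond_true hb r, q⟩
  | cond_false hb _ ih =>
    subst hs
    obtain ⟨u, s', r, q⟩ := ih hc.2 hm s rfl
    exact ⟨u, s', .cond_false hb r, q⟩
  | loop_false hb => subst hs; cases hm; exact ⟨[], s, .loop_false hb, rfl, .nil⟩
  | loop_true hb _ _ ih₁ ih₂ =>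
    obtain ⟨m₁, m₂, rfl, h₁, h₂, e⟩ := split hm
    obtain ⟨u₁, s₁, r₁, e₁, q₁⟩ := ih₁ hc h₁ s hs
    obtain ⟨u₂, s₂, r₂, e₂, q₂⟩ := ih₂ hc h₂ s₁ e₁
    subst hs
    exact ⟨u₁ ++ u₂, s₂, by rw [List.flatten_append]; exact .loop_true hb r₁ r₂, e₂,
      by rw [e]; exact List.rel_append q₁ q₂⟩
  | tx hb =>
    cases hm with
    | cons hl hn =>
      cases hn
      obtain ⟨u, s', r, e, q⟩ := hc _ _ _ hb _ hl s hs
      exact ⟨[u], s', by simpa [implement] using r, e, .cons q .nil⟩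

end Programs

/-! ### Layouts of execution graphs -/

section Layouts

variable {Tid Loc Val : Type*}

/-- The event `e` with `At p j e` is number `j` of block `p.2` of thread `p.1`. Blocks correspond to
transactions; `B p` contains the labels, and `tag p` the transaction identifier of the events of
block `p`. -/
structure Layout (G : ExecGraph Tid Loc Val) (tag : Tid × ℕ → ℕ)
    (B : Tid × ℕ → List (Label Loc Val)) (At : Tid × ℕ → ℕ → Event Tid Loc Val → Prop) : Prop where
  mem : ∀ {p j e}, At p j e → e ∈ G.E
  tid : ∀ {p j e}, At p j e → e.tid = some p.1
  tx : ∀ {p j e}, At p j e → e.tx = tag p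
  lab : ∀ {p j e}, At p j e → (B p)[j]? = some e.lab
  ex : ∀ {p j l}, (B p)[j]? = some l → ∃ e, At p j e ∧ e.lab = l
  cover : ∀ {e}, e ∈ G.E → e.tid ≠ none → ∃ p j, At p j e
  fn : ∀ {p j e f}, At p j e → At p j f → e = f
  inj : ∀ {p j q i e}, At p j e → At q i e → p = q ∧ j = i
  po : ∀ {p j e q i f}, At p j e → At q i f →
    (G.po e f ↔ p.1 = q.1 ∧ (p.2 < q.2 ∨ p.2 = q.2 ∧ j < i))

/-- The blocks of a list of blocks for every thread, with empty blocks added at the end. -/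
def blockOf {α : Type*} (bs : Tid → List (List α)) (p : Tid × ℕ) : List α :=
  (bs p.1).getD p.2 []

theorem getElem?_blockOf {α : Type*} {bs : Tid → List (List α)} {p : Tid × ℕ} {j : ℕ} {l : α} :
    (blockOf bs p)[j]? = some l ↔ ∃ b, (bs p.1)[p.2]? = some b ∧ b[j]? = some l := by
  rw [blockOf, List.getD_eq_getElem?_getD]
  cases (bs p.1)[p.2]? <;> simp

theorem List.exists_flatten_of_map_eq_flatten {α β : Type*} {f : α → β} {l : List α}
    {L : List (List β)} (h : l.map f = L.flatten) :
    ∃ L' : List (List α), l = L'.flatten ∧ L'.map (List.map f) = L := by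
  induction L generalizing l with
  | nil => exact ⟨[], by simpa using h, rfl⟩
  | cons b L ih =>
    rw [List.flatten_cons] at h
    obtain ⟨l₁, l₂, rfl, rfl, h₂⟩ := List.map_eq_append_iff.1 h
    obtain ⟨L', rfl, rfl⟩ := ih h₂
    exact ⟨l₁ :: L', by simp, by simp⟩

theorem List.map_zipIdx_fst {α β : Type*} (g : α → β) (l : List α) :
    (l.zipIdx.map fun p => g p.1) = l.map g := by
  rw [show (fun p : α × ℕ => g p.1) = g ∘ Prod.fst from rfl, ← List.map_map, List.zipIdx_map_fst]

theorem List.pairwise_zipIdx_lt {α : Type*} (l : List α) :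
    l.zipIdx.Pairwise fun a b => a.2 < b.2 := by
  rw [List.pairwise_iff_getElem]
  intro i j hi hj hij
  simpa using hij

/-- The traces that consist of the given blocks, with their tags. -/
abbrev taggedTraces (tag : Tid × ℕ → ℕ) (bs : Tid → List (List (Label Loc Val))) (τ : Tid) :
    List (ℕ × Label Loc Val) :=
  (bs τ).zipIdx.flatMap fun p => p.1.map fun l => (tag (τ, p.2), l)

theorem taggedTraces_zero (bs : Tid → List (List (Label Loc Val))) (τ : Tid) :
    taggedTraces (fun _ => 0) bs τ = (bs τ).flatten.map fun l => (0, l) := by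
  rw [taggedTraces, List.map_flatten]
  rw [List.flatMap_def]
  congr 1
  exact List.map_zipIdx_fst (List.map fun l => (0, l)) (bs τ)

/-- The events of a graph whose threads generate given blocks can be addressed by the number of the
block and the position in it. -/
theorem exists_layout [Zero Val] {G : ExecGraph Tid Loc Val} (hG : G.WF) {tag : Tid × ℕ → ℕ}
    {bs : Tid → List (List (Label Loc Val))} (h : G.HasThreads (taggedTraces tag bs)) :
    ∃ At, Layout G tag (blockOf bs) At := by
  obtain ⟨es, hes⟩ := h
  have hL : ∀ τ, ∃ L' : List (List (Event Tid Loc Val)), es τ = L'.flatten ∧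
      L'.map (List.map fun e : Event Tid Loc Val => (e.tx, e.lab)) =
        (bs τ).zipIdx.map fun p : List (Label Loc Val) × ℕ =>
          p.1.map fun l => (tag (τ, p.2), l) := fun τ =>
    List.exists_flatten_of_map_eq_flatten ((hes τ).2.2.trans (List.flatMap_def ..))
  choose L hL hmap using hL
  -- the block of events with given index
  have hblk : ∀ τ k, ((L τ)[k]?).map (List.map fun e : Event Tid Loc Val => (e.tx, e.lab)) =
      ((bs τ)[k]?).map fun b : List (Label Loc Val) => b.map fun l => (tag (τ, k), l) := by
    intro τ k
    have := congrArg (fun l => l[k]?) (hmap τ)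
    simpa [Function.comp_def] using this
  let At : Tid × ℕ → ℕ → Event Tid Loc Val → Prop := fun p j e =>
    ∃ b, (L p.1)[p.2]? = some b ∧ b[j]? = some e
  have hmemes : ∀ {p j e}, At p j e → e ∈ es p.1 := by
    rintro p j e ⟨b, hb, hj⟩
    rw [hL]
    exact List.mem_flatten.2 ⟨b, List.mem_of_getElem? hb, List.mem_of_getElem? hj⟩
  have hfn : ∀ {p j e f}, At p j e → At p j f → e = f := by
    rintro p j e f ⟨b, hb, hj⟩ ⟨c, hc, hi⟩
    rw [hb] at hc; cases hc
    rw [hj] at hi; cases hi; rfl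
  have hlab : ∀ {p j e}, At p j e → e.tx = tag p ∧ (blockOf bs p)[j]? = some e.lab := by
    rintro p j e ⟨b, hb, hj⟩
    have h1 := hblk p.1 p.2
    rw [hb] at h1
    cases hc : (bs p.1)[p.2]? with
    | none => simp [hc] at h1
    | some d =>
      simp only [hc, Option.map_some, Option.some.injEq] at h1
      have h2 := congrArg (fun l => l[j]?) h1
      simp only [List.getElem?_map, hj, Option.map_some] at h2
      cases hl : d[j]? with
      | none => simp [hl] at h2
      | some l =>
        simp only [hl, Option.map_some, Option.some.injEq, Prod.mk.injEq] at h2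
        exact ⟨h2.1, getElem?_blockOf.2 ⟨d, hc, by rw [hl, h2.2]⟩⟩
  have hpo : ∀ {p j e q i f}, At p j e → At q i f → p.1 = q.1 →
      (p.2 < q.2 ∨ p.2 = q.2 ∧ j < i) → G.po e f := by
    rintro ⟨τ, k⟩ j e ⟨τ', k'⟩ i f ⟨b, hb, hj⟩ ⟨c, hc, hi⟩ (rfl : τ = τ') hlt
    have hp := (hes τ).1
    rw [hL, List.pairwise_flatten] at hp
    simp only at hb hc hlt
    rcases hlt with hlt | ⟨rfl, hlt⟩
    · obtain ⟨h1, h1'⟩ := List.getElem?_eq_some_iff.1 hb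
      obtain ⟨h2, h2'⟩ := List.getElem?_eq_some_iff.1 hc
      have := List.pairwise_iff_getElem.1 hp.2 k k' h1 h2 hlt
      rw [h1', h2'] at this
      exact this e (List.mem_of_getElem? hj) f (List.mem_of_getElem? hi)
    · rw [hb] at hc; cases hc
      obtain ⟨h1, h1'⟩ := List.getElem?_eq_some_iff.1 hj
      obtain ⟨h2, h2'⟩ := List.getElem?_eq_some_iff.1 hi
      have := List.pairwise_iff_getElem.1 (hp.1 b (List.mem_of_getElem? hb)) j i h1 h2 hlt
      rwa [h1', h2'] at this
  have htid : ∀ {p j e}, At p j e → e.tid = some p.1 := fun h =>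
    (((hes _).2.1 _).1 (hmemes h)).2
  have hinj : ∀ {p j q i e}, At p j e → At q i e → p = q ∧ j = i := by
    intro p j q i e h h'
    have h1 : p.1 = q.1 := Option.some.inj ((htid h).symm.trans (htid h'))
    rcases lt_trichotomy p.2 q.2 with h2 | h2 | h2
    · exact (hG.po_irrefl _ (hpo h h' h1 (.inl h2))).elim
    · rcases lt_trichotomy j i with h3 | h3 | h3
      · exact (hG.po_irrefl _ (hpo h h' h1 (.inr ⟨h2, h3⟩))).elim
      · exact ⟨Prod.ext h1 h2, h3⟩
      · exact (hG.po_irrefl _ (hpo h' h h1.symm (.inr ⟨h2.symm, h3⟩))).elim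
    · exact (hG.po_irrefl _ (hpo h' h h1.symm (.inl h2))).elim
  refine ⟨At, fun h => (((hes _).2.1 _).1 (hmemes h)).1, htid, fun h => (hlab h).1,
    fun h => (hlab h).2, ?_, ?_, hfn, hinj, ?_⟩
  · intro p j l hl
    obtain ⟨b, hb, hj⟩ := getElem?_blockOf.1 hl
    have h1 := hblk p.1 p.2
    rw [hb] at h1
    cases hc : (L p.1)[p.2]? with
    | none => simp [hc] at h1
    | some d =>
      simp only [hc, Option.map_some, Option.some.injEq] at h1
      have h2 := congrArg (fun l => l[j]?) h1
      simp only [List.getElem?_map, hj, Option.map_some] at h2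
      cases he : d[j]? with
      | none => simp [he] at h2
      | some e =>
        simp only [he, Option.map_some, Option.some.injEq, Prod.mk.injEq] at h2
        exact ⟨e, ⟨d, hc, he⟩, h2.2⟩
  · intro e he ht
    obtain ⟨τ, hτ⟩ := Option.ne_none_iff_exists'.1 ht
    have h1 := ((hes τ).2.1 e).2 ⟨he, hτ⟩
    rw [hL] at h1
    obtain ⟨b, hb, he⟩ := List.mem_flatten.1 h1
    obtain ⟨k, hk⟩ := List.mem_iff_getElem?.1 hb
    obtain ⟨j, hj⟩ := List.mem_iff_getElem?.1 he
    exact ⟨(τ, k), j, b, hk, hj⟩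
  · intro p j e q i f h h'
    refine ⟨fun hp => ?_, fun hp => hpo h h' hp.1 hp.2⟩
    have h1 : p.1 = q.1 := by
      have := (hG.po_thread _ _ hp).2
      rw [htid h, htid h'] at this
      simpa using this
    refine ⟨h1, ?_⟩
    by_contra hcon
    rcases lt_trichotomy p.2 q.2 with h2 | h2 | h2
    · exact hcon (.inl h2)
    · rcases lt_trichotomy j i with h3 | h3 | h3
      · exact hcon (.inr ⟨h2, h3⟩)
      · have : p = q := Prod.ext h1 h2
        subst this h3
        rw [hfn h h'] at hp
        exact hG.po_irrefl _ hp
      · exact hG.po_irrefl _ (hG.po_trans _ _ _ hp (hpo h' h h1.symm (.inr ⟨h2.symm, h3⟩)))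
    · exact hG.po_irrefl _ (hG.po_trans _ _ _ hp (hpo h' h h1.symm (.inl h2)))

end Layouts

/-! ### Execution graphs built from blocks -/

section Build

variable {Tid Loc Val : Type*}

theorem Label.eq_W_of_isWrite {l : Label Loc Val} (h : l.IsWrite) :
    (∃ v, l = .W l.loc v) ∨ ∃ a b, l = .U l.loc a b := by
  cases l <;> simp_all [Label.IsWrite, Label.valW, Label.loc]

theorem Label.eq_R_of_isRead {l : Label Loc Val} (h : l.IsRead) :
    (∃ v, l = .R l.loc v) ∨ ∃ a b, l = .U l.loc a b := by
  cases l <;> simp_all [Label.IsRead, Label.valR, Label.loc]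

/-- The initialisation event of a location. -/
def initEvent [Zero Val] (x : Loc) : Event Tid Loc Val := ⟨0, none, 0, .W x 0⟩

/-- The event `e` is number `j` of block `p`; its identifier encodes its position in the thread. -/
def Placed (tag : Tid × ℕ → ℕ) (B : Tid × ℕ → List (Label Loc Val)) (p : Tid × ℕ) (j : ℕ)
    (e : Event Tid Loc Val) : Prop :=
  e = ⟨Nat.pair p.2 j, some p.1, tag p, e.lab⟩ ∧ (B p)[j]? = some e.lab

variable {tag : Tid × ℕ → ℕ} {B : Tid × ℕ → List (Label Loc Val)}

theorem Placed.inj {p q : Tid × ℕ} {j i : ℕ} {e : Event Tid Loc Val} (h : Placed tag B p j e)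
    (h' : Placed tag B q i e) : p = q ∧ j = i := by
  obtain ⟨h, -⟩ := h
  obtain ⟨h', -⟩ := h'
  rw [h] at h'
  simp only [Event.mk.injEq, Nat.pair_eq_pair, Option.some.injEq] at h'
  exact ⟨Prod.ext h'.2.1 h'.1.1, h'.1.2⟩

theorem Placed.fn {p : Tid × ℕ} {j : ℕ} {e f : Event Tid Loc Val} (h : Placed tag B p j e)
    (h' : Placed tag B p j f) : e = f := by
  have := h.2.symm.trans h'.2
  rw [h.1, h'.1, Option.some.inj this]

theorem Placed.tid {p : Tid × ℕ} {j : ℕ} {e : Event Tid Loc Val} (h : Placed tag B p j e) :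
    e.tid = some p.1 := by rw [h.1]

theorem Placed.tx {p : Tid × ℕ} {j : ℕ} {e : Event Tid Loc Val} (h : Placed tag B p j e) :
    e.tx = tag p := by rw [h.1]

theorem exists_placed {p : Tid × ℕ} {j : ℕ} {l : Label Loc Val} (h : (B p)[j]? = some l) :
    ∃ e : Event Tid Loc Val, Placed tag B p j e ∧ e.lab = l :=
  ⟨⟨Nat.pair p.2 j, some p.1, tag p, l⟩, ⟨rfl, h⟩, rfl⟩

theorem Placed.mem_writesOf {p : Tid × ℕ} {j : ℕ} {e : Event Tid Loc Val} {x : Loc} {v : Val}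
    (h : Placed tag B p j e) (hl : e.lab = .W x v) : x ∈ writesOf (B p) :=
  mem_writesOf_iff_getElem?.2 ⟨j, v, hl ▸ h.2⟩

variable [Zero Val]

/-- The write that a read of `x` at position `j` of block `p` reads from: the last preceding
write in the block, or else the last write in the block `src p x`, or else the initialisation
event. -/
def Source (tag : Tid × ℕ → ℕ) (B : Tid × ℕ → List (Label Loc Val))
    (src : Tid × ℕ → Loc → Option (Tid × ℕ)) (p : Tid × ℕ) (j : ℕ) (x : Loc)
    (w : Event Tid Loc Val) : Prop :=
  (∃ i, Placed tag B p i w ∧ IsLastWrite x i ((B p).take j)) ∨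
  (x ∉ writesOf ((B p).take j) ∧
    ((src p x = none ∧ w = initEvent x) ∨
      ∃ q i, src p x = some q ∧ Placed tag B q i w ∧ IsLastWrite x i (B q)))

/-- The execution graph with given blocks, in which writes of different blocks are ordered by `lt`
and reads that are not preceded by a write to the same location in their block are from the
block `src p x`. -/
def build (tag : Tid × ℕ → ℕ) (B : Tid × ℕ → List (Label Loc Val))
    (lt : Tid × ℕ → Tid × ℕ → Prop) (src : Tid × ℕ → Loc → Option (Tid × ℕ))
    (lo : Event Tid Loc Val → Event Tid Loc Val → Prop) : ExecGraph Tid Loc Val where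
  E := {e | (∃ x, e = initEvent x) ∨ ∃ p j, Placed tag B p j e}
  po a b := (∃ x q i, a = initEvent x ∧ Placed tag B q i b) ∨
    ∃ p j q i, Placed tag B p j a ∧ Placed tag B q i b ∧ p.1 = q.1 ∧
      (p.2 < q.2 ∨ p.2 = q.2 ∧ j < i)
  rf w r := ∃ p j x v, Placed tag B p j r ∧ r.lab = .R x v ∧ Source tag B src p j x w
  mo a b := (∃ x v q i, a = initEvent x ∧ Placed tag B q i b ∧ b.lab = .W x v) ∨
    ∃ p j q i x v w, Placed tag B p j a ∧ Placed tag B q i b ∧ a.lab = .W x v ∧ b.lab = .W x w ∧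
      (lt p q ∨ p = q ∧ j < i)
  lo := lo

/-- The values that block `p` reads from other blocks. -/
def extVal [DecidableEq Loc] (B : Tid × ℕ → List (Label Loc Val))
    (src : Tid × ℕ → Loc → Option (Tid × ℕ)) (p : Tid × ℕ) (x : Loc) : Val :=
  match src p x with
  | none => 0
  | some q => memAfter (fun _ => 0) (B q) x

/-- The conditions on blocks that make `build` well-formed. Either all events are outside
transactions, or the blocks are transactions. -/
structure Buildable [DecidableEq Loc] (tag : Tid × ℕ → ℕ) (B : Tid × ℕ → List (Label Loc Val))
    (lt : Tid × ℕ → Tid × ℕ → Prop) (src : Tid × ℕ → Loc → Option (Tid × ℕ)) : Prop where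
  tags : (∀ p, tag p = 0) ∨ ((∀ p, tag p ≠ 0) ∧ Function.Injective tag ∧
    ∀ p, ∀ l ∈ B p, ∃ x v, l = .R x v ∨ l = .W x v)
  no_upd : ∀ p x a b, Label.U x a b ∉ B p
  irrefl : ∀ x p, x ∈ writesOf (B p) → ¬ lt p p
  trans : ∀ x p q r, x ∈ writesOf (B p) → x ∈ writesOf (B q) → x ∈ writesOf (B r) →
    lt p q → lt q r → lt p r
  total : ∀ x p q, x ∈ writesOf (B p) → x ∈ writesOf (B q) → p ≠ q → lt p q ∨ lt q p
  src_mem : ∀ p x q, src p x = some q → x ∈ writesOf (B q)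
  legal : ∀ p, Legal (extVal B src p) (B p)

variable {lt : Tid × ℕ → Tid × ℕ → Prop} {src : Tid × ℕ → Loc → Option (Tid × ℕ)}
  {lo : Event Tid Loc Val → Event Tid Loc Val → Prop}

theorem Placed.ne_init {p : Tid × ℕ} {j : ℕ} {x : Loc} :
    ¬ Placed tag B p j (initEvent x : Event Tid Loc Val) := by
  intro h
  have := h.tid
  simp [initEvent] at this

theorem build_layout : Layout (build tag B lt src lo) tag B (Placed tag B) where
  mem h := .inr ⟨_, _, h⟩
  tid h := h.tid
  tx h := h.tx
  lab h := h.2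
  ex h := exists_placed h
  cover := by
    rintro e (⟨x, rfl⟩ | h) ht
    · exact (ht rfl).elim
    · exact h
  fn h h' := h.fn h'
  inj h h' := h.inj h'
  po := by
    intro p j e q i f h h'
    constructor
    · rintro (⟨x, _, _, rfl, -⟩ | ⟨p', j', q', i', h₁, h₂, h₃⟩)
      · exact (h.ne_init).elim
      · obtain ⟨rfl, rfl⟩ := h.inj h₁
        obtain ⟨rfl, rfl⟩ := h'.inj h₂
        exact h₃
    · exact fun hp => .inr ⟨p, j, q, i, h, h', hp⟩

theorem build_hasThreads {bs : Tid → List (List (Label Loc Val))} :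
    (build tag (blockOf bs) lt src lo).HasThreads (taggedTraces tag bs) := by
  refine ⟨fun τ => (bs τ).zipIdx.flatMap fun p => p.1.zipIdx.map fun q =>
    ⟨Nat.pair p.2 q.2, some τ, tag (τ, p.2), q.1⟩, fun τ => ⟨?_, ?_, ?_⟩⟩
  · have placed : ∀ (p : List (Label Loc Val) × ℕ), p ∈ (bs τ).zipIdx → ∀ q ∈ p.1.zipIdx,
        Placed tag (blockOf bs) (τ, p.2) q.2
          (⟨Nat.pair p.2 q.2, some τ, tag (τ, p.2), q.1⟩ : Event Tid Loc Val) := by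
      intro p hp q hq
      exact ⟨rfl, getElem?_blockOf.2 ⟨p.1, List.mem_zipIdx_iff_getElem?.1 hp,
        List.mem_zipIdx_iff_getElem?.1 hq⟩⟩
    dsimp only
    rw [List.flatMap_def, List.pairwise_flatten]
    constructor
    · simp only [List.mem_map]
      rintro _ ⟨p, hp, rfl⟩
      rw [List.pairwise_map]
      refine List.Pairwise.imp_of_mem ?_ (List.pairwise_zipIdx_lt p.1)
      intro a b ha hb hab
      exact .inr ⟨_, _, _, _, placed p hp a ha, placed p hp b hb, rfl, .inr ⟨rfl, hab⟩⟩
    · rw [List.pairwise_map]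
      refine List.Pairwise.imp_of_mem ?_ (List.pairwise_zipIdx_lt (bs τ))
      intro p q hp hq hpq a ha b hb
      simp only [List.mem_map] at ha hb
      obtain ⟨a, ha, rfl⟩ := ha
      obtain ⟨b, hb, rfl⟩ := hb
      exact .inr ⟨_, _, _, _, placed p hp a ha, placed q hq b hb, rfl, .inl hpq⟩
  · intro e
    simp only [List.mem_flatMap, List.mem_map, Prod.exists, List.mem_zipIdx_iff_getElem?]
    constructor
    · rintro ⟨b, k, hb, l, j, hl, rfl⟩
      exact ⟨.inr ⟨(τ, k), j, rfl, getElem?_blockOf.2 ⟨b, hb, hl⟩⟩, rfl⟩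
    · rintro ⟨⟨x, rfl⟩ | ⟨⟨τ', k⟩, j, h⟩, ht⟩
      · simp [initEvent] at ht
      · have : τ' = τ := by simpa [h.tid] using ht
        subst this
        obtain ⟨b, hb, hj⟩ := getElem?_blockOf.1 h.2
        exact ⟨b, k, hb, e.lab, j, hj, h.1.symm⟩
  · rw [List.map_flatMap]
    congr 1
    funext p
    simp only [List.map_map, Function.comp_def]
    exact List.map_zipIdx_fst (fun l => (tag (τ, p.2), l)) p.1

theorem Source.unique {p : Tid × ℕ} {j : ℕ} {x : Loc} {w w' : Event Tid Loc Val}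
    (h : Source tag B src p j x w) (h' : Source tag B src p j x w') : w = w' := by
  have hn : ∀ {i}, IsLastWrite x i ((B p).take j) → x ∈ writesOf ((B p).take j) := fun h =>
    mem_writesOf_iff_getElem?.2 ⟨_, h.1⟩
  rcases h with ⟨i, h₁, h₂⟩ | ⟨h₁, h₂⟩ <;> rcases h' with ⟨i', h₁', h₂'⟩ | ⟨h₁', h₂'⟩
  · obtain rfl := h₂.unique h₂'
    exact h₁.fn h₁'
  · exact (h₁' (hn h₂)).elim
  · exact (h₁ (hn h₂')).elim
  · rcases h₂ with ⟨h₂, rfl⟩ | ⟨q, i, h₂, h₃, h₄⟩ <;>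
      rcases h₂' with ⟨h₂', rfl⟩ | ⟨q', i', h₂', h₃', h₄'⟩
    · rfl
    · simp [h₂] at h₂'
    · simp [h₂] at h₂'
    · rw [h₂] at h₂'
      cases h₂'
      obtain rfl := h₄.unique h₄'
      exact h₃.fn h₃'

theorem Source.mem {p : Tid × ℕ} {j : ℕ} {x : Loc} {w : Event Tid Loc Val}
    (h : Source tag B src p j x w) : w ∈ (build tag B lt src lo).E := by
  rcases h with ⟨i, h₁, h₂⟩ | ⟨h₁, ⟨h₂, rfl⟩ | ⟨q, i, h₂, h₃, h₄⟩⟩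
  · exact .inr ⟨_, _, h₁⟩
  · exact .inl ⟨x, rfl⟩
  · exact .inr ⟨_, _, h₃⟩

variable [DecidableEq Loc]

theorem Source.value (hB : Buildable tag B lt src) {p : Tid × ℕ} {j : ℕ} {x : Loc} {v : Val}
    {w : Event Tid Loc Val} (h : Source tag B src p j x w) (hj : (B p)[j]? = some (.R x v)) :
    w.lab = .W x v := by
  have hv := (hB.legal p).eq_of_getElem? hj
  rcases h with ⟨i, h₁, h₂⟩ | ⟨h₁, h₂⟩
  · obtain ⟨v', hv'⟩ := h₂.1
    have h3 := memAfter_of_isLastWrite h₂ hv' (extVal B src p)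
    rw [List.getElem?_take] at hv'
    split_ifs at hv' with hij
    rw [h₁.2] at hv'
    rw [hv, h3, Option.some.inj hv']
  · rw [memAfter_of_notMem h₁] at hv
    rcases h₂ with ⟨h₂, rfl⟩ | ⟨q, i, h₂, h₃, h₄⟩
    · simp [hv, extVal, h₂, initEvent]
    · obtain ⟨v', hv'⟩ := h₄.1
      have h3 := memAfter_of_isLastWrite h₄ hv' (fun _ => 0)
      rw [h₃.2] at hv'
      rw [hv, Option.some.inj hv', ← h3]
      simp [extVal, h₂]

theorem Buildable.exists_source (hB : Buildable tag B lt src) (p : Tid × ℕ) (j : ℕ) (x : Loc) :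
    ∃ w : Event Tid Loc Val, Source tag B src p j x w := by
  by_cases hx : x ∈ writesOf ((B p).take j)
  · obtain ⟨i, hi⟩ := exists_isLastWrite hx
    obtain ⟨v, hv⟩ := hi.1
    rw [List.getElem?_take] at hv
    split_ifs at hv with hij
    obtain ⟨w, hw, -⟩ := exists_placed (tag := tag) hv
    exact ⟨w, .inl ⟨i, hw, hi⟩⟩
  · cases hs : src p x with
    | none => exact ⟨_, .inr ⟨hx, .inl ⟨hs, rfl⟩⟩⟩
    | some q =>
      obtain ⟨i, hi⟩ := exists_isLastWrite (hB.src_mem p x q hs)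
      obtain ⟨v, hv⟩ := hi.1
      obtain ⟨w, hw, -⟩ := exists_placed (tag := tag) hv
      exact ⟨w, .inr ⟨hx, .inr ⟨q, i, hs, hw, hi⟩⟩⟩

/-- The graph built from blocks is an execution graph: the writes to a location are ordered first by
the order of the blocks and then by position, and every read has a unique source. -/
theorem build_wf (hB : Buildable tag B lt src)
    (lo_mem : ∀ a b, lo a b → a ∈ (build tag B lt src lo).E ∧ b ∈ (build tag B lt src lo).E)
    (lo_lock : ∀ a b, lo a b → a.lab.IsLock ∧ b.lab.IsLock ∧ a.loc = b.loc)
    (lo_irrefl : ∀ a, ¬ lo a a) (lo_trans : ∀ a b c, lo a b → lo b c → lo a c) :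
    (build tag B lt src lo).WF := by
  have hL : Layout (build tag B lt src lo) tag B (Placed tag B) := build_layout
  have hinit : ∀ {e}, e ∈ (build tag B lt src lo).E → e.tid = none → ∃ x, e = initEvent x := by
    rintro e (h | ⟨p, j, h⟩) ht
    · exact h
    · rw [h.tid] at ht; simp at ht
  have hnU : ∀ {p j} {e : Event Tid Loc Val} {x a b}, Placed tag B p j e → e.lab ≠ .U x a b :=
    fun h h' => hB.no_upd _ _ _ _ (List.mem_of_getElem? (h' ▸ h.2))
  have htag : ∀ {p q} {e f : Event Tid Loc Val} {i j}, Placed tag B p j e → Placed tag B q i f →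
      e.tx ≠ 0 → e.tx = f.tx → p = q := by
    intro p q e f i j h h' h0 he
    rw [h.tx] at h0
    rcases hB.tags with ht | ht
    · exact (h0 (ht p)).elim
    · exact ht.2.1 (by rw [← h.tx, ← h'.tx, he])
  have hplaced : ∀ {e}, e ∈ (build tag B lt src lo).E → e.tx ≠ 0 → ∃ p j, Placed tag B p j e := by
    rintro e (⟨x, rfl⟩ | h) h0
    · exact (h0 rfl).elim
    · exact h
  refine ⟨?_, ?_, ?_, ?_, ?_, ?_, ?_, ?_, ?_, ?_, ?_, ?_, ?_, ?_, ?_, ?_, ?_, ?_, ?_, ?_,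
    lo_mem, lo_lock, lo_irrefl, lo_trans⟩
  · intro e he ht
    obtain ⟨x, rfl⟩ := hinit he ht
    exact ⟨rfl, x, rfl⟩
  · refine fun x => ⟨initEvent x, ⟨.inl ⟨x, rfl⟩, rfl, rfl⟩, ?_⟩
    rintro e ⟨he, ht, hl⟩
    obtain ⟨y, rfl⟩ := hinit he ht
    cases hl; rfl
  · intro e he h0
    obtain ⟨p, j, h⟩ := hplaced he h0
    rcases hB.tags with ht | ht
    · rw [h.tx] at h0; exact (h0 (ht p)).elim
    · exact ht.2.2 p _ (List.mem_of_getElem? h.2)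
  · rintro a b (⟨x, q, i, rfl, h⟩ | ⟨p, j, q, i, h, h', -⟩)
    · exact ⟨.inl ⟨x, rfl⟩, hL.mem h⟩
    · exact ⟨hL.mem h, hL.mem h'⟩
  · rintro a b (⟨x, q, i, rfl, h⟩ | ⟨p, j, q, i, h, h', hpq, -⟩)
    · exact ⟨by simp [h.tid], .inl rfl⟩
    · exact ⟨by simp [h'.tid], .inr (by rw [h.tid, h'.tid, hpq])⟩
  · intro a ha b hb hta htb
    obtain ⟨x, rfl⟩ := hinit ha hta
    obtain ⟨p, j, h⟩ := hL.cover hb htb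
    exact .inl ⟨x, p, j, rfl, h⟩
  · rintro a (⟨x, q, i, rfl, h⟩ | ⟨p, j, q, i, h, h', -, hlt⟩)
    · exact h.ne_init
    · obtain ⟨rfl, rfl⟩ := h.inj h'
      omega
  · rintro a b c (⟨x, q, i, rfl, h⟩ | ⟨p, j, q, i, h, h', hpq, hlt⟩)
      (⟨y, q', i', rfl, h₁⟩ | ⟨p', j', q', i', h₁, h₁', hpq', hlt'⟩)
    · exact (h.ne_init).elim
    · exact .inl ⟨x, q', i', rfl, h₁'⟩
    · exact (h'.ne_init).elim
    · obtain ⟨rfl, rfl⟩ := h'.inj h₁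
      refine .inr ⟨p, j, q', i', h, h₁', hpq.trans hpq', ?_⟩
      omega
  · intro a ha b hb hab hta hne
    obtain ⟨p, j, h⟩ := hL.cover ha hta
    obtain ⟨q, i, h'⟩ := hL.cover hb (hab ▸ hta)
    have hpq : p.1 = q.1 := by simpa [h.tid, h'.tid] using hab
    rw [hL.po h h', hL.po h' h]
    by_cases h2 : p = q
    · subst h2
      have : j ≠ i := by rintro rfl; exact hne (h.fn h')
      exact (lt_or_gt_of_ne this).imp (fun h3 => ⟨rfl, .inr ⟨rfl, h3⟩⟩)
        fun h3 => ⟨rfl, .inr ⟨rfl, h3⟩⟩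
    · have : p.2 ≠ q.2 := fun h3 => h2 (Prod.ext hpq h3)
      exact (lt_or_gt_of_ne this).imp (fun h3 => ⟨hpq, .inl h3⟩) fun h3 => ⟨hpq.symm, .inl h3⟩
  · intro a ha b hb h0 hab hne
    obtain ⟨p, j, h⟩ := hplaced ha h0
    obtain ⟨q, i, h'⟩ := hplaced hb (hab ▸ h0)
    obtain rfl := htag h h' h0 hab
    rw [hL.po h h', hL.po h' h]
    have : j ≠ i := by rintro rfl; exact hne (h.fn h')
    exact (lt_or_gt_of_ne this).imp (fun h3 => ⟨rfl, .inr ⟨rfl, h3⟩⟩)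
      fun h3 => ⟨rfl, .inr ⟨rfl, h3⟩⟩
  · rintro a b c h0 hac (⟨x, q, i, rfl, h⟩ | ⟨p, j, q, i, h, h', hpq, hlt⟩)
      (⟨y, q', i', rfl, h₁⟩ | ⟨p', j', q', i', h₁, h₁', hpq', hlt'⟩)
    · exact (h0 rfl).elim
    · exact (h0 rfl).elim
    · exact (h'.ne_init).elim
    · obtain ⟨rfl, rfl⟩ := h'.inj h₁
      obtain rfl := htag h h₁' h0 hac
      have : p = q := Prod.ext hpq (by omega)
      rw [h.tx, h'.tx, this]
  · rintro a b ⟨p, j, x, v, h, -, hs⟩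
    exact ⟨hs.mem, hL.mem h⟩
  · rintro a b ⟨p, j, x, v, h, hl, hs⟩
    have := hs.value hB (hl ▸ h.2)
    refine ⟨by simp [Event.loc, this, hl, Label.loc], v, by simp [this, Label.valW],
      by simp [hl, Label.valR]⟩
  · intro b hb hr
    have ht : b.tid ≠ none := by
      intro ht
      obtain ⟨x, rfl⟩ := hinit hb ht
      simp [Label.IsRead, initEvent, Label.valR] at hr
    obtain ⟨p, j, h⟩ := hL.cover hb ht
    rcases Label.eq_R_of_isRead hr with ⟨v, hv⟩ | ⟨v, w, hv⟩
    · obtain ⟨w, hw⟩ := hB.exists_source p j b.lab.loc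
      refine ⟨w, ⟨p, j, _, v, h, hv, hw⟩, ?_⟩
      rintro w' ⟨p', j', x', v', h', hl', hs'⟩
      obtain ⟨rfl, rfl⟩ := h.inj h'
      rw [hl'] at hw
      exact hs'.unique hw
    · exact (hnU h hv).elim
  · rintro a b (⟨x, v, q, i, rfl, h, -⟩ | ⟨p, j, q, i, x, v, w, h, h', -⟩)
    · exact ⟨.inl ⟨x, rfl⟩, hL.mem h⟩
    · exact ⟨hL.mem h, hL.mem h'⟩
  · rintro a b (⟨x, v, q, i, rfl, h, hl⟩ | ⟨p, j, q, i, x, v, w, h, h', hl, hl', -⟩)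
    · simp [Label.IsWrite, Event.loc, hl, initEvent, Label.loc, Label.valW]
    · simp [Label.IsWrite, Event.loc, hl, hl', Label.loc, Label.valW]
  · rintro a (⟨x, v, q, i, rfl, h, hl⟩ | ⟨p, j, q, i, x, v, w, h, h', hl, hl', hlt⟩)
    · exact h.ne_init
    · obtain ⟨rfl, rfl⟩ := h.inj h'
      rcases hlt with hlt | hlt
      · exact hB.irrefl x p (h.mem_writesOf hl) hlt
      · omega
  · rintro a b c (⟨x, v, q, i, rfl, h, hl⟩ | ⟨p, j, q, i, x, v, w, h, h', hl, hl', hlt⟩)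
      (⟨y, v', q', i', rfl, h₁, hl₁⟩ | ⟨p', j', q', i', y, v', w', h₁, h₁', hl₁, hl₁', hlt'⟩)
    · exact (h.ne_init).elim
    · rw [hl] at hl₁
      cases hl₁
      exact .inl ⟨x, _, _, _, rfl, h₁', hl₁'⟩
    · exact (h'.ne_init).elim
    · rw [hl'] at hl₁
      cases hl₁
      obtain ⟨rfl, rfl⟩ := h'.inj h₁
      refine .inr ⟨p, j, q', i', x, _, _, h, h₁', hl, hl₁', ?_⟩
      rcases hlt with hlt | ⟨rfl, hlt⟩ <;> rcases hlt' with hlt' | ⟨rfl, hlt'⟩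
      · exact .inl (hB.trans x p q q' (h.mem_writesOf hl) (h'.mem_writesOf hl')
          (h₁'.mem_writesOf hl₁') hlt hlt')
      · exact .inl hlt
      · exact .inl hlt'
      · exact .inr ⟨rfl, hlt.trans hlt'⟩
  · intro a ha b hb hwa hwb hloc hne
    have hcase : ∀ {e}, e ∈ (build tag B lt src lo).E → e.lab.IsWrite →
        e = initEvent e.loc ∨ ∃ p j v, Placed tag B p j e ∧ e.lab = .W e.loc v := by
      rintro e (⟨x, rfl⟩ | ⟨p, j, h⟩) hw
      · exact .inl rfl
      · rcases Label.eq_W_of_isWrite hw with ⟨v, hv⟩ | ⟨v, w, hv⟩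
        · exact .inr ⟨p, j, v, h, hv⟩
        · exact (hnU h hv).elim
    rcases hcase ha hwa with hi | ⟨p, j, v, h, hl⟩ <;>
      rcases hcase hb hwb with hi' | ⟨q, i, w, h', hl'⟩
    · rw [hi, hi', hloc] at hne; exact (hne rfl).elim
    · exact .inl (.inl ⟨_, w, q, i, hi, h', hloc ▸ hl'⟩)
    · exact .inr (.inl ⟨_, v, p, j, hi', h, hloc ▸ hl⟩)
    · rw [← hloc] at hl'
      by_cases hpq : p = q
      · subst hpq
        have : j ≠ i := by rintro rfl; exact hne (h.fn h')
        rcases lt_or_gt_of_ne this with hlt | hlt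
        · exact .inl (.inr ⟨_, _, _, _, _, _, _, h, h', hl, hl', .inr ⟨rfl, hlt⟩⟩)
        · exact .inr (.inr ⟨_, _, _, _, _, _, _, h', h, hl', hl, .inr ⟨rfl, hlt⟩⟩)
      · rcases hB.total _ p q (h.mem_writesOf hl) (h'.mem_writesOf hl') hpq with hlt | hlt
        · exact .inl (.inr ⟨_, _, _, _, _, _, _, h, h', hl, hl', .inl hlt⟩)
        · exact .inr (.inr ⟨_, _, _, _, _, _, _, h', h, hl', hl, .inl hlt⟩)
  · intro a ha b hb hta htb hw hloc
    obtain ⟨x, rfl⟩ := hinit ha hta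
    obtain ⟨p, j, h⟩ := hL.cover hb htb
    have hloc : x = b.loc := hloc
    subst hloc
    rcases Label.eq_W_of_isWrite hw with ⟨v, hv⟩ | ⟨v, w, hv⟩
    · exact .inl ⟨_, v, p, j, rfl, h, hv⟩
    · exact (hnU h hv).elim

end Build

/-! ### Internal consistency of built graphs -/

section BuildSI

variable {Tid Loc Val : Type*} [Zero Val]
variable {tag : Tid × ℕ → ℕ} {B : Tid × ℕ → List (Label Loc Val)}
  {lt : Tid × ℕ → Tid × ℕ → Prop} {src : Tid × ℕ → Loc → Option (Tid × ℕ)}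
  {lo : Event Tid Loc Val → Event Tid Loc Val → Prop}

theorem build_st (ht : Function.Injective tag) {a b : Event Tid Loc Val} (h0 : ∀ p, tag p ≠ 0) :
    (build tag B lt src lo).st a b ↔ ∃ p j i, Placed tag B p j a ∧ Placed tag B p i b := by
  constructor
  · rintro ⟨ha, hb, hn, hab⟩
    rcases ha with ⟨x, rfl⟩ | ⟨p, j, h⟩
    · exact (hn rfl).elim
    rcases hb with ⟨x, rfl⟩ | ⟨q, i, h'⟩
    · rw [hab] at hn; exact (hn rfl).elim
    rw [h.tx, h'.tx] at hab
    exact ⟨p, j, i, h, ht hab ▸ h'⟩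
  · rintro ⟨p, j, i, h, h'⟩
    exact ⟨.inr ⟨p, j, h⟩, .inr ⟨p, i, h'⟩, by rw [h.tx]; exact h0 p, by rw [h.tx, h'.tx]⟩

variable [DecidableEq Loc]

/-- A built graph satisfies the part of SI-consistency that concerns single transactions. -/
theorem build_int (hB : Buildable tag B lt src) (ht : Function.Injective tag)
    (h0 : ∀ p, tag p ≠ 0) (hs : ∀ p x, src p x ≠ some p) (a b : Event Tid Loc Val)
    (h : (build tag B lt src lo).intra (build tag B lt src lo).rf a b ∨
      (build tag B lt src lo).intra (build tag B lt src lo).mo a b ∨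
      (build tag B lt src lo).intra (build tag B lt src lo).rb a b) :
    (build tag B lt src lo).po a b := by
  have po : ∀ {p j i} {a b : Event Tid Loc Val}, Placed tag B p j a → Placed tag B p i b → j < i →
      (build tag B lt src lo).po a b := fun h h' hlt =>
    (build_layout.po h h').2 ⟨rfl, .inr ⟨rfl, hlt⟩⟩
  have hmo : ∀ {p j i} {a b : Event Tid Loc Val}, Placed tag B p j a → Placed tag B p i b →
      (build tag B lt src lo).mo a b → j < i := by
    rintro p j i a b h h' (⟨x, v, q, i', rfl, -, -⟩ | ⟨p', j', q, i', x, v, w, h₁, h₂, hl, -, hlt⟩)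
    · exact (h.ne_init).elim
    · obtain ⟨rfl, rfl⟩ := h.inj h₁
      obtain ⟨rfl, rfl⟩ := h'.inj h₂
      rcases hlt with hlt | hlt
      · exact (hB.irrefl x p (h.mem_writesOf hl) hlt).elim
      · exact hlt.2
  rcases h with ⟨hr, hst⟩ | ⟨hr, hst⟩ | ⟨hr, hst⟩ <;>
    obtain ⟨p, j, i, h, h'⟩ := (build_st ht h0).1 hst
  · obtain ⟨p', i', x, v, h₁, hl, hsrc⟩ := hr
    obtain ⟨rfl, rfl⟩ := h'.inj h₁
    rcases hsrc with ⟨j', h₂, hw⟩ | ⟨-, ⟨-, rfl⟩ | ⟨q, j', hq, h₂, -⟩⟩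
    · obtain ⟨-, rfl⟩ := h.inj h₂
      obtain ⟨v', hv'⟩ := hw.1
      rw [List.getElem?_take] at hv'
      split_ifs at hv' with hlt
      exact po h h' hlt
    · exact (h.ne_init).elim
    · obtain ⟨rfl, rfl⟩ := h.inj h₂
      exact (hs _ _ hq).elim
  · exact po h h' (hmo h h' hr)
  · obtain ⟨hne, w, ⟨p', j', x, v, h₁, hl, hsrc⟩, hmo'⟩ := hr
    obtain ⟨rfl, rfl⟩ := h.inj h₁
    refine po h h' (lt_of_not_ge fun hle => ?_)
    have hlt : i < j := lt_of_le_of_ne hle fun e => hne (by subst e; exact h.fn h')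
    have hwx : w.lab = .W x v := hsrc.value hB (hl ▸ h.2)
    obtain ⟨y, hy⟩ : ∃ y, b.lab = .W x y := by
      rcases hmo' with ⟨z, y, q, i', rfl, h₂, hb⟩ | ⟨_, _, q, i', z, y, y', _, h₂, ha, hb, -⟩
      · simp only [initEvent, Label.W.injEq] at hwx
        exact ⟨y, hwx.1 ▸ hb⟩
      · rw [ha] at hwx; cases hwx; exact ⟨y', hb⟩
    have htake : ((B p).take j)[i]? = some (.W x y) := by
      rw [List.getElem?_take, if_pos hlt, h'.2, hy]
    rcases hsrc with ⟨j', h₂, hw⟩ | ⟨hn, -⟩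
    · have h3 := hw.2 _ _ htake
      have h4 := hmo h₂ h' hmo'
      omega
    · exact hn (mem_writesOf_iff_getElem?.2 ⟨_, _, htake⟩)

end BuildSI

/-! ### Successful attempts in RA-consistent graphs -/

section Sound

variable {Tid Loc Val : Type*}

theorem accessed_nonempty_of_mem_writesOf {t : List (Label Loc Val)} {x : Loc}
    (hx : x ∈ writesOf t) : (accessed t).Nonempty := ⟨x, .inr hx⟩

section HappensBefore

variable {G : ExecGraph Tid Loc Val}

theorem hb_of_po {a b : Event Tid Loc Val} (h : G.po a b) : G.hb a b := .single (.inl h)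

theorem hb_trans {a b c : Event Tid Loc Val} (h : G.hb a b) (h' : G.hb b c) : G.hb a c :=
  Relation.TransGen.trans h h'

theorem hb_of_hb_of_eq_or_po {a b c : Event Tid Loc Val} (h : G.hb a b) (h' : b = c ∨ G.po b c) :
    G.hb a c := by
  rcases h' with rfl | h'
  · exact h
  · exact hb_trans h (hb_of_po h')

theorem hb_of_po_of_lo {a u b : Event Tid Loc Val} (h : G.po a u) (h' : u = b ∨ G.lo u b) :
    G.hb a b := by
  rcases h' with rfl | h'
  · exact hb_of_po h
  · exact hb_trans (hb_of_po h) (.single (.inr (.inr h')))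

end HappensBefore

variable [Zero Val] [DecidableEq Loc]

/-- `G` is an RA-consistent execution graph of an implementation: block `p` consists of the trace
`F p` of failed attempts and the trace `V p` of a successful attempt to execute a transaction
with the accesses `T p`, which reads the values `m p` from other transactions. -/
structure Attempts (G : ExecGraph Tid Loc Val) (At : Tid × ℕ → ℕ → Event Tid Loc Val → Prop)
    (F V T : Tid × ℕ → List (Label Loc Val)) (m : Tid × ℕ → Loc → Val) : Prop where
  wf : G.WF
  ra : G.RAConsistent
  lay : Layout G (fun _ => 0) (fun p => F p ++ V p) At
  fail : ∀ p, ∀ l ∈ F p, l.valW = none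
  block : ∀ p, Block (m p) (T p) (V p)

/-- The event `e` is number `i` of the successful attempt `p`. -/
def InV (At : Tid × ℕ → ℕ → Event Tid Loc Val → Prop) (F : Tid × ℕ → List (Label Loc Val))
    (p : Tid × ℕ) (i : ℕ) (e : Event Tid Loc Val) : Prop := At p ((F p).length + i) e

/-- The last event of stage at most `s` of the successful attempt `p`. -/
def LastStage (At : Tid × ℕ → ℕ → Event Tid Loc Val → Prop) (F : Tid × ℕ → List (Label Loc Val))
    (p : Tid × ℕ) (s : ℕ) (e : Event Tid Loc Val) : Prop :=
  ∃ i, InV At F p i e ∧ e.lab.stage ≤ s ∧ ∀ i' f, InV At F p i' f → f.lab.stage ≤ s → i' ≤ i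

/-- The attempt `q` owns its write locks after the attempt `p` does. -/
def CommitLT (G : ExecGraph Tid Loc Val)
    (At : Tid × ℕ → ℕ → Event Tid Loc Val → Prop) (F : Tid × ℕ → List (Label Loc Val))
    (p q : Tid × ℕ) : Prop :=
  ∃ c d, LastStage At F p 2 c ∧ LastStage At F q 2 d ∧ G.hb c d

/-- The attempt `q` completes its snapshot after the attempt `p` owns its write locks. -/
def CommitSnap (G : ExecGraph Tid Loc Val)
    (At : Tid × ℕ → ℕ → Event Tid Loc Val → Prop) (F : Tid × ℕ → List (Label Loc Val))
    (p q : Tid × ℕ) : Prop :=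
  ∃ c s, LastStage At F p 2 c ∧ LastStage At F q 0 s ∧ G.hb c s

/-- The attempt `q` owns its write locks after the attempt `p` completes its snapshot. -/
def SnapCommit (G : ExecGraph Tid Loc Val)
    (At : Tid × ℕ → ℕ → Event Tid Loc Val → Prop) (F : Tid × ℕ → List (Label Loc Val))
    (p q : Tid × ℕ) : Prop :=
  ∃ s c, LastStage At F p 0 s ∧ LastStage At F q 2 c ∧ G.hb s c

namespace Attempts

variable {G : ExecGraph Tid Loc Val} {At : Tid × ℕ → ℕ → Event Tid Loc Val → Prop}
  {F V T : Tid × ℕ → List (Label Loc Val)} {m : Tid × ℕ → Loc → Val}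

theorem hb_irrefl (h : Attempts G At F V T m) (a : Event Tid Loc Val) : ¬ G.hb a a := fun hab =>
  h.ra.acyclic a (.single (.inl ⟨hab, rfl⟩))

theorem label (h : Attempts G At F V T m) {p : Tid × ℕ} {i : ℕ} {e : Event Tid Loc Val}
    (he : InV At F p i e) : (V p)[i]? = some e.lab := by
  have := h.lay.lab he
  rwa [List.getElem?_append_right (by omega), Nat.add_sub_cancel_left] at this

theorem exists_event (h : Attempts G At F V T m) {p : Tid × ℕ} {l : Label Loc Val}
    (hl : l ∈ V p) : ∃ i e, InV At F p i e ∧ e.lab = l := by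
  obtain ⟨i, hi⟩ := List.mem_iff_getElem?.1 hl
  obtain ⟨e, he, hl⟩ := h.lay.ex (p := p) (j := (F p).length + i) (l := l)
    (by rw [List.getElem?_append_right (by omega), Nat.add_sub_cancel_left, hi])
  exact ⟨i, e, he, hl⟩

theorem lt_of_stage_lt (h : Attempts G At F V T m) {p : Tid × ℕ} {i j : ℕ}
    {e f : Event Tid Loc Val} (he : InV At F p i e) (hf : InV At F p j f)
    (hs : e.lab.stage < f.lab.stage) : i < j := by
  by_contra hij
  rcases (not_lt.1 hij).lt_or_eq with hij | rfl
  · obtain ⟨h₁, h₁'⟩ := List.getElem?_eq_some_iff.1 (h.label he)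
    obtain ⟨h₂, h₂'⟩ := List.getElem?_eq_some_iff.1 (h.label hf)
    have := List.pairwise_iff_getElem.1 (h.block p).sorted j i h₂ h₁ hij
    rw [h₁', h₂'] at this
    omega
  · rw [h.lay.fn he hf] at hs
    exact lt_irrefl _ hs

theorem po_of_lt (h : Attempts G At F V T m) {p : Tid × ℕ} {i j : ℕ}
    {e f : Event Tid Loc Val} (he : InV At F p i e) (hf : InV At F p j f)
    (hij : i < j) : G.po e f :=
  (h.lay.po he hf).2 ⟨rfl, .inr ⟨rfl, by omega⟩⟩

theorem po_of_stage_lt (h : Attempts G At F V T m) {p : Tid × ℕ} {i j : ℕ}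
    {e f : Event Tid Loc Val} (he : InV At F p i e) (hf : InV At F p j f)
    (hs : e.lab.stage < f.lab.stage) : G.po e f :=
  h.po_of_lt he hf (h.lt_of_stage_lt he hf hs)

/-- Events `po`-after an event of a successful attempt belong to the same attempt or to a later
block. -/
theorem po_cases (h : Attempts G At F V T m) {p : Tid × ℕ} {i : ℕ} {a u : Event Tid Loc Val}
    (ha : InV At F p i a) (hu : G.po a u) :
    (∃ j, InV At F p j u) ∨ ∀ j e, InV At F p j e → G.po e u := by
  obtain ⟨q, k, hk⟩ := h.lay.cover (h.wf.po_mem _ _ hu).2 (h.wf.po_thread _ _ hu).1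
  obtain ⟨h₁, h₂ | ⟨h₂, h₃⟩⟩ := (h.lay.po ha hk).1 hu
  · exact .inr fun j e he => (h.lay.po he hk).2 ⟨h₁, .inl h₂⟩
  · obtain rfl : p = q := Prod.ext h₁ h₂
    refine .inl ⟨k - (F p).length, ?_⟩
    rwa [InV, Nat.add_sub_cancel' (by omega)]

theorem po_of_po (h : Attempts G At F V T m) {p : Tid × ℕ} {i j : ℕ} {a e u : Event Tid Loc Val}
    (ha : InV At F p i a) (hu : G.po a u) (he : InV At F p j e)
    (hs : e.lab.stage < u.lab.stage) : G.po e u := by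
  rcases h.po_cases ha hu with ⟨k, hk⟩ | h'
  · exact h.po_of_stage_lt he hk hs
  · exact h' j e he

theorem exists_lastStage (h : Attempts G At F V T m) {p : Tid × ℕ} {s : ℕ}
    (hp : (accessed (T p)).Nonempty) : ∃ e, LastStage At F p s e := by
  classical
  obtain ⟨x, hx⟩ := hp
  obtain ⟨i₀, r, hr, hrl⟩ := h.exists_event ((h.block p).rl x hx)
  let P : ℕ → Prop := fun i => ∃ e, InV At F p i e ∧ e.lab.stage ≤ s
  have hb : ∀ i, P i → i ≤ (V p).length := by
    rintro i ⟨e, he, -⟩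
    exact (List.getElem?_eq_some_iff.1 (h.label he)).1.le
  have h0 : P i₀ := ⟨r, hr, by simp [hrl, Label.stage]⟩
  obtain ⟨e, he, hs⟩ := Nat.findGreatest_spec (hb i₀ h0) h0
  exact ⟨e, _, he, hs, fun i' f hf hf' => Nat.le_findGreatest (hb i' ⟨f, hf, hf'⟩) ⟨f, hf, hf'⟩⟩

theorem eq_or_po_last (h : Attempts G At F V T m) {p : Tid × ℕ} {s i : ℕ}
    {e c : Event Tid Loc Val} (hc : LastStage At F p s c) (he : InV At F p i e)
    (hs : e.lab.stage ≤ s) : e = c ∨ G.po e c := by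
  obtain ⟨k, hk, -, hmax⟩ := hc
  rcases (hmax i e he hs).lt_or_eq with hlt | rfl
  · exact .inr (h.po_of_lt he hk hlt)
  · exact .inl (h.lay.fn he hk)

/-- The writer lock that is obtained by a promotion is released after all stores. -/
theorem hb_of_promoted (h : Attempts G At F V T m) {p : Tid × ℕ} {x : Loc} {i : ℕ}
    {a b : Event Tid Loc Val} (ha : InV At F p i a) (hl : a.lab = .PL x) (hab : G.lo a b)
    {j : ℕ} {e : Event Tid Loc Val} (he : InV At F p j e) (hs : e.lab.stage ≤ 3) : G.hb e b := by
  obtain ⟨u, -, hu, hpo, hub⟩ := h.ra.wex a b hab (.inr (by simp [Event.loc, hl, Label.loc]))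
  exact hb_of_po_of_lo (h.po_of_po ha hpo he (by rw [hu]; exact Nat.lt_succ_of_le hs)) hub

theorem wsync (h : Attempts G At F V T m) {p q : Tid × ℕ} {x : Loc} {i j : ℕ}
    {a b : Event Tid Loc Val} (ha : InV At F p i a) (hl : a.lab = .PL x) (hbV : InV At F q j b)
    (hl' : b.lab = .PL x ∨ b.lab = .RL x) (hpq : p ≠ q) : G.lo a b ∨ G.lo b a := by
  refine h.ra.wsync a (h.lay.mem ha) b (h.lay.mem hbV) ?_ ?_ ?_ ?_
  · simp [Label.IsWLock, hl, Label.loc]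
  · rcases hl' with hl' | hl' <;> simp [Label.IsLock, Label.IsWLock, Label.IsRLock, hl', Label.loc]
  · rcases hl' with hl' | hl' <;> simp [Event.loc, hl, hl', Label.loc]
  · rintro rfl
    exact hpq (h.lay.inj ha hbV).1

theorem _root_.SnapIso.LastStage.unique (h : Attempts G At F V T m) {p : Tid × ℕ} {s : ℕ}
    {c d : Event Tid Loc Val} (hc : LastStage At F p s c) (hd : LastStage At F p s d) : c = d := by
  obtain ⟨i, hi, hs, hmax⟩ := hc
  obtain ⟨j, hj, hs', hmax'⟩ := hd
  obtain rfl : i = j := le_antisymm (hmax' i c hi hs) (hmax j d hj hs')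
  exact h.lay.fn hi hj

theorem exists_promotion (h : Attempts G At F V T m) {p : Tid × ℕ} {x : Loc}
    (hx : x ∈ writesOf (T p)) : ∃ i e, InV At F p i e ∧ e.lab = .PL x :=
  h.exists_event ((h.block p).pl x hx).1

theorem eq_or_po_snap_commit (h : Attempts G At F V T m) {p : Tid × ℕ} {s c : Event Tid Loc Val}
    (hs : LastStage At F p 0 s) (hc : LastStage At F p 2 c) : s = c ∨ G.po s c := by
  obtain ⟨i, hi, hi', -⟩ := hs
  exact h.eq_or_po_last hc hi (by omega)

theorem commitLT_irrefl (h : Attempts G At F V T m) (p : Tid × ℕ) : ¬ CommitLT G At F p p := by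
  rintro ⟨c, d, hc, hd, hcd⟩
  exact h.hb_irrefl c (hc.unique h hd ▸ hcd)

theorem commitLT_trans (h : Attempts G At F V T m) {p q r : Tid × ℕ} (hpq : CommitLT G At F p q)
    (hqr : CommitLT G At F q r) : CommitLT G At F p r := by
  obtain ⟨c, d, hc, hd, hcd⟩ := hpq
  obtain ⟨d', e, hd', he, hde⟩ := hqr
  obtain rfl := hd.unique h hd'
  exact ⟨c, e, hc, he, hb_trans hcd hde⟩

theorem commitLT_of_commitSnap (h : Attempts G At F V T m) {p q : Tid × ℕ}
    (hq : (accessed (T q)).Nonempty) (hpq : CommitSnap G At F p q) : CommitLT G At F p q := by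
  obtain ⟨c, s, hc, hs, hcs⟩ := hpq
  obtain ⟨d, hd⟩ := h.exists_lastStage (s := 2) hq
  exact ⟨c, d, hc, hd, hb_of_hb_of_eq_or_po hcs (h.eq_or_po_snap_commit hs hd)⟩

theorem commitLT_of_commitSnap_of_snapCommit (h : Attempts G At F V T m) {p q r : Tid × ℕ}
    (hpq : CommitSnap G At F p q) (hqr : SnapCommit G At F q r) : CommitLT G At F p r := by
  obtain ⟨c, s, hc, hs, hcs⟩ := hpq
  obtain ⟨s', d, hs', hd, hsd⟩ := hqr
  obtain rfl := hs.unique h hs'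
  exact ⟨c, d, hc, hd, hb_trans hcs hsd⟩

theorem snapCommit_of_commitLT (h : Attempts G At F V T m) {p q : Tid × ℕ}
    (hp : (accessed (T p)).Nonempty) (hpq : CommitLT G At F p q) : SnapCommit G At F p q := by
  obtain ⟨c, d, hc, hd, hcd⟩ := hpq
  obtain ⟨s, hs⟩ := h.exists_lastStage (s := 0) hp
  refine ⟨s, d, hs, hd, ?_⟩
  rcases h.eq_or_po_snap_commit hs hc with rfl | hsc
  · exact hcd
  · exact hb_trans (hb_of_po hsc) hcd

/-- If the attempt `p` promotes its lock on `x` before `b` is called, then it commits before any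
attempt that calls `b` as part of its promotions. -/
theorem commitLT_of_lo (h : Attempts G At F V T m) {p q : Tid × ℕ} {x : Loc} {i j : ℕ}
    {a b : Event Tid Loc Val} (ha : InV At F p i a) (hl : a.lab = .PL x) (hbV : InV At F q j b)
    (hl' : b.lab = .PL x) (hab : G.lo a b) (hx : x ∈ writesOf (T p)) (hx' : x ∈ writesOf (T q)) :
    CommitLT G At F p q := by
  obtain ⟨c, hc⟩ := h.exists_lastStage (s := 2) (accessed_nonempty_of_mem_writesOf hx)
  obtain ⟨d, hd⟩ := h.exists_lastStage (s := 2) (accessed_nonempty_of_mem_writesOf hx')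
  obtain ⟨k, hk, hs, -⟩ := id hc
  exact ⟨c, d, hc, hd, hb_of_hb_of_eq_or_po (h.hb_of_promoted ha hl hab hk (by omega))
    (h.eq_or_po_last hd hbV (by rw [hl']; exact le_rfl))⟩

theorem commitLT_total (h : Attempts G At F V T m) {p q : Tid × ℕ} {x : Loc}
    (hx : x ∈ writesOf (T p)) (hx' : x ∈ writesOf (T q)) (hpq : p ≠ q) :
    CommitLT G At F p q ∨ CommitLT G At F q p := by
  obtain ⟨i, a, ha, hl⟩ := h.exists_promotion hx
  obtain ⟨j, b, hbV, hl'⟩ := h.exists_promotion hx'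
  exact (h.wsync ha hl hbV (.inl hl') hpq).imp
    (fun hab => h.commitLT_of_lo ha hl hbV hl' hab hx hx')
    fun hba => h.commitLT_of_lo hbV hl' ha hl hba hx' hx

theorem hb_promotion_of_commitLT (h : Attempts G At F V T m) {p q : Tid × ℕ} {x : Loc}
    (hx : x ∈ writesOf (T p)) (hx' : x ∈ writesOf (T q)) (hlt : CommitLT G At F p q) {i j : ℕ}
    {e b : Event Tid Loc Val} (he : InV At F p i e) (hs : e.lab.stage ≤ 3)
    (hbV : InV At F q j b) (hl' : b.lab = .PL x) : G.hb e b := by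
  have hpq : p ≠ q := by rintro rfl; exact h.commitLT_irrefl _ hlt
  obtain ⟨i, a, ha, hl⟩ := h.exists_promotion hx
  rcases h.wsync ha hl hbV (.inl hl') hpq with hab | hba
  · exact h.hb_of_promoted ha hl hab he hs
  · exact (h.commitLT_irrefl _ (h.commitLT_trans hlt
      (h.commitLT_of_lo hbV hl' ha hl hba hx' hx))).elim

/-- Of two attempts that write to a common location, the one that commits first does so before
the other one takes its snapshot: otherwise the other one would hold the reader lock until it
promotes it. -/
theorem commitSnap_of_commitLT (h : Attempts G At F V T m) {p q : Tid × ℕ} {x : Loc}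
    (hx : x ∈ writesOf (T p)) (hx' : x ∈ writesOf (T q)) (hlt : CommitLT G At F p q) :
    CommitSnap G At F p q := by
  have hpq : p ≠ q := by rintro rfl; exact h.commitLT_irrefl _ hlt
  obtain ⟨i, a, ha, hl⟩ := h.exists_promotion hx
  obtain ⟨j, r, hr, hrl⟩ := h.exists_event ((h.block q).rl x (.inr hx'))
  obtain ⟨c, hc⟩ := h.exists_lastStage (s := 2) (accessed_nonempty_of_mem_writesOf hx)
  obtain ⟨d, hd⟩ := h.exists_lastStage (s := 2) (accessed_nonempty_of_mem_writesOf hx')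
  obtain ⟨s, hs⟩ := h.exists_lastStage (s := 0) (accessed_nonempty_of_mem_writesOf hx')
  obtain ⟨k, hk, hks, -⟩ := id hc
  obtain ⟨k', hk', -, -⟩ := id hd
  have hac := h.eq_or_po_last hc ha (by rw [hl]; exact le_rfl)
  rcases h.wsync ha hl hr (.inr hrl) hpq with har | hra
  · exact ⟨c, s, hc, hs, hb_of_hb_of_eq_or_po (h.hb_of_promoted ha hl har hk (by omega))
      (h.eq_or_po_last hs hr (by rw [hrl]; exact le_rfl))⟩
  · -- If `q` acquires its reader lock before `p` promotes the lock, then `q` has to give it up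
    -- first: not by a release, since `q` writes to `x`, and a promotion would let `q` commit before
    -- `p`.
    refine (h.commitLT_irrefl _ (h.commitLT_trans hlt ?_)).elim
    obtain ⟨u, -, hu, hpo, hua⟩ := h.ra.rshared r a hra (by simp [hrl, Event.loc, Label.loc])
      (by simp [Label.IsWLock, hl, Label.loc])
    have hrx : r.loc = x := by simp [hrl, Event.loc, Label.loc]
    rw [hrx] at hu
    rcases h.po_cases hr hpo with ⟨n, hn⟩ | hlater
    · rcases hu with hu | hu
      · exact (((h.block q).pl x hx').2 (hu ▸ List.mem_of_getElem? (h.label hn))).elim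
      · rcases hua with rfl | hua
        · exact (hpq (h.lay.inj ha hn).1).elim
        · exact h.commitLT_of_lo hn hu ha hl hua hx' hx
    · exact ⟨d, c, hd, hc, hb_of_hb_of_eq_or_po (hb_of_po_of_lo (hlater _ _ hk') hua) hac⟩

/-- A reader lock call for `x` of the attempt `p` either follows all stores of another attempt `q`
that writes to `x`, or the attempt `p` completes its snapshot before `q` promotes its lock. -/
theorem hb_or_hb (h : Attempts G At F V T m) {p q : Tid × ℕ} {x : Loc} (hpq : p ≠ q)
    (hx : x ∈ writesOf (T q)) {j : ℕ} {r : Event Tid Loc Val} (hr : InV At F p j r)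
    (hrl : r.lab = .RL x) :
    (∀ i e, InV At F q i e → e.lab.stage ≤ 3 → G.hb e r) ∨
      ∀ i e n b, InV At F p i e → e.lab.stage = 0 → InV At F q n b → b.lab = .PL x → G.hb e b := by
  obtain ⟨n, a, ha, hl⟩ := h.exists_promotion hx
  rcases h.wsync ha hl hr (.inr hrl) hpq.symm with har | hra
  · exact .inl fun i e he hs => h.hb_of_promoted ha hl har he hs
  by_cases hall : ∀ n b, InV At F q n b → b.lab = .PL x → G.lo r b
  · refine .inr fun i e n b he hs hbV hbl => ?_
    obtain ⟨u, -, hu, hpo, hub⟩ := h.ra.rshared r b (hall n b hbV hbl)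
      (by simp [hrl, Event.loc, Label.loc]) (by simp [Label.IsWLock, hbl, Label.loc])
    refine hb_of_po_of_lo (h.po_of_po hr hpo he ?_) hub
    rw [hs]
    rcases hu with hu | hu <;> simp [hu, Label.stage]
  · push Not at hall
    obtain ⟨n', b, hbV, hbl, hrb⟩ := hall
    have := (h.wsync hbV hbl hr (.inr hrl) hpq.symm).resolve_right hrb
    exact .inl fun i e he hs => h.hb_of_promoted hbV hbl this he hs

theorem mo_of_hb (h : Attempts G At F V T m) {w w' : Event Tid Loc Val} (hw : w ∈ G.E)
    (hw' : w' ∈ G.E) (hl : w.lab.IsWrite) (hl' : w'.lab.IsWrite) (hloc : w.loc = w'.loc)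
    (hb : G.hb w w') : G.mo w w' := by
  refine (h.wf.mo_total w hw w' hw' hl hl' hloc ?_).resolve_right fun hmo =>
    h.ra.acyclic w (.tail (.single (.inl ⟨hb, hloc⟩)) (.inr (.inl hmo)))
  rintro rfl
  exact h.hb_irrefl _ hb

/-- A read cannot read from a write that has been overwritten by a write that happens before the
read. -/
theorem not_hb_of_rf_of_mo (h : Attempts G At F V T m) {w w' l : Event Tid Loc Val}
    (hrf : G.rf w l) (hmo : G.mo w w') : ¬ G.hb w' l := by
  intro hb
  have hloc : w'.loc = l.loc := (h.wf.mo_write _ _ hmo).2.2.symm.trans (h.wf.rf_val _ _ hrf).1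
  refine h.ra.acyclic l (.tail (.single (.inr (.inr ⟨?_, w, hrf, hmo⟩))) (.inl ⟨hb, hloc⟩))
  rintro rfl
  exact h.hb_irrefl _ hb

theorem inV_of_isWrite (h : Attempts G At F V T m) {w : Event Tid Loc Val} (hw : w ∈ G.E)
    (ht : w.tid ≠ none) (hl : w.lab.IsWrite) : ∃ p i v, InV At F p i w ∧ w.lab = .W w.loc v := by
  obtain ⟨p, k, hk⟩ := h.lay.cover hw ht
  have hlab := h.lay.lab hk
  by_cases hlt : k < (F p).length
  · rw [List.getElem?_append_left hlt] at hlab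
    exact (hl (h.fail p _ (List.mem_of_getElem? hlab))).elim
  · have hin : InV At F p (k - (F p).length) w := by
      rwa [InV, Nat.add_sub_cancel' (not_lt.1 hlt)]
    rcases Label.eq_W_of_isWrite hl with ⟨v, hv⟩ | ⟨v, v', hv⟩
    · exact ⟨p, _, v, hin, hv⟩
    · exact ((h.block p).no_upd _ _ _ (hv ▸ List.mem_of_getElem? (h.label hin))).elim

/-- Every value that is read from another transaction is the initial value or the last value
written by another attempt that commits before the snapshot is complete. All later writers commit
after the snapshot is complete. -/
theorem exists_source (h : Attempts G At F V T m) {p : Tid × ℕ} {x : Loc}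
    (hx : x ∈ readsFirst (T p)) :
    (m p x = 0 ∧ ∀ q, q ≠ p → x ∈ writesOf (T q) → SnapCommit G At F p q) ∨
    ∃ q, q ≠ p ∧ x ∈ writesOf (T q) ∧ memAfter (fun _ => 0) (T q) x = m p x ∧
      CommitSnap G At F q p ∧
      ∀ q', q' ≠ p → x ∈ writesOf (T q') → CommitLT G At F q q' → SnapCommit G At F p q' := by
  have hacc : x ∈ accessed (T p) := .inl hx
  obtain ⟨v₁, v₂, hV, hrl⟩ := (h.block p).load x hx
  obtain ⟨j, hj⟩ := List.mem_iff_getElem?.1 hrl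
  have hjlt := (List.getElem?_eq_some_iff.1 hj).1
  obtain ⟨r, hr, hrl⟩ : ∃ r, InV At F p j r ∧ r.lab = .RL x := h.lay.ex
    (by rw [List.getElem?_append_right (by omega), Nat.add_sub_cancel_left, hV,
      List.getElem?_append_left hjlt, hj])
  obtain ⟨l, hl, hll⟩ : ∃ l, InV At F p v₁.length l ∧ l.lab = .R x (m p x) := h.lay.ex
    (by rw [List.getElem?_append_right (by omega), Nat.add_sub_cancel_left, hV]; simp)
  have hrl' : G.hb r l := hb_of_po (h.po_of_lt hr hl hjlt)
  have hlx : l.loc = x := by simp [Event.loc, hll, Label.loc]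
  obtain ⟨s, hs⟩ := h.exists_lastStage (s := 0) ⟨x, hacc⟩
  have hrs := h.eq_or_po_last hs hr (by rw [hrl]; exact le_rfl)
  have hss : s.lab.stage = 0 := by obtain ⟨_, -, h0, -⟩ := hs; omega
  obtain ⟨k, hk, -⟩ := id hs
  obtain ⟨w, hrf, -⟩ := h.wf.rf_unique l (h.lay.mem hl) (by simp [Label.IsRead, hll, Label.valR])
  obtain ⟨hwl, v, hwv, hlv⟩ := h.wf.rf_val _ _ hrf
  obtain rfl : m p x = v := by simpa [hll, Label.valR] using hlv
  have hwE := (h.wf.rf_mem _ _ hrf).1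
  have hww : w.lab.IsWrite := by simp [Label.IsWrite, hwv]
  -- the snapshot precedes the commit of every writer whose stores would overwrite the value read
  have key : ∀ q, q ≠ p → x ∈ writesOf (T q) →
      (∀ i w', InV At F q i w' → (∃ v, w'.lab = .W x v) → G.mo w w') →
      SnapCommit G At F p q := by
    intro q hq hxq hmo
    rcases h.hb_or_hb hq.symm hxq hr hrl with h1 | h1
    · obtain ⟨v', hv'⟩ := (h.block q).writes.symm ▸ hxq
      obtain ⟨i, w', hw', hl'⟩ := h.exists_event hv'
      exact (h.not_hb_of_rf_of_mo hrf (hmo i w' hw' ⟨v', hl'⟩)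
        (hb_trans (h1 i w' hw' (by rw [hl']; exact le_rfl)) hrl')).elim
    · obtain ⟨i, a, ha, hal⟩ := h.exists_promotion hxq
      obtain ⟨d, hd⟩ := h.exists_lastStage (s := 2) (accessed_nonempty_of_mem_writesOf hxq)
      exact ⟨s, d, hs, hd, hb_of_hb_of_eq_or_po (h1 k s i a hk hss ha hal)
        (h.eq_or_po_last hd ha (by rw [hal]; exact le_rfl))⟩
  by_cases ht : w.tid = none
  · obtain ⟨-, y, hy⟩ := h.wf.init_lab w hwE ht
    refine .inl ⟨by simpa [hy, Label.valW] using hwv.symm, fun q hq hxq => key q hq hxq ?_⟩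
    rintro i w' hw' ⟨v', hl'⟩
    refine h.wf.mo_init w hwE w' (h.lay.mem hw') ht (by simp [h.lay.tid hw'])
      (by simp [Label.IsWrite, hl', Label.valW]) (hwl.trans (hlx.trans ?_))
    simp [Event.loc, hl', Label.loc]
  · obtain ⟨q, i, v, hw, hwlab⟩ := h.inV_of_isWrite hwE ht hww
    rw [hwl, hlx] at hwlab
    obtain rfl : v = m p x := by simpa [hwlab, Label.valW] using hwv
    have hxq : x ∈ writesOf (T q) :=
      (h.block q).writes ▸ mem_writesOf_iff_getElem?.2 ⟨i, _, hwlab ▸ h.label hw⟩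
    have hstage : w.lab.stage = 3 := by rw [hwlab]; rfl
    have hne : q ≠ p := by
      rintro rfl
      have : G.po l w := h.po_of_stage_lt hl hw (by rw [hll, hstage]; exact Nat.succ_pos 2)
      exact h.hb_irrefl l (hb_trans (hb_of_po this) (.single (.inr (.inl hrf))))
    -- the load cannot precede the promotion of `q`, as it reads from a store of `q`
    have h1 : ∀ i e, InV At F q i e → e.lab.stage ≤ 3 → G.hb e r := by
      rcases h.hb_or_hb hne.symm hxq hr hrl with h1 | h1
      · exact h1
      · obtain ⟨n, a, ha, hal⟩ := h.exists_promotion hxq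
        have h2 := h1 _ l n a hl (by rw [hll]; rfl) ha hal
        have h3 : G.po a w := h.po_of_stage_lt ha hw (by rw [hal, hstage]; exact Nat.lt_succ_self 2)
        exact (h.hb_irrefl l (hb_trans h2
          (hb_trans (hb_of_po h3) (.single (.inr (.inl hrf)))))).elim
    -- a later store of `q` would have overwritten the value before it was loaded
    have hlast : IsLastWrite x i (V q) := by
      refine ⟨⟨_, hwlab ▸ h.label hw⟩, fun i' v' hi' => not_lt.1 fun hlt => ?_⟩
      obtain ⟨w', hw', hl'⟩ : ∃ w', InV At F q i' w' ∧ w'.lab = .W x v' := h.lay.ex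
        (by rw [List.getElem?_append_right (by omega), Nat.add_sub_cancel_left, hi'])
      have hmo : G.mo w w' := h.mo_of_hb hwE (h.lay.mem hw') hww
        (by simp [Label.IsWrite, hl', Label.valW]) (by simp [Event.loc, hl', hwlab, Label.loc])
        (hb_of_po (h.po_of_lt hw hw' hlt))
      exact h.not_hb_of_rf_of_mo hrf hmo
        (hb_trans (h1 i' w' hw' (by rw [hl']; exact le_rfl)) hrl')
    obtain ⟨c, hc⟩ := h.exists_lastStage (s := 2) (accessed_nonempty_of_mem_writesOf hxq)
    obtain ⟨n, hn, hns, -⟩ := id hc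
    refine .inr ⟨q, hne, hxq, ?_, ⟨c, s, hc, hs,
      hb_of_hb_of_eq_or_po (h1 n c hn (by omega)) hrs⟩, ?_⟩
    · rw [← (h.block q).mem]
      exact memAfter_of_isLastWrite hlast (hwlab ▸ h.label hw) _
    · intro q' hq' hxq' hlt
      refine key q' hq' hxq' ?_
      rintro i' w' hw' ⟨v', hl'⟩
      obtain ⟨n', a, ha, hal⟩ := h.exists_promotion hxq'
      refine h.mo_of_hb hwE (h.lay.mem hw') hww (by simp [Label.IsWrite, hl', Label.valW])
        (by simp [Event.loc, hl', hwlab, Label.loc]) ?_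
      exact hb_trans (h.hb_promotion_of_commitLT hxq hxq' hlt hw (by omega) ha hal)
        (hb_of_po (h.po_of_stage_lt ha hw' (by rw [hal, hl']; exact Nat.lt_succ_self 2)))

/-- The attempts of an RA-consistent graph, ordered by `CommitLT`, are the transactions of an
SI-consistent graph. -/
theorem exists_siConsistent {ts : Tid → List (List (Label Loc Val))}
    (h : Attempts G At F V (blockOf ts) m) {tag : Tid × ℕ → ℕ} (ht : Function.Injective tag)
    (h0 : ∀ p, tag p ≠ 0)
    (hT : ∀ p, ∀ l ∈ blockOf ts p, ∃ x v, l = .R x v ∨ l = .W x v) :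
    ∃ H : ExecGraph Tid Loc Val, H.WF ∧ H.SIConsistent ∧ H.HasThreads (taggedTraces tag ts) := by
  set T := blockOf ts with hTdef
  have hsrc : ∀ p x, ∃ o : Option (Tid × ℕ),
      (∀ q, o = some q → q ≠ p ∧ x ∈ writesOf (T q) ∧ CommitSnap G At F q p) ∧
      (x ∈ readsFirst (T p) → m p x = (match o with
        | none => 0
        | some q => memAfter (fun _ => 0) (T q) x) ∧
        ∀ q, q ≠ p → x ∈ writesOf (T q) → (∀ q', o = some q' → CommitLT G At F q' q) →
          SnapCommit G At F p q) := by
    intro p x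
    by_cases hx : x ∈ readsFirst (T p)
    · rcases h.exists_source hx with ⟨h1, h2⟩ | ⟨q, hq, hxq, hm, hcs, h2⟩
      · exact ⟨none, by simp, fun _ => ⟨h1, fun q hq hxq _ => h2 q hq hxq⟩⟩
      · refine ⟨some q, ?_, fun _ => ⟨hm.symm, fun q' hq' hxq' hlt => h2 q' hq' hxq' (hlt q rfl)⟩⟩
        rintro q' ⟨⟩
        exact ⟨hq, hxq, hcs⟩
    · exact ⟨none, by simp, fun hx' => (hx hx').elim⟩
  choose src hsrc hread using hsrc
  have hB : Buildable tag T (CommitLT G At F) src := by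
    refine ⟨.inr ⟨h0, ht, hT⟩, ?_, fun _ p _ => h.commitLT_irrefl p,
      fun _ p q r _ _ _ => h.commitLT_trans, fun x p q hx hx' => h.commitLT_total hx hx',
      fun p x q hq => (hsrc p x q hq).2.1, fun p => ?_⟩
    · intro p x a b hm
      obtain ⟨y, v, hl | hl⟩ := hT p _ hm <;> cases hl
    · exact (h.block p).legal.congr fun x hx => (hread p x hx).1
  set H := build tag T (CommitLT G At F) src fun _ _ => False with hH
  have hacc : ∀ {p j} {e : Event Tid Loc Val}, Placed tag T p j e → (accessed (T p)).Nonempty := by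
    intro p j e he
    have hm := List.mem_of_getElem? he.2
    obtain ⟨x, v, hl | hl⟩ := hT p _ hm
    · exact ⟨x, readsOf_subset ⟨v, hl ▸ hm⟩⟩
    · exact ⟨x, .inr ⟨v, hl ▸ hm⟩⟩
  have hlift : ∀ {r : Event Tid Loc Val → Event Tid Loc Val → Prop} {a b}, H.lift r a b →
      ∃ p q c d i j i' j', Placed tag T p i a ∧ Placed tag T q j b ∧ Placed tag T p i' c ∧
        Placed tag T q j' d ∧ p ≠ q ∧ r c d := by
    rintro r a b ⟨c, d, hac, ⟨hr, hcd⟩, hdb⟩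
    obtain ⟨p, i, i', ha, hc⟩ := (build_st ht h0).1 hac
    obtain ⟨q, j', j, hd, hb⟩ := (build_st ht h0).1 hdb
    refine ⟨p, q, c, d, i, j, i', j', ha, hb, hc, hd, ?_, hr⟩
    rintro rfl
    exact hcd ((build_st ht h0).2 ⟨p, _, _, hc, hd⟩)
  -- writes of different blocks are ordered in the same way as the blocks
  have hmo : ∀ {p q i j} {c d : Event Tid Loc Val}, Placed tag T p i c → Placed tag T q j d →
      H.mo c d → ∃ x, x ∈ writesOf (T p) ∧ x ∈ writesOf (T q) ∧ (∃ v, c.lab = .W x v) ∧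
        (∃ v, d.lab = .W x v) ∧ (CommitLT G At F p q ∨ p = q ∧ i < j) := by
    rintro p q i j c d hc hd
      (⟨x, v, q', j', rfl, -⟩ | ⟨p', i', q', j', x, v, w, h₁, h₂, hl, hl', hlt⟩)
    · exact (hc.ne_init).elim
    · obtain ⟨rfl, rfl⟩ := hc.inj h₁
      obtain ⟨rfl, rfl⟩ := hd.inj h₂
      exact ⟨x, hc.mem_writesOf hl, hd.mem_writesOf hl', ⟨v, hl⟩, ⟨w, hl'⟩, hlt⟩
  -- dependencies lead from commits to snapshots
  have hdep : ∀ {a b}, H.dep a b → ∃ p q i j, Placed tag T p i a ∧ Placed tag T q j b ∧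
      CommitSnap G At F p q := by
    rintro a b (hab | hab | hab) <;>
      obtain ⟨p, q, c, d, i, j, i', j', ha, hb, hc, hd, hpq, hr⟩ := hlift hab <;>
      refine ⟨p, q, i, j, ha, hb, ?_⟩
    · obtain ⟨h₁, h₂⟩ := (build_layout.po hc hd).1 hr
      have h₃ : p.2 < q.2 := h₂.resolve_right fun h₂ => hpq (Prod.ext h₁ h₂.1)
      obtain ⟨e, he⟩ := h.exists_lastStage (s := 2) (hacc ha)
      obtain ⟨s, hs⟩ := h.exists_lastStage (s := 0) (hacc hb)
      obtain ⟨k, hk, -⟩ := id he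
      obtain ⟨k', hk', -⟩ := id hs
      exact ⟨e, s, he, hs, hb_of_po ((h.lay.po hk hk').2 ⟨h₁, .inl h₃⟩)⟩
    · obtain ⟨q', j'', x, v, hd', hl, ⟨n, hn, -⟩ | ⟨-, ⟨-, rfl⟩ | ⟨q'', n, hs, hn, -⟩⟩⟩ := hr
      · exact (hpq ((hc.inj hn).1.trans (hd'.inj hd).1)).elim
      · exact (hc.ne_init).elim
      · obtain ⟨rfl, rfl⟩ := hd.inj hd'
        obtain ⟨rfl, rfl⟩ := hc.inj hn
        exact (hsrc _ _ _ hs).2.2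
    · obtain ⟨x, hx, hx', -, -, hlt | ⟨rfl, -⟩⟩ := hmo hc hd hr
      · exact h.commitSnap_of_commitLT hx hx' hlt
      · exact (hpq rfl).elim
  -- reads-before leads from snapshots to commits
  have hrb : ∀ {a b}, H.lift H.rb a b → ∃ p q i j, Placed tag T p i a ∧ Placed tag T q j b ∧
      SnapCommit G At F p q := by
    intro a b hab
    obtain ⟨p, q, c, d, i, j, i', j', ha, hb, hc, hd, hpq, -, w,
      ⟨p', i'', x, v, hc', hl, hs⟩, hwd⟩ := hlift hab
    obtain ⟨rfl, rfl⟩ := hc.inj hc'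
    refine ⟨p, q, i, j, ha, hb, ?_⟩
    have hwx : w.lab = .W x v := hs.value hB (hl ▸ hc.2)
    rcases hs with ⟨n, hn, -⟩ | ⟨hx, hs⟩
    · obtain ⟨y, -, -, -, -, hlt | ⟨rfl, -⟩⟩ := hmo hn hd hwd
      · exact h.snapCommit_of_commitLT (hacc ha) hlt
      · exact (hpq rfl).elim
    · have hxr : x ∈ readsFirst (T p) := mem_readsFirst_of_getElem? (hl ▸ hc.2) hx
      rcases hs with ⟨hs, rfl⟩ | ⟨q', n, hs, hn, hlast⟩
      · refine (hread p x hxr).2 q hpq.symm ?_ (by simp [hs])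
        rcases hwd with ⟨y, v', _, _, hy, hd', hl'⟩ | ⟨_, _, _, _, _, _, _, hn, -⟩
        · obtain ⟨rfl, rfl⟩ := hd.inj hd'
          cases hy
          exact hd.mem_writesOf hl'
        · exact (hn.ne_init).elim
      · obtain ⟨y, -, hyq, ⟨v₁, hy⟩, ⟨v', hl'⟩, hlt⟩ := hmo hn hd hwd
        obtain ⟨rfl, rfl⟩ : x = y ∧ v = v₁ := by simpa [hwx] using hy
        refine (hread p x hxr).2 q hpq.symm hyq ?_
        rw [hs]
        rintro _ ⟨⟩
        rcases hlt with hlt | ⟨rfl, hlt⟩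
        · exact hlt
        · have := hlast.2 _ _ (hl' ▸ hd.2)
          omega
  refine ⟨H, build_wf hB (fun _ _ h => h.elim) (fun _ _ h => h.elim) (fun _ h => h)
    fun _ _ _ h _ => h, ⟨?_, ?_⟩, build_hasThreads⟩
  · exact build_int hB ht h0 fun p x hs => (hsrc p x p hs).1 rfl
  · intro a hcyc
    suffices key : ∀ b, Relation.TransGen
        (fun a b => ∃ c, H.dep a c ∧ (c = b ∨ H.lift H.rb c b)) a b →
        ∃ p q i j, Placed tag T p i a ∧ Placed tag T q j b ∧ CommitLT G At F p q by
      obtain ⟨p, q, i, j, ha, hb, hlt⟩ := key a hcyc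
      obtain ⟨rfl, -⟩ := ha.inj hb
      exact h.commitLT_irrefl _ hlt
    have step : ∀ {a b}, (∃ c, H.dep a c ∧ (c = b ∨ H.lift H.rb c b)) →
        ∃ p q i j, Placed tag T p i a ∧ Placed tag T q j b ∧ CommitLT G At F p q := by
      rintro a b ⟨c, hac, hcb⟩
      obtain ⟨p, q, i, j, ha, hc, hcs⟩ := hdep hac
      rcases hcb with rfl | hcb
      · exact ⟨p, q, i, j, ha, hc, h.commitLT_of_commitSnap (hacc hc) hcs⟩
      · obtain ⟨q', r, i', j', hc', hb, hsc⟩ := hrb hcb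
        obtain ⟨rfl, rfl⟩ := hc.inj hc'
        exact ⟨p, r, i, j', ha, hb, h.commitLT_of_commitSnap_of_snapCommit hcs hsc⟩
    intro b hab
    induction hab with
    | single hab => exact step hab
    | tail _ hbc ih =>
      obtain ⟨p, q, i, j, ha, hb, hlt⟩ := ih
      obtain ⟨q', r, i', j', hb', hc, hlt'⟩ := step hbc
      obtain ⟨rfl, rfl⟩ := hb.inj hb'
      exact ⟨p, r, i, j', ha, hc, h.commitLT_trans hlt hlt'⟩

end Attempts

end Sound

/-! ### Soundness -/

section Soundness

variable {Tid Reg Loc Val : Type*} [LinearOrder Loc] [DecidableEq Reg] [Zero Val]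

theorem List.Forall₂.getD {α β : Type*} {r : α → β → Prop} {a : α} {b : β} (hab : r a b)
    {l : List α} {l' : List β} (h : List.Forall₂ r l l') (k : ℕ) :
    r (l.getD k a) (l'.getD k b) := by
  induction h generalizing k with
  | nil => simpa using hab
  | cons h _ ih =>
    cases k with
    | zero => simpa using h
    | succ k => simpa using ih k

/-- Transaction identifiers for the blocks of finitely many threads. -/
theorem exists_tag (Tid : Type*) [Finite Tid] :
    ∃ tag : Tid × ℕ → ℕ, Function.Injective tag ∧ ∀ p, tag p ≠ 0 := by
  obtain ⟨n, ⟨e⟩⟩ := Finite.exists_equiv_fin Tid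
  refine ⟨fun p => Nat.pair (e p.1) p.2 + 1, fun p q h => ?_, fun p => Nat.succ_ne_zero _⟩
  have h := Nat.pair_eq_pair.1 (Nat.succ_injective h)
  exact Prod.ext (e.injective (Fin.ext h.1)) h.2

/-- Soundness of every implementation whose transactions consist of failed attempts and a block. -/
theorem soundness [Finite Tid]
    {f : Body Reg Loc Val → Finset Loc → Finset Loc → Com (LState Reg Loc Val) Loc Val}
    {P : Tid → Prog Reg Loc Val}
    (hc : ∀ τ, (P τ).AllTx fun T rs ws => ∀ s u s', Run (f T rs ws) s u s' →
      ∃ t, BRun T s.regs t s'.regs ∧ Committed t u)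
    {G : ExecGraph Tid Loc Val} {out : Tid → Reg → Val}
    (h : ImplExec (fun τ => implement f (P τ)) G out) (hra : G.RAConsistent) :
    ∃ H, SIExec P H out ∧ H.SIConsistent := by
  obtain ⟨wf, tr, fin, hrun, hout, hth⟩ := h
  have hex := fun τ => implement_sound (hc τ) (hrun τ)
  choose ts us hP htr hcom using hex
  obtain rfl : tr = fun τ => (us τ).flatten := funext htr
  simp only [← taggedTraces_zero] at hth
  -- all events of the implementation are outside of transactions
  obtain ⟨At, lay⟩ := exists_layout (tag := fun _ => 0) wf hth
  have hblk : ∀ p, Committed (blockOf ts p) (blockOf us p) := fun p =>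
    List.Forall₂.getD ⟨fun _ => 0, [], [], rfl, by simp, block_nil _⟩ (hcom p.1) p.2
  choose m F V hV hF hblk using hblk
  have hat : Attempts G At F V (blockOf ts) m := by
    refine ⟨wf, hra, ?_, hF, hblk⟩
    rwa [show (fun p => F p ++ V p) = blockOf us from (funext hV).symm]
  obtain ⟨tag, ht, h0⟩ := exists_tag Tid
  obtain ⟨H, hwf, hcons, hH⟩ := hat.exists_siConsistent ht h0 fun p l hl => by
    obtain ⟨i, hi⟩ := List.mem_iff_getElem?.1 hl
    obtain ⟨b, hb, hbl⟩ := getElem?_blockOf.1 hi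
    exact (hP p.1).labels b (List.mem_of_getElem? hb) l (List.mem_of_getElem? hbl)
  refine ⟨H, ⟨hwf, ts, fun τ k => tag (τ, k), fun τ k => h0 _, fun τ k τ' k' e => ?_,
    fun τ => ?_, hH⟩, hcons⟩
  · exact Prod.mk.inj (ht e)
  · have := hP τ
    rwa [hout] at this

end Soundness

/-! ### The transaction dependency order -/

section TransactionRelations

variable {Tid Loc Val : Type*}

namespace ExecGraph

variable {G : ExecGraph Tid Loc Val}

/-- The relation between the identifiers of different transactions that is induced by a relation
between events. -/
def TxRel (G : ExecGraph Tid Loc Val) (r : Event Tid Loc Val → Event Tid Loc Val → Prop)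
    (ξ ζ : ℕ) : Prop :=
  ξ ≠ 0 ∧ ζ ≠ 0 ∧ ξ ≠ ζ ∧ ∃ c ∈ G.E, ∃ d ∈ G.E, c.tx = ξ ∧ d.tx = ζ ∧ r c d

/-- Dependencies between transactions, as a relation between identifiers. -/
def TxDep (G : ExecGraph Tid Loc Val) (ξ ζ : ℕ) : Prop :=
  G.TxRel G.po ξ ζ ∨ G.TxRel G.rf ξ ζ ∨ G.TxRel G.mo ξ ζ

theorem lift_iff {r : Event Tid Loc Val → Event Tid Loc Val → Prop} {a b : Event Tid Loc Val} :
    G.lift r a b ↔ a ∈ G.E ∧ b ∈ G.E ∧ G.TxRel r a.tx b.tx := by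
  constructor
  · rintro ⟨c, d, ⟨ha, hc, h0, hac⟩, ⟨hr, hn⟩, ⟨hd, hb, h0', hdb⟩⟩
    exact ⟨ha, hb, h0, hdb ▸ h0', fun e => hn ⟨hc, hd, hac ▸ h0, by rw [← hac, e, hdb]⟩,
      c, hc, d, hd, hac.symm, hdb, hr⟩
  · rintro ⟨ha, hb, h0, h0', hne, c, hc, d, hd, hca, hdb, hr⟩
    exact ⟨c, d, ⟨ha, hc, h0, hca.symm⟩, ⟨hr, fun h => hne (by rw [← hca, ← hdb, h.2.2.2])⟩,
      ⟨hd, hb, hdb ▸ h0', hdb⟩⟩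

theorem dep_iff {a b : Event Tid Loc Val} :
    G.dep a b ↔ a ∈ G.E ∧ b ∈ G.E ∧ G.TxDep a.tx b.tx := by
  simp only [dep, lift_iff, TxDep]
  tauto

theorem TxRel.mem {r : Event Tid Loc Val → Event Tid Loc Val → Prop} {ξ ζ : ℕ}
    (h : G.TxRel r ξ ζ) : ξ ∈ G.txs ∧ ζ ∈ G.txs := by
  obtain ⟨h0, h0', -, c, hc, d, hd, h₁, h₂, -⟩ := h
  exact ⟨⟨h0, c, hc, h₁⟩, ⟨h0', d, hd, h₂⟩⟩

theorem TxDep.mem {ξ ζ : ℕ} (h : G.TxDep ξ ζ) : ξ ∈ G.txs ∧ ζ ∈ G.txs := by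
  rcases h with h | h | h <;> exact h.mem

/-- The generating edges of the transaction dependency order. -/
def TxEdge (G : ExecGraph Tid Loc Val) (ξ ζ : ℕ) : Prop :=
  ∃ η, (ξ = η ∨ G.TxRel G.rb ξ η) ∧ G.TxDep η ζ

/-- A cycle of edges `rb? ; dep` can be rotated to a cycle of edges `dep ; rb?`. -/
theorem SIConsistent.txEdge_acyclic (h : G.SIConsistent) (ξ : ℕ) :
    ¬ Relation.TransGen G.TxEdge ξ ξ := by
  -- `S` is the relation `dep ; rb?` between identifiers
  let S : ℕ → ℕ → Prop := fun ξ ζ => ∃ η, G.TxDep ξ η ∧ (η = ζ ∨ G.TxRel G.rb η ζ)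
  have rot : ∀ {ζ}, Relation.TransGen G.TxEdge ξ ζ →
      ∃ η θ, (ξ = η ∨ G.TxRel G.rb ξ η) ∧ Relation.ReflTransGen S η θ ∧ G.TxDep θ ζ := by
    intro ζ hζ
    induction hζ with
    | single h =>
      obtain ⟨η, h₁, h₂⟩ := h
      exact ⟨η, η, h₁, .refl, h₂⟩
    | tail _ h ih =>
      obtain ⟨η, θ, h₁, h₂, h₃⟩ := ih
      obtain ⟨η', h₄, h₅⟩ := h
      exact ⟨η, η', h₁, h₂.tail ⟨_, h₃, h₄⟩, h₅⟩
  have events : ∀ {ξ ζ}, Relation.TransGen S ξ ζ → ∀ a ∈ G.E, a.tx = ξ → ∀ b ∈ G.E, b.tx = ζ →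
      Relation.TransGen (fun a b => ∃ c, G.dep a c ∧ (c = b ∨ G.lift G.rb c b)) a b := by
    have step : ∀ {ξ ζ}, S ξ ζ → ∀ a ∈ G.E, a.tx = ξ → ∀ b ∈ G.E, b.tx = ζ →
        ∃ c, G.dep a c ∧ (c = b ∨ G.lift G.rb c b) := by
      rintro ξ ζ ⟨η, h₁, rfl | h₂⟩ a ha rfl b hb hbt
      · exact ⟨b, dep_iff.2 ⟨ha, hb, hbt ▸ h₁⟩, .inl rfl⟩
      · obtain ⟨-, c, hc, rfl⟩ := h₁.mem.2
        exact ⟨c, dep_iff.2 ⟨ha, hc, h₁⟩, .inr (lift_iff.2 ⟨hc, hb, hbt ▸ h₂⟩)⟩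
    intro ξ ζ h
    induction h with
    | single h => exact fun a ha hat b hb hbt => .single (step h a ha hat b hb hbt)
    | tail h₁ h₂ ih =>
      intro a ha hat b hb hbt
      obtain ⟨η, h₃, -⟩ := id h₂
      obtain ⟨-, c, hc, hct⟩ := h₃.mem.1
      exact (ih a ha hat c hc hct).tail (step h₂ c hc hct b hb hbt)
  intro hcyc
  obtain ⟨η, θ, h₁, h₂, h₃⟩ := rot hcyc
  have hθ : Relation.TransGen S θ θ := Relation.TransGen.head' ⟨_, h₃, h₁⟩ h₂
  obtain ⟨-, a, ha, rfl⟩ := h₃.mem.1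
  exact h.ext a (events hθ a ha rfl a ha rfl)

/-- The transaction dependency order of an SI-consistent graph has a linear extension. -/
theorem exists_isTCO (h : G.SIConsistent) : ∃ tco, G.IsTCO tco := by
  let r : ℕ → ℕ → Prop := Relation.ReflTransGen G.TxEdge
  have : IsPartialOrder ℕ r :=
    { refl := fun _ => .refl
      trans := fun _ _ _ => .trans
      antisymm := fun a b hab hba => by
        rcases Relation.reflTransGen_iff_eq_or_transGen.1 hab with e | hab'
        · exact e.symm
        · exact (h.txEdge_acyclic a (hab'.trans_left hba)).elim }
  obtain ⟨s, hs, hrs⟩ := extend_partialOrder r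
  refine ⟨fun ξ ζ => s ξ ζ ∧ ξ ≠ ζ, ⟨fun _ _ h => h.2 rfl, ?_, ?_, ?_⟩⟩
  · rintro ξ - ζ - η - ⟨h₁, hne⟩ ⟨h₂, hne'⟩
    refine ⟨_root_.trans h₁ h₂, ?_⟩
    rintro rfl
    exact hne (antisymm h₁ h₂)
  · intro ξ _ ζ _ hne
    exact (total_of s ξ ζ).imp (fun h => ⟨h, hne⟩) fun h => ⟨h, hne.symm⟩
  · intro a b hab
    have hab' : Relation.TransGen G.TxEdge a.tx b.tx := by
      refine hab.lift Event.tx ?_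
      rintro a b ⟨c, h₁, h₂⟩
      exact ⟨c.tx, h₁.imp (congrArg _) fun h => (lift_iff.1 h).2.2, (dep_iff.1 h₂).2.2⟩
    refine ⟨hrs _ _ hab'.to_reflTransGen, fun e => ?_⟩
    rw [e] at hab'
    exact h.txEdge_acyclic _ hab'

end ExecGraph

end TransactionRelations

/-! ### Phases -/

section Phases

variable {Tid Loc Val : Type*}

theorem exists_writerAt {H : ExecGraph Tid Loc Val} {tco : ℕ → ℕ → Prop} {ξ : ℕ}
    {x : Loc} (hξ : ξ ∈ H.txs) (hx : H.TxWrites ξ x) :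
    ∃ i, H.WriterAt tco x i ξ := ⟨_, hξ, hx, rfl⟩

/-- Transaction `ξ` reads `x` from another transaction, the writer that precedes phase `i`. -/
def ReaderAt (H : ExecGraph Tid Loc Val) (tco : ℕ → ℕ → Prop) (x : Loc)
    (i ξ : ℕ) : Prop :=
  ∃ w r, H.rf w r ∧ w.loc = x ∧ r.tx = ξ ∧
    ((i = 0 ∧ w.tid = none) ∨ ∃ k, i = k + 1 ∧ H.WriterAt tco x k w.tx ∧ w.tx ≠ ξ)

variable [Zero Val]

/-- `H` is an SI-consistent graph with finitely many transactions, which contain all events other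
than initialisation events, and `tco` is a total order that extends the transaction
dependency order. -/
structure TxOrdered (H : ExecGraph Tid Loc Val) (tco : ℕ → ℕ → Prop) : Prop where
  wf : H.WF
  si : H.SIConsistent
  ord : H.IsTCO tco
  fin : H.txs.Finite
  tx_ne : ∀ e ∈ H.E, e.tid ≠ none → e.tx ≠ 0

namespace TxOrdered

variable {H : ExecGraph Tid Loc Val} {tco : ℕ → ℕ → Prop}

theorem tid_ne (h : TxOrdered H tco) {e : Event Tid Loc Val} (he : e ∈ H.E) (h0 : e.tx ≠ 0) :
    e.tid ≠ none := fun ht => h0 (h.wf.init_lab e he ht).1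

theorem asymm (h : TxOrdered H tco) {ξ ζ : ℕ} (hξ : ξ ∈ H.txs) (hζ : ζ ∈ H.txs) (h₁ : tco ξ ζ) :
    ¬ tco ζ ξ := fun h₂ => h.ord.irrefl ξ hξ (h.ord.trans ξ hξ ζ hζ ξ hξ h₁ h₂)

theorem tco_of_edge (h : TxOrdered H tco) {ξ η ζ : ℕ} (h₁ : ξ = η ∨ H.TxRel H.rb ξ η)
    (h₂ : H.TxDep η ζ) : tco ξ ζ := by
  have hξ : ξ ∈ H.txs := by
    rcases h₁ with rfl | h₁
    · exact h₂.mem.1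
    · exact h₁.mem.1
  obtain ⟨-, a, ha, rfl⟩ := hξ
  obtain ⟨-, c, hc, hcη⟩ := h₂.mem.1
  obtain ⟨-, b, hb, rfl⟩ := h₂.mem.2
  subst hcη
  refine h.ord.extend a b (.single ?_)
  rcases h₁ with e | h₁
  · exact ⟨a, .inl rfl, ExecGraph.dep_iff.2 ⟨ha, hb, e ▸ h₂⟩⟩
  · exact ⟨c, .inr (ExecGraph.lift_iff.2 ⟨ha, hc, h₁⟩), ExecGraph.dep_iff.2 ⟨hc, hb, h₂⟩⟩

theorem tco_of_dep (h : TxOrdered H tco) {ξ ζ : ℕ} (h₁ : H.TxDep ξ ζ) : tco ξ ζ :=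
  h.tco_of_edge (.inl rfl) h₁

theorem eq_or_tco_of_mo (h : TxOrdered H tco) {a b : Event Tid Loc Val} (hab : H.mo a b)
    (ha : a.tx ≠ 0) (hb : b.tx ≠ 0) : a.tx = b.tx ∨ tco a.tx b.tx := by
  refine or_iff_not_imp_left.2 fun hne => h.tco_of_dep (.inr (.inr ?_))
  exact ⟨ha, hb, hne, a, (h.wf.mo_mem _ _ hab).1, b, (h.wf.mo_mem _ _ hab).2, rfl, rfl, hab⟩

theorem mo_of_tco (h : TxOrdered H tco) {a b : Event Tid Loc Val} (ha : a ∈ H.E) (hb : b ∈ H.E)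
    (ha0 : a.tx ≠ 0) (hb0 : b.tx ≠ 0) (hwa : a.lab.IsWrite) (hwb : b.lab.IsWrite)
    (hloc : a.loc = b.loc) (hab : tco a.tx b.tx) : H.mo a b := by
  have hta : a.tx ∈ H.txs := ⟨ha0, a, ha, rfl⟩
  have htb : b.tx ∈ H.txs := ⟨hb0, b, hb, rfl⟩
  refine (h.wf.mo_total a ha b hb hwa hwb hloc ?_).resolve_right fun hba => ?_
  · rintro rfl
    exact h.ord.irrefl _ hta hab
  · rcases h.eq_or_tco_of_mo hba hb0 ha0 with e | hba
    · rw [e] at hab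
      exact h.ord.irrefl _ hta hab
    · exact h.asymm hta htb hab hba

theorem dep_of_writes (h : TxOrdered H tco) {ξ ζ : ℕ} {x : Loc} (hξ : ξ ∈ H.txs)
    (hζ : ζ ∈ H.txs) (hξx : H.TxWrites ξ x) (hζx : H.TxWrites ζ x) (hlt : tco ξ ζ) :
    H.TxDep ξ ζ := by
  obtain ⟨a, ha, rfl, hax, hwa⟩ := hξx
  obtain ⟨b, hb, rfl, hbx, hwb⟩ := hζx
  refine .inr (.inr ⟨hξ.1, hζ.1, ?_, a, ha, b, hb, rfl, rfl,
    h.mo_of_tco ha hb hξ.1 hζ.1 hwa hwb (hax.trans hbx.symm) hlt⟩)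
  intro e
  rw [e] at hlt
  exact h.ord.irrefl _ hζ hlt

theorem lt_of_tco (h : TxOrdered H tco) {ξ ζ i k : ℕ} {x : Loc} (hξ : H.WriterAt tco x i ξ)
    (hζ : H.WriterAt tco x k ζ) (hlt : tco ξ ζ) : i < k := by
  obtain ⟨h₁, h₂, rfl⟩ := hξ
  obtain ⟨h₃, h₄, rfl⟩ := hζ
  refine Set.ncard_lt_ncard ⟨?_, fun hsub => ?_⟩ (h.fin.subset fun η hη => hη.1)
  · rintro η ⟨hη, hηx, hlt'⟩
    exact ⟨hη, hηx, h.ord.trans η hη ξ h₁ ζ h₃ hlt' hlt⟩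
  · exact h.ord.irrefl ξ h₁ (hsub ⟨h₁, h₂, hlt⟩).2.2

theorem writer_eq (h : TxOrdered H tco) {ξ ζ i : ℕ} {x : Loc} (hξ : H.WriterAt tco x i ξ)
    (hζ : H.WriterAt tco x i ζ) : ξ = ζ := by
  by_contra hne
  rcases h.ord.total ξ hξ.1 ζ hζ.1 hne with hlt | hlt
  · exact lt_irrefl _ (h.lt_of_tco hξ hζ hlt)
  · exact lt_irrefl _ (h.lt_of_tco hζ hξ hlt)

theorem tco_of_lt (h : TxOrdered H tco) {ξ ζ i k : ℕ} {x : Loc} (hξ : H.WriterAt tco x i ξ)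
    (hζ : H.WriterAt tco x k ζ) (hlt : i < k) : tco ξ ζ := by
  have hne : ξ ≠ ζ := by
    rintro rfl
    exact hlt.ne (hξ.2.2.symm.trans hζ.2.2)
  refine (h.ord.total ξ hξ.1 ζ hζ.1 hne).resolve_right fun hlt' => ?_
  exact lt_asymm hlt (h.lt_of_tco hζ hξ hlt')

theorem dep_of_lt (h : TxOrdered H tco) {ξ ζ i k : ℕ} {x : Loc} (hξ : H.WriterAt tco x i ξ)
    (hζ : H.WriterAt tco x k ζ) (hlt : i < k) : H.TxDep ξ ζ :=
  h.dep_of_writes hξ.1 hζ.1 hξ.2.1 hζ.2.1 (h.tco_of_lt hξ hζ hlt)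

theorem exists_max (h : TxOrdered H tco) {A : Set ℕ} (hA : A ⊆ H.txs) (hne : A.Nonempty) :
    ∃ η ∈ A, ∀ ζ ∈ A, ζ ≠ η → tco ζ η := by
  have hfin : A.Finite := h.fin.subset hA
  induction A, hfin using Set.Finite.induction_on with
  | empty => exact (Set.not_nonempty_empty hne).elim
  | @insert a s _ _ ih =>
    have ha : a ∈ H.txs := hA (Set.mem_insert _ _)
    rcases s.eq_empty_or_nonempty with rfl | hs
    · refine ⟨a, by simp, fun ζ hζ hne => ?_⟩
      exact (hne (by simpa using hζ)).elim
    · obtain ⟨η, hη, hmax⟩ := ih (fun _ h => hA (Set.mem_insert_of_mem _ h)) hs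
      have hη' : η ∈ H.txs := hA (Set.mem_insert_of_mem _ hη)
      by_cases hlt : tco η a
      · refine ⟨a, Set.mem_insert _ _, ?_⟩
        rintro ζ (rfl | hζ) hne
        · exact (hne rfl).elim
        · by_cases e : ζ = η
          · exact e ▸ hlt
          · exact h.ord.trans ζ (hA (Set.mem_insert_of_mem _ hζ)) η hη' a ha (hmax ζ hζ e) hlt
      · refine ⟨η, Set.mem_insert_of_mem _ hη, ?_⟩
        rintro ζ (rfl | hζ) hne
        · exact (h.ord.total _ ha _ hη' hne).resolve_right hlt
        · exact hmax ζ hζ hne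

theorem exists_preceding_writer (h : TxOrdered H tco) {ζ i : ℕ} {x : Loc}
    (hζ : H.WriterAt tco x (i + 1) ζ) : ∃ ξ, H.WriterAt tco x i ξ := by
  obtain ⟨hζt, hζx, hcard⟩ := hζ
  set A := {η | η ∈ H.txs ∧ H.TxWrites η x ∧ tco η ζ} with hA
  have hfin : A.Finite := h.fin.subset fun η hη => hη.1
  obtain ⟨η, hη, hmax⟩ := h.exists_max (A := A) (fun η hη => hη.1)
    (Set.nonempty_of_ncard_ne_zero (by omega))
  refine ⟨η, hη.1, hη.2.1, ?_⟩
  have : {θ | θ ∈ H.txs ∧ H.TxWrites θ x ∧ tco θ η} = A \ {η} := by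
    ext θ
    constructor
    · rintro ⟨h₁, h₂, h₃⟩
      refine ⟨⟨h₁, h₂, h.ord.trans θ h₁ η hη.1 ζ hζt h₃ hη.2.2⟩, ?_⟩
      rintro rfl
      exact h.ord.irrefl _ h₁ h₃
    · rintro ⟨h₁, h₂⟩
      exact ⟨h₁.1, h₁.2.1, hmax θ h₁ h₂⟩
  rw [this, Set.ncard_sdiff_singleton_of_mem hη, hcard]
  rfl

theorem inPhase_iff (h : TxOrdered H tco) {x : Loc} {i ξ : ℕ} :
    H.InPhase tco x i ξ ↔ H.WriterAt tco x i ξ ∨ ReaderAt H tco x i ξ := by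
  cases i with
  | zero =>
    refine or_congr_right ⟨?_, ?_⟩
    · rintro ⟨w, r, ht, hx, hr, hrf⟩
      exact ⟨w, r, hrf, hx, hr, .inl ⟨rfl, ht⟩⟩
    · rintro ⟨w, r, hrf, hx, hr, ⟨-, ht⟩ | ⟨k, hk, -⟩⟩
      · exact ⟨w, r, ht, hx, hr, hrf⟩
      · omega
  | succ i =>
    refine or_congr_right ⟨?_, ?_⟩
    · rintro ⟨w, r, hw, hx, hr, hrf, hst⟩
      refine ⟨w, r, hrf, hx, hr, .inr ⟨i, rfl, hw, fun e => hst ?_⟩⟩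
      exact ⟨(h.wf.rf_mem _ _ hrf).1, (h.wf.rf_mem _ _ hrf).2, hw.1.1, e.trans hr.symm⟩
    · rintro ⟨w, r, hrf, hx, hr, ⟨hi, -⟩ | ⟨k, hk, hw, hne⟩⟩
      · omega
      · obtain rfl : i = k := by omega
        exact ⟨w, r, hw, hx, hr, hrf, fun hst => hne (hst.2.2.2.trans hr)⟩

/-- A transaction that reads `x` precedes, in `rb`, all other writers of its phase and of later
phases. -/
theorem rb_of_reader (h : TxOrdered H tco) {x : Loc} {i k ξ ζ : ℕ} (hξ : ReaderAt H tco x i ξ)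
    (hξ0 : ξ ≠ 0) (hζ : H.WriterAt tco x k ζ) (hik : i ≤ k) (hne : ξ ≠ ζ) : H.TxRel H.rb ξ ζ := by
  obtain ⟨w, r, hrf, hwx, rfl, hcase⟩ := hξ
  obtain ⟨b, hb, hbt, hbx, hbw⟩ := hζ.2.1
  obtain ⟨hw, hr⟩ := h.wf.rf_mem _ _ hrf
  have hww : w.lab.IsWrite := by
    obtain ⟨-, v, hv, -⟩ := h.wf.rf_val _ _ hrf
    simp [Label.IsWrite, hv]
  have hb0 : b.tx ≠ 0 := hbt ▸ hζ.1.1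
  refine ⟨hξ0, hζ.1.1, hne, r, hr, b, hb, rfl, hbt, fun e => hne (by rw [e, hbt]), w, hrf, ?_⟩
  rcases hcase with ⟨-, ht⟩ | ⟨j, rfl, hwj, -⟩
  · exact h.wf.mo_init w hw b hb ht (h.tid_ne hb hb0) hbw (hwx.trans hbx.symm)
  · exact h.mo_of_tco hw hb hwj.1.1 hb0 hww hbw (hwx.trans hbx.symm)
      (hbt ▸ h.tco_of_lt hwj hζ hik)

theorem readerAt_mem (h : TxOrdered H tco) {x : Loc} {i ξ : ℕ} (hξ : ReaderAt H tco x i ξ)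
    (hξ0 : ξ ≠ 0) : ξ ∈ H.txs := by
  obtain ⟨w, r, hrf, -, rfl, -⟩ := hξ
  exact ⟨hξ0, r, (h.wf.rf_mem _ _ hrf).2, rfl⟩

/-- Writers precede the transactions of later phases in the transaction dependency order. -/
theorem dep_of_writer (h : TxOrdered H tco) {x : Loc} {i k ξ ζ : ℕ} (hξ : H.WriterAt tco x i ξ)
    (hζ : H.InPhase tco x k ζ) (hζ0 : ζ ≠ 0) (hik : i < k) : Relation.TransGen H.TxDep ξ ζ := by
  rcases h.inPhase_iff.1 hζ with hζ | ⟨w, r, hrf, hwx, rfl, ⟨hk, -⟩ | ⟨j, rfl, hwj, hne⟩⟩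
  · exact .single (h.dep_of_lt hξ hζ hik)
  · omega
  · have hdep : H.TxDep w.tx r.tx := .inr (.inl ⟨hwj.1.1, hζ0, hne, w, (h.wf.rf_mem _ _ hrf).1, r,
      (h.wf.rf_mem _ _ hrf).2, rfl, rfl, hrf⟩)
    rcases (Nat.lt_succ_iff.1 hik).lt_or_eq with hij | rfl
    · exact .head (h.dep_of_lt hξ hwj hij) (.single hdep)
    · rw [h.writer_eq hξ hwj]
      exact .single hdep

theorem dep_or_rb_of_inPhase (h : TxOrdered H tco) {x : Loc} {i k ξ ζ : ℕ}
    (hξ : H.InPhase tco x i ξ) (hξ0 : ξ ≠ 0) (hζ : H.WriterAt tco x k ζ) (hik : i ≤ k)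
    (hne : ξ ≠ ζ) : H.TxDep ξ ζ ∨ H.TxRel H.rb ξ ζ := by
  rcases h.inPhase_iff.1 hξ with hξ | hξ
  · rcases hik.lt_or_eq with hik | rfl
    · exact .inl (h.dep_of_lt hξ hζ hik)
    · exact (hne (h.writer_eq hξ hζ)).elim
  · exact .inr (h.rb_of_reader hξ hξ0 hζ hik hne)

/-- The total order extends the order of the phases. -/
theorem tco_of_inPhase (h : TxOrdered H tco) {x : Loc} {i k ξ ζ : ℕ}
    (hξ : H.InPhase tco x i ξ) (hξ0 : ξ ≠ 0) (hζ : H.InPhase tco x k ζ) (hζ0 : ζ ≠ 0)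
    (hik : i < k) : tco ξ ζ := by
  -- the writer that precedes phase `k` is followed by `ζ` in the dependency order
  obtain ⟨j, η, rfl, hη, hdep⟩ : ∃ j η, k = j + 1 ∧ H.WriterAt tco x j η ∧ H.TxDep η ζ := by
    rcases h.inPhase_iff.1 hζ with hζ | ⟨w, r, hrf, hwx, rfl, ⟨hk, -⟩ | ⟨j, rfl, hwj, hne⟩⟩
    · obtain ⟨j, rfl⟩ : ∃ j, k = j + 1 := ⟨k - 1, by omega⟩
      obtain ⟨η, hη⟩ := h.exists_preceding_writer hζ
      exact ⟨j, η, rfl, hη, h.dep_of_lt hη hζ (Nat.lt_succ_self j)⟩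
    · omega
    · exact ⟨j, w.tx, rfl, hwj, .inr (.inl ⟨hwj.1.1, hζ0, hne, w, (h.wf.rf_mem _ _ hrf).1, r,
        (h.wf.rf_mem _ _ hrf).2, rfl, rfl, hrf⟩)⟩
  by_cases hne : ξ = η
  · exact h.tco_of_dep (hne ▸ hdep)
  rcases h.dep_or_rb_of_inPhase hξ hξ0 hη (Nat.lt_succ_iff.1 hik) hne with hd | hd
  · exact h.ord.trans ξ hd.mem.1 η hη.1 ζ hdep.mem.2 (h.tco_of_dep hd) (h.tco_of_dep hdep)
  · exact h.tco_of_edge (.inr hd) hdep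

theorem inPhase_unique (h : TxOrdered H tco) {x : Loc} {i k ξ : ℕ} (hξ : ξ ∈ H.txs)
    (hi : H.InPhase tco x i ξ) (hk : H.InPhase tco x k ξ) : i = k := by
  by_contra hne
  rcases lt_or_gt_of_ne hne with hlt | hlt
  · exact h.ord.irrefl ξ hξ (h.tco_of_inPhase hi hξ.1 hk hξ.1 hlt)
  · exact h.ord.irrefl ξ hξ (h.tco_of_inPhase hk hξ.1 hi hξ.1 hlt)

theorem writerAt_of_inPhase (h : TxOrdered H tco) {x : Loc} {i ξ : ℕ} (hξ : ξ ∈ H.txs)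
    (hx : H.TxWrites ξ x) (hi : H.InPhase tco x i ξ) : H.WriterAt tco x i ξ := by
  obtain ⟨k, hk⟩ := exists_writerAt (tco := tco) hξ hx
  rwa [h.inPhase_unique hξ hi (h.inPhase_iff.2 (.inl hk))]

theorem exists_inPhase (h : TxOrdered H tco) {x : Loc} {ξ : ℕ} (hξ : ξ ∈ H.txs)
    (hx : H.TxAccesses ξ x) : ∃ i, H.InPhase tco x i ξ := by
  by_cases hw : H.TxWrites ξ x
  · obtain ⟨i, hi⟩ := exists_writerAt (tco := tco) hξ hw
    exact ⟨i, h.inPhase_iff.2 (.inl hi)⟩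
  obtain ⟨r, hr, rfl, rfl⟩ := hx
  have hread : r.lab.IsRead := by
    obtain ⟨x, v, hl | hl⟩ := h.wf.tx_lab r hr hξ.1
    · simp [Label.IsRead, hl, Label.valR]
    · exact (hw ⟨r, hr, rfl, rfl, by simp [Label.IsWrite, hl, Label.valW]⟩).elim
  obtain ⟨w, hrf, -⟩ := h.wf.rf_unique r hr hread
  have hwE := (h.wf.rf_mem _ _ hrf).1
  obtain ⟨hloc, v, hv, -⟩ := h.wf.rf_val _ _ hrf
  have hww : w.lab.IsWrite := by simp [Label.IsWrite, hv]
  by_cases ht : w.tid = none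
  · exact ⟨0, h.inPhase_iff.2 (.inr ⟨w, r, hrf, hloc, rfl, .inl ⟨rfl, ht⟩⟩)⟩
  · have hw0 := h.tx_ne w hwE ht
    obtain ⟨i, hi⟩ := exists_writerAt (tco := tco) (x := r.loc) ⟨hw0, w, hwE, rfl⟩
      ⟨w, hwE, rfl, hloc, hww⟩
    refine ⟨i + 1, h.inPhase_iff.2 (.inr ⟨w, r, hrf, hloc, rfl, .inr ⟨i, rfl, hi, fun e => ?_⟩⟩)⟩
    exact hw ⟨w, hwE, e, hloc, hww⟩

end TxOrdered

end Phases

/-! ### Lock orders -/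

section LockOrders

theorem Label.IsRLock.not_isWLock {Loc Val : Type*} {l : Label Loc Val} (h : l.IsRLock) :
    ¬ l.IsWLock := by
  cases l <;> simp_all [Label.IsRLock, Label.IsWLock, Label.loc]

variable {Tid Loc Val : Type*}

/-- The order of the lock events within a phase. -/
def PhaseOrder (tco : ℕ → ℕ → Prop) (own : Event Tid Loc Val → ℕ)
    (a b : Event Tid Loc Val) : Prop :=
  (a.lab.IsRLock ∧ b.lab.IsWLock) ∨
  (a.lab = .PL a.loc ∧ b.lab = .WU a.loc ∧ own a = own b) ∨
  (a.lab.IsRLock ∧ b.lab.IsRLock ∧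
    (tco (own a) (own b) ∨ own a = own b ∧ a.lab = .RL a.loc ∧ b.lab = .RU a.loc))

variable {H G : ExecGraph Tid Loc Val} {tco : ℕ → ℕ → Prop} {own : Event Tid Loc Val → ℕ}

theorem lo_of_lt {a b : Event Tid Loc Val} {i k : ℕ} (ha : a ∈ G.E)
    (hb : b ∈ G.E) (hla : a.lab.IsLock) (hlb : b.lab.IsLock) (hloc : a.loc = b.loc)
    (hi : H.InPhase tco a.loc i (own a)) (hk : H.InPhase tco a.loc k (own b)) (hik : i < k)
    (hw : a.lab.IsWLock ∨ b.lab.IsWLock) : ExecGraph.LO H tco G own a b := by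
  refine ⟨ha, hb, hla, hlb, hloc, i, k, hi, hk, ?_⟩
  rcases hla with hla | hla
  · rcases hw with hw | hw
    · exact .inl ⟨hw, hik⟩
    · exact .inr (.inr ⟨hla, hw, hik.le⟩)
  · exact .inl ⟨hla, hik⟩

theorem mem_of_rlo {a b : Event Tid Loc Val}
    (hab : ExecGraph.RLO H tco G own a b) :
    a ∈ G.E ∧ b ∈ G.E ∧ a.lab.IsLock ∧ b.lab.IsLock ∧ a.loc = b.loc := by
  rcases hab with ⟨ha, hb, hla, hlb, hloc, -⟩ | ⟨ha, hb, hla, hlb, hloc, -⟩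
  · exact ⟨ha, hb, hla, hlb, hloc⟩
  · exact ⟨ha, hb, .inl hla, .inl hlb, hloc⟩

variable [Zero Val]

/-- The lock events of `G` are owned by the transactions of `H`, and are ordered by stages within
each transaction. -/
structure LocksOwned (H : ExecGraph Tid Loc Val) (tco : ℕ → ℕ → Prop) (G : ExecGraph Tid Loc Val)
    (own : Event Tid Loc Val → ℕ) : Prop extends TxOrdered H tco where
  owner : H.LockOwner G own
  po_stage : ∀ a ∈ G.E, ∀ b ∈ G.E, a.lab.IsLock → b.lab.IsLock → own a = own b →
    a.lab.stage < b.lab.stage → G.po a b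

namespace LocksOwned

theorem own_mem (h : LocksOwned H tco G own) {a : Event Tid Loc Val} (ha : a ∈ G.E)
    (hl : a.lab.IsLock) : own a ∈ H.txs := (h.owner.mem a ha hl).1

theorem wlock_cases (h : LocksOwned H tco G own) {a : Event Tid Loc Val} (ha : a ∈ G.E)
    (hl : a.lab.IsWLock) : a.lab = .PL a.loc ∨ a.lab = .WU a.loc := by
  rcases hl with hl | hl | hl
  · exact (h.owner.wl a ha _ hl).elim
  · exact .inr hl
  · exact .inl hl

theorem writes (h : LocksOwned H tco G own) {a : Event Tid Loc Val} (ha : a ∈ G.E)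
    (hl : a.lab.IsWLock) : H.TxWrites (own a) a.loc := by
  have hm := h.own_mem ha (.inr hl)
  rcases h.wlock_cases ha hl with hl | hl
  · exact (h.owner.pl _ hm _).1 ⟨a, ha, hl, rfl⟩
  · exact (h.owner.wu _ hm _).1 ⟨a, ha, hl, rfl⟩

theorem accesses (h : LocksOwned H tco G own) {a : Event Tid Loc Val} (ha : a ∈ G.E)
    (hl : a.lab.IsLock) : H.TxAccesses (own a) a.loc := by
  have hm := h.own_mem ha hl
  rcases hl with (hl | hl) | hl
  · exact (h.owner.rl _ hm _).1 ⟨a, ha, hl, rfl⟩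
  · exact ((h.owner.ru _ hm _).1 ⟨a, ha, hl, rfl⟩).1
  · obtain ⟨e, he, ht, hx, -⟩ := h.writes ha hl
    exact ⟨e, he, ht, hx⟩

theorem exists_phase (h : LocksOwned H tco G own) {a : Event Tid Loc Val} (ha : a ∈ G.E)
    (hl : a.lab.IsLock) : ∃ i, H.InPhase tco a.loc i (own a) :=
  h.exists_inPhase (h.own_mem ha hl) (h.accesses ha hl)

theorem writerAt (h : LocksOwned H tco G own) {a : Event Tid Loc Val} {i : ℕ} (ha : a ∈ G.E)
    (hl : a.lab.IsWLock) (hi : H.InPhase tco a.loc i (own a)) :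
    H.WriterAt tco a.loc i (own a) :=
  h.writerAt_of_inPhase (h.own_mem ha (.inr hl)) (h.writes ha hl) hi

/-- The lock order is the lexicographic order of the phases and the order within phases. -/
theorem rlo_iff (h : LocksOwned H tco G own) {a b : Event Tid Loc Val} {i k : ℕ} (ha : a ∈ G.E)
    (hb : b ∈ G.E) (hla : a.lab.IsLock) (hlb : b.lab.IsLock) (hloc : a.loc = b.loc)
    (hi : H.InPhase tco a.loc i (own a)) (hk : H.InPhase tco b.loc k (own b)) :
    ExecGraph.RLO H tco G own a b ↔ i < k ∨ i = k ∧ PhaseOrder tco own a b := by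
  rw [← hloc] at hk
  have ui := fun j hj => h.inPhase_unique (i := i) (k := j) (h.own_mem ha hla) hi hj
  have uk := fun j hj => h.inPhase_unique (i := k) (k := j) (h.own_mem hb hlb) hk hj
  have ue : own a = own b → i = k := fun e => ui k (e ▸ hk)
  constructor
  · rintro (⟨-, -, -, -, -, i', k', hi', hk', hc⟩ | ⟨-, -, hra, hrb, -, i', k', hi', hk', hc⟩) <;>
      obtain rfl := ui _ hi' <;> obtain rfl := uk _ hk'
    · rcases hc with ⟨-, hc⟩ | ⟨h₁, h₂, h₃⟩ | ⟨h₁, h₂, h₃⟩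
      · exact .inl hc
      · exact .inr ⟨ue h₃, .inr (.inl ⟨h₁, h₂, h₃⟩)⟩
      · exact h₃.lt_or_eq.imp id fun e => ⟨e, .inl ⟨h₁, h₂⟩⟩
    · rcases hc with hc | ⟨h₁, h₂⟩ | ⟨h₁, h₂⟩
      · exact .inl hc
      · exact .inr ⟨h₁, .inr (.inr ⟨hra, hrb, .inl h₂⟩)⟩
      · exact .inr ⟨ue h₁, .inr (.inr ⟨hra, hrb, .inr ⟨h₁, h₂⟩⟩)⟩
  · rintro (hik | ⟨rfl, hc | hc | ⟨h₁, h₂, hc⟩⟩)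
    · by_cases hw : a.lab.IsWLock ∨ b.lab.IsWLock
      · exact .inl (lo_of_lt ha hb hla hlb hloc hi hk hik hw)
      · push Not at hw
        exact .inr ⟨ha, hb, hla.resolve_right hw.1, hlb.resolve_right hw.2, hloc, i, k, hi, hk,
          .inl hik⟩
    · exact .inl ⟨ha, hb, hla, hlb, hloc, i, i, hi, hk, .inr (.inr ⟨hc.1, hc.2, le_rfl⟩)⟩
    · exact .inl ⟨ha, hb, hla, hlb, hloc, i, i, hi, hk, .inr (.inl hc)⟩
    · exact .inr ⟨ha, hb, h₁, h₂, hloc, i, i, hi, hk, .inr (hc.imp (fun hc => ⟨rfl, hc⟩) id)⟩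

theorem phaseOrder_irrefl (h : LocksOwned H tco G own) {a : Event Tid Loc Val} (ha : a ∈ G.E)
    (hla : a.lab.IsLock) : ¬ PhaseOrder tco own a a := by
  rintro (⟨h₁, h₂⟩ | ⟨h₁, h₂, -⟩ | ⟨-, -, hc | ⟨-, h₁, h₂⟩⟩)
  · exact h₁.not_isWLock h₂
  · rw [h₁] at h₂; cases h₂
  · exact h.ord.irrefl _ (h.own_mem ha hla) hc
  · rw [h₁] at h₂; cases h₂

theorem phaseOrder_trans (h : LocksOwned H tco G own) {a b d : Event Tid Loc Val} (ha : a ∈ G.E)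
    (hb : b ∈ G.E) (hd : d ∈ G.E) (hla : a.lab.IsLock) (hlb : b.lab.IsLock) (hld : d.lab.IsLock)
    (hab : PhaseOrder tco own a b) (hbd : PhaseOrder tco own b d) : PhaseOrder tco own a d := by
  have hwl : ∀ {x}, b.lab = .PL x → ¬ b.lab.IsRLock := fun e hr => by
    rw [e] at hr; simp [Label.IsRLock] at hr
  have hwu : ∀ {x}, b.lab = .WU x → ¬ b.lab.IsRLock := fun e hr => by
    rw [e] at hr; simp [Label.IsRLock] at hr
  rcases hab with ⟨h₁, h₂⟩ | ⟨h₁, h₂, h₃⟩ | ⟨h₁, h₂, h₃⟩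
  · rcases hbd with ⟨h₄, -⟩ | ⟨h₄, h₅, -⟩ | ⟨h₄, -⟩
    · exact (h₄.not_isWLock h₂).elim
    · exact .inl ⟨h₁, by rw [h₅]; simp [Label.IsWLock, Label.loc]⟩
    · exact (h₄.not_isWLock h₂).elim
  · rcases hbd with ⟨h₄, -⟩ | ⟨h₄, -⟩ | ⟨h₄, -⟩
    · exact (hwu h₂ h₄).elim
    · rw [h₂] at h₄; cases h₄
    · exact (hwu h₂ h₄).elim
  · rcases hbd with ⟨-, h₅⟩ | ⟨h₄, -⟩ | ⟨-, h₅, h₆⟩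
    · exact .inl ⟨h₁, h₅⟩
    · exact (hwl h₄ h₂).elim
    · refine .inr (.inr ⟨h₁, h₅, ?_⟩)
      rcases h₃ with h₃ | ⟨h₃, h₇, h₈⟩ <;> rcases h₆ with h₆ | ⟨h₆, h₉, -⟩
      · exact .inl (h.ord.trans _ (h.own_mem ha hla) _ (h.own_mem hb hlb) _
          (h.own_mem hd hld) h₃ h₆)
      · exact .inl (h₆ ▸ h₃)
      · exact .inl (h₃ ▸ h₆)
      · rw [h₈] at h₉; cases h₉

theorem rlo_irrefl (h : LocksOwned H tco G own) (a : Event Tid Loc Val) :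
    ¬ ExecGraph.RLO H tco G own a a := by
  intro haa
  obtain ⟨ha, -, hla, -, -⟩ := mem_of_rlo haa
  obtain ⟨i, hi⟩ := h.exists_phase ha hla
  rcases (h.rlo_iff ha ha hla hla rfl hi hi).1 haa with hlt | ⟨-, hp⟩
  · exact lt_irrefl _ hlt
  · exact h.phaseOrder_irrefl ha hla hp

theorem rlo_trans (h : LocksOwned H tco G own) (a b d : Event Tid Loc Val)
    (hab : ExecGraph.RLO H tco G own a b) (hbd : ExecGraph.RLO H tco G own b d) :
    ExecGraph.RLO H tco G own a d := by
  obtain ⟨ha, hb, hla, hlb, hloc⟩ := mem_of_rlo hab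
  obtain ⟨-, hd, -, hld, hloc'⟩ := mem_of_rlo hbd
  obtain ⟨i, hi⟩ := h.exists_phase ha hla
  obtain ⟨j, hj⟩ := h.exists_phase hb hlb
  obtain ⟨k, hk⟩ := h.exists_phase hd hld
  rw [h.rlo_iff ha hd hla hld (hloc.trans hloc') hi hk]
  rcases (h.rlo_iff ha hb hla hlb hloc hi hj).1 hab with h₁ | ⟨rfl, h₁⟩ <;>
    rcases (h.rlo_iff hb hd hlb hld hloc' hj hk).1 hbd with h₂ | ⟨rfl, h₂⟩
  · exact .inl (h₁.trans h₂)
  · exact .inl h₁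
  · exact .inl h₂
  · exact .inr ⟨rfl, h.phaseOrder_trans ha hb hd hla hlb hld h₁ h₂⟩

theorem rlo_of_transGen_lo (h : LocksOwned H tco G own) {a b : Event Tid Loc Val}
    (hab : Relation.TransGen (ExecGraph.LO H tco G own) a b) : ExecGraph.RLO H tco G own a b := by
  induction hab with
  | single hab => exact .inl hab
  | tail _ hbd ih => exact h.rlo_trans _ _ _ ih (.inl hbd)

theorem rsync (h : LocksOwned H tco G own) {a b : Event Tid Loc Val} (ha : a ∈ G.E)
    (hb : b ∈ G.E) (hla : a.lab.IsRLock) (hlb : b.lab.IsRLock) (hloc : a.loc = b.loc)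
    (hne : a ≠ b) : ExecGraph.RLO H tco G own a b ∨ ExecGraph.RLO H tco G own b a := by
  obtain ⟨i, hi⟩ := h.exists_phase ha (.inl hla)
  obtain ⟨k, hk⟩ := h.exists_phase hb (.inl hlb)
  rw [h.rlo_iff ha hb (.inl hla) (.inl hlb) hloc hi hk,
    h.rlo_iff hb ha (.inl hlb) (.inl hla) hloc.symm hk hi]
  rcases lt_trichotomy i k with hik | rfl | hik
  · exact .inl (.inl hik)
  · by_cases he : own a = own b
    · have hlab : a.lab ≠ b.lab := fun e => hne (h.owner.inj a ha b hb (.inl hla) e he)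
      rcases hla with h₁ | h₁ <;> rcases hlb with h₂ | h₂
      · exact (hlab (by rw [h₁, h₂]; exact congrArg _ hloc)).elim
      · exact .inl (.inr ⟨rfl, .inr (.inr ⟨.inl h₁, .inr h₂, .inr ⟨he, h₁, hloc ▸ h₂⟩⟩)⟩)
      · exact .inr (.inr ⟨rfl, .inr (.inr ⟨.inl h₂, .inr h₁, .inr ⟨he.symm, h₂, hloc ▸ h₁⟩⟩)⟩)
      · exact (hlab (by rw [h₁, h₂]; exact congrArg _ hloc)).elim
    · rcases h.ord.total _ (h.own_mem ha (.inl hla)) _ (h.own_mem hb (.inl hlb)) he with ht | ht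
      · exact .inl (.inr ⟨rfl, .inr (.inr ⟨hla, hlb, .inl ht⟩)⟩)
      · exact .inr (.inr ⟨rfl, .inr (.inr ⟨hlb, hla, .inl ht⟩)⟩)
  · exact .inr (.inl hik)

theorem own_eq_of_phase_eq (h : LocksOwned H tco G own) {a b : Event Tid Loc Val} {i : ℕ}
    (ha : a ∈ G.E) (hb : b ∈ G.E) (hla : a.lab.IsWLock) (hlb : b.lab.IsWLock)
    (hloc : a.loc = b.loc) (hi : H.InPhase tco a.loc i (own a))
    (hk : H.InPhase tco b.loc i (own b)) : own a = own b :=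
  h.writer_eq (h.writerAt ha hla hi) (hloc ▸ h.writerAt hb hlb hk)

theorem lo_total (h : LocksOwned H tco G own) {a b : Event Tid Loc Val} (ha : a ∈ G.E)
    (hb : b ∈ G.E) (hla : a.lab.IsWLock) (hlb : b.lab.IsLock) (hloc : a.loc = b.loc)
    (hne : a ≠ b) : ExecGraph.LO H tco G own a b ∨ ExecGraph.LO H tco G own b a := by
  obtain ⟨i, hi⟩ := h.exists_phase ha (.inr hla)
  obtain ⟨k, hk⟩ := h.exists_phase hb hlb
  rcases lt_or_ge i k with hik | hik
  · exact .inl (lo_of_lt ha hb (.inr hla) hlb hloc hi (hloc ▸ hk) hik (.inl hla))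
  rcases hik.lt_or_eq with hik | rfl
  · exact .inr (lo_of_lt hb ha hlb (.inr hla) hloc.symm hk (hloc ▸ hi) hik (.inr hla))
  rcases hlb with hlb | hlb
  · exact .inr ⟨hb, ha, .inl hlb, .inr hla, hloc.symm, _, _, hk, hloc ▸ hi,
      .inr (.inr ⟨hlb, hla, le_rfl⟩)⟩
  have he := h.own_eq_of_phase_eq ha hb hla hlb hloc hi hk
  have hlab : a.lab ≠ b.lab := fun e => hne (h.owner.inj a ha b hb (.inr hla) e he)
  rcases h.wlock_cases ha hla with h₁ | h₁ <;> rcases h.wlock_cases hb hlb with h₂ | h₂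
  · exact (hlab (by rw [h₁, h₂, hloc])).elim
  · exact .inl ⟨ha, hb, .inr hla, .inr hlb, hloc, _, _, hi, hloc ▸ hk,
      .inr (.inl ⟨h₁, hloc ▸ h₂, he⟩)⟩
  · exact .inr ⟨hb, ha, .inr hlb, .inr hla, hloc.symm, _, _, hk, hloc ▸ hi,
      .inr (.inl ⟨h₂, hloc ▸ h₁, he.symm⟩)⟩
  · exact (hlab (by rw [h₁, h₂, hloc])).elim

/-- A promoted lock is released before it is acquired by other transactions. -/
theorem exists_release (h : LocksOwned H tco G own) {a b : Event Tid Loc Val}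
    (hab : ExecGraph.RLO H tco G own a b) (hl : a.lab = .PL a.loc) :
    ∃ u ∈ G.E, u.lab = .WU a.loc ∧ G.po a u ∧ (u = b ∨ ExecGraph.LO H tco G own u b) := by
  obtain ⟨ha, hb, hla, hlb, hloc⟩ := mem_of_rlo hab
  have haW : a.lab.IsWLock := .inr (.inr hl)
  obtain ⟨i, hi⟩ := h.exists_phase ha hla
  obtain ⟨k, hk⟩ := h.exists_phase hb hlb
  obtain ⟨u, hu, hul, huo⟩ := (h.owner.wu _ (h.own_mem ha hla) a.loc).2 (h.writes ha haW)
  have huloc : u.loc = a.loc := by simp [Event.loc, hul, Label.loc]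
  have huW : u.lab.IsWLock := .inr (.inl (by simp [hul, Label.loc]))
  refine ⟨u, hu, hul, h.po_stage a ha u hu hla (.inr huW) huo.symm
    (by rw [hl, hul]; simp [Label.stage]), ?_⟩
  rcases (h.rlo_iff ha hb hla hlb hloc hi hk).1 hab with hik | ⟨-, h₁ | h₁ | h₁⟩
  · exact .inr (lo_of_lt hu hb (.inr huW) hlb (huloc.trans hloc) (huloc ▸ huo ▸ hi)
      (huloc.trans hloc ▸ hk) hik (.inl huW))
  · exact (h₁.1.not_isWLock haW).elim
  · exact .inl (h.owner.inj u hu b hb (.inr huW) (hul.trans h₁.2.1.symm) (huo.trans h₁.2.2))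
  · exact (h₁.1.not_isWLock haW).elim

/-- A reader lock is released or promoted before a writer lock is acquired by other
transactions. -/
theorem exists_release_or_promotion (h : LocksOwned H tco G own) {a b : Event Tid Loc Val}
    (hab : ExecGraph.RLO H tco G own a b) (hl : a.lab = .RL a.loc) (hbW : b.lab.IsWLock) :
    ∃ u ∈ G.E, (u.lab = .RU a.loc ∨ u.lab = .PL a.loc) ∧ G.po a u ∧
      (u = b ∨ ExecGraph.LO H tco G own u b) := by
  obtain ⟨ha, hb, hla, hlb, hloc⟩ := mem_of_rlo hab
  have haR : a.lab.IsRLock := .inl hl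
  have hm := h.own_mem ha hla
  obtain ⟨i, hi⟩ := h.exists_phase ha hla
  obtain ⟨k, hk⟩ := h.exists_phase hb hlb
  have hik : i ≤ k := by
    rcases (h.rlo_iff ha hb hla hlb hloc hi hk).1 hab with hik | ⟨hik, -⟩
    · exact hik.le
    · exact hik.le
  by_cases hw : H.TxWrites (own a) a.loc
  · obtain ⟨u, hu, hul, huo⟩ := (h.owner.pl _ hm a.loc).2 hw
    have huloc : u.loc = a.loc := by simp [Event.loc, hul, Label.loc]
    have huW : u.lab.IsWLock := .inr (.inr (by simp [hul, Label.loc]))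
    have hui : H.InPhase tco u.loc i (own u) := huloc ▸ huo ▸ hi
    refine ⟨u, hu, .inr hul, h.po_stage a ha u hu hla (.inr huW) huo.symm
      (by rw [hl, hul]; simp [Label.stage]), ?_⟩
    rcases hik.lt_or_eq with hik | rfl
    · exact .inr (lo_of_lt hu hb (.inr huW) hlb (huloc.trans hloc) hui
        (huloc.trans hloc ▸ hk) hik (.inl huW))
    have he := h.own_eq_of_phase_eq hu hb huW hbW (huloc.trans hloc) hui hk
    rcases h.wlock_cases hb hbW with h₁ | h₁
    · exact .inl (h.owner.inj u hu b hb (.inr huW) (by rw [hul, h₁, hloc]) he)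
    · exact .inr ⟨hu, hb, .inr huW, hlb, huloc.trans hloc, _, _, hui, huloc.trans hloc ▸ hk,
        .inr (.inl ⟨huloc ▸ hul, (huloc.trans hloc) ▸ h₁, he⟩)⟩
  · obtain ⟨u, hu, hul, huo⟩ := (h.owner.ru _ hm a.loc).2 ⟨h.accesses ha hla, hw⟩
    have huloc : u.loc = a.loc := by simp [Event.loc, hul, Label.loc]
    have huR : u.lab.IsRLock := .inr (by simp [hul, Label.loc])
    exact ⟨u, hu, .inl hul, h.po_stage a ha u hu hla (.inl huR) huo.symm
      (by rw [hl, hul]; simp [Label.stage]), .inr ⟨hu, hb, .inl huR, hlb, huloc.trans hloc, i, k,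
        huloc ▸ huo ▸ hi, huloc.trans hloc ▸ hk, .inr (.inr ⟨huR, hbW, hik⟩)⟩⟩

end LocksOwned

end LockOrders

/-! ### Times of snapshots and commits -/

section Times

variable {Tid Loc Val : Type*}

/-- The number of transactions up to `ξ`: the time at which `ξ` takes its snapshot. -/
noncomputable def snapTime (H : ExecGraph Tid Loc Val) (tco : ℕ → ℕ → Prop) (ξ : ℕ) : ℕ :=
  {η | η ∈ H.txs ∧ (η = ξ ∨ tco η ξ)}.ncard

/-- The number of transactions up to `ξ` or up to a transaction that precedes `ξ` in `rb`: the time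
at which `ξ` stores its results. -/
noncomputable def commitTime (H : ExecGraph Tid Loc Val) (tco : ℕ → ℕ → Prop) (ξ : ℕ) : ℕ :=
  {η | η ∈ H.txs ∧ ∃ ζ, (ζ = ξ ∨ H.TxRel H.rb ζ ξ) ∧ (η = ζ ∨ tco η ζ)}.ncard

namespace TxOrdered

variable {H : ExecGraph Tid Loc Val} {tco : ℕ → ℕ → Prop}

theorem mem_of_transGen_dep {ξ ζ : ℕ} (hd : Relation.TransGen H.TxDep ξ ζ) :
    ξ ∈ H.txs ∧ ζ ∈ H.txs := by
  induction hd with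
  | single hd => exact hd.mem
  | tail _ hd ih => exact ⟨ih.1, hd.mem.2⟩

variable [Zero Val]

theorem snapTime_pos (h : TxOrdered H tco) {ξ : ℕ} (hξ : ξ ∈ H.txs) : 0 < snapTime H tco ξ :=
  (Set.ncard_pos (h.fin.subset fun _ hη => hη.1)).2 ⟨ξ, hξ, .inl rfl⟩

theorem snapTime_lt_of_tco (h : TxOrdered H tco) {ξ ζ : ℕ} (hξ : ξ ∈ H.txs) (hζ : ζ ∈ H.txs)
    (hlt : tco ξ ζ) : snapTime H tco ξ < snapTime H tco ζ := by
  refine Set.ncard_lt_ncard ⟨?_, fun hsub => ?_⟩ (h.fin.subset fun η hη => hη.1)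
  · rintro η ⟨hη, rfl | hηξ⟩
    · exact ⟨hη, .inr hlt⟩
    · exact ⟨hη, .inr (h.ord.trans η hη ξ hξ ζ hζ hηξ hlt)⟩
  · obtain ⟨-, rfl | hζξ⟩ := hsub (a := ζ) ⟨hζ, .inl rfl⟩
    · exact h.ord.irrefl _ hξ hlt
    · exact h.asymm hξ hζ hlt hζξ

theorem snapTime_le_commitTime (h : TxOrdered H tco) {ξ ζ : ℕ} (hξζ : ξ = ζ ∨ H.TxRel H.rb ξ ζ) :
    snapTime H tco ξ ≤ commitTime H tco ζ :=
  Set.ncard_le_ncard (fun _ hη => ⟨hη.1, ξ, hξζ, hη.2⟩) (h.fin.subset fun _ hη => hη.1)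

theorem tco_of_transGen_dep (h : TxOrdered H tco) {θ ξ ζ : ℕ} (h₁ : θ = ξ ∨ H.TxRel H.rb θ ξ)
    (hd : Relation.TransGen H.TxDep ξ ζ) : tco θ ζ := by
  induction hd with
  | single hd => exact h.tco_of_edge h₁ hd
  | tail hd hd' ih =>
    have hθ : θ ∈ H.txs := by
      rcases h₁ with rfl | h₁
      · exact (mem_of_transGen_dep hd).1
      · exact h₁.mem.1
    exact h.ord.trans _ hθ _ hd'.mem.1 _ hd'.mem.2 ih (h.tco_of_dep hd')

/-- This is where SI-consistency enters: `rb? ; dep` is contained in the total order. -/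
theorem commitTime_lt_snapTime (h : TxOrdered H tco) {ξ ζ : ℕ}
    (hd : Relation.TransGen H.TxDep ξ ζ) : commitTime H tco ξ < snapTime H tco ζ := by
  have hζ := (mem_of_transGen_dep hd).2
  have key : ∀ η ∈ H.txs, (∃ θ, (θ = ξ ∨ H.TxRel H.rb θ ξ) ∧ (η = θ ∨ tco η θ)) → tco η ζ := by
    rintro η hη ⟨θ, h₁, h₂⟩
    have hθζ := h.tco_of_transGen_dep h₁ hd
    have hθ : θ ∈ H.txs := by
      rcases h₁ with rfl | h₁
      · exact (mem_of_transGen_dep hd).1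
      · exact h₁.mem.1
    rcases h₂ with rfl | h₂
    · exact hθζ
    · exact h.ord.trans η hη θ hθ ζ hζ h₂ hθζ
  refine Set.ncard_lt_ncard ⟨fun η hη => ⟨hη.1, .inr (key η hη.1 hη.2)⟩, fun hsub => ?_⟩
    (h.fin.subset fun η hη => hη.1)
  obtain ⟨-, hζ'⟩ := hsub (a := ζ) ⟨hζ, .inl rfl⟩
  exact h.ord.irrefl ζ hζ (key ζ hζ hζ')

theorem exists_writer_of_inPhase_succ (h : TxOrdered H tco) {x : Loc} {i ξ : ℕ}
    (hξ : H.InPhase tco x (i + 1) ξ) : ∃ η, H.WriterAt tco x i η := by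
  rcases h.inPhase_iff.1 hξ with hξ | ⟨w, r, -, -, -, ⟨hi, -⟩ | ⟨k, hk, hw, -⟩⟩
  · exact h.exists_preceding_writer hξ
  · omega
  · exact ⟨w.tx, by rwa [show i = k by omega]⟩

end TxOrdered

end Times

/-! ### The values read in SI-consistent graphs -/

section Transactions

variable {Tid Loc Val : Type*} [Zero Val]

/-- The ordered SI-consistent graph `H` whose transaction `p` has the identifier `tag p` and the
accesses `T p`. -/
structure TxLayout (H : ExecGraph Tid Loc Val) (tco : ℕ → ℕ → Prop) (tag : Tid × ℕ → ℕ)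
    (T : Tid × ℕ → List (Label Loc Val)) (At : Tid × ℕ → ℕ → Event Tid Loc Val → Prop) : Prop
    extends TxOrdered H tco where
  lay : Layout H tag T At
  tag_inj : Function.Injective tag
  tag_ne : ∀ p, tag p ≠ 0
  labels : ∀ p, ∀ l ∈ T p, ∃ x v, l = .R x v ∨ l = .W x v

namespace TxLayout

variable {H : ExecGraph Tid Loc Val} {tco : ℕ → ℕ → Prop} {tag : Tid × ℕ → ℕ}
  {T : Tid × ℕ → List (Label Loc Val)} {At : Tid × ℕ → ℕ → Event Tid Loc Val → Prop}

theorem exists_at (h : TxLayout H tco tag T At) {e : Event Tid Loc Val} (he : e ∈ H.E)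
    (h0 : e.tx ≠ 0) : ∃ p j, tag p = e.tx ∧ At p j e := by
  obtain ⟨p, j, hj⟩ := h.lay.cover he (h.tid_ne he h0)
  exact ⟨p, j, (h.lay.tx hj).symm, hj⟩

theorem exists_at_of_tx (h : TxLayout H tco tag T At) {e : Event Tid Loc Val} {p : Tid × ℕ}
    (he : e ∈ H.E) (ht : e.tx = tag p) : ∃ j, At p j e := by
  obtain ⟨q, j, hq, hj⟩ := h.exists_at he (ht ▸ h.tag_ne p)
  exact ⟨j, h.tag_inj (hq.trans ht) ▸ hj⟩

theorem exists_tag_eq (h : TxLayout H tco tag T At) {ξ : ℕ} (hξ : ξ ∈ H.txs) :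
    ∃ p, tag p = ξ := by
  obtain ⟨h0, e, he, rfl⟩ := hξ
  obtain ⟨p, -, hp, -⟩ := h.exists_at he h0
  exact ⟨p, hp⟩

theorem label_cases (h : TxLayout H tco tag T At) {p : Tid × ℕ} {j : ℕ} {e : Event Tid Loc Val}
    (he : At p j e) : ∃ v, e.lab = .R e.loc v ∨ e.lab = .W e.loc v := by
  obtain ⟨x, v, hl⟩ := h.labels p _ (List.mem_of_getElem? (h.lay.lab he))
  refine ⟨v, ?_⟩
  rcases hl with hl | hl <;> simp [Event.loc, hl, Label.loc]

theorem exists_W (h : TxLayout H tco tag T At) {p : Tid × ℕ} {j : ℕ} {e : Event Tid Loc Val}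
    (he : At p j e) (hw : e.lab.IsWrite) : ∃ v, e.lab = .W e.loc v := by
  obtain ⟨v, hl | hl⟩ := h.label_cases he
  · rw [hl] at hw; simp [Label.IsWrite, Label.valW] at hw
  · exact ⟨v, hl⟩

theorem txWrites_iff (h : TxLayout H tco tag T At) {p : Tid × ℕ} {x : Loc} :
    H.TxWrites (tag p) x ↔ x ∈ writesOf (T p) := by
  constructor
  · rintro ⟨e, he, ht, rfl, hw⟩
    obtain ⟨j, hj⟩ := h.exists_at_of_tx he ht
    obtain ⟨v, hv⟩ := h.exists_W hj hw
    exact mem_writesOf_iff_getElem?.2 ⟨j, v, hv ▸ h.lay.lab hj⟩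
  · intro hx
    obtain ⟨j, v, hj⟩ := mem_writesOf_iff_getElem?.1 hx
    obtain ⟨e, he, hl⟩ := h.lay.ex hj
    exact ⟨e, h.lay.mem he, h.lay.tx he, by simp [Event.loc, hl, Label.loc],
      by simp [Label.IsWrite, hl, Label.valW]⟩

theorem txAccesses_iff (h : TxLayout H tco tag T At) {p : Tid × ℕ} {x : Loc} :
    H.TxAccesses (tag p) x ↔ x ∈ accessed (T p) := by
  constructor
  · rintro ⟨e, he, ht, rfl⟩
    obtain ⟨j, hj⟩ := h.exists_at_of_tx he ht
    have hm := List.mem_of_getElem? (h.lay.lab hj)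
    obtain ⟨v, hv | hv⟩ := h.label_cases hj
    · exact readsOf_subset ⟨v, hv ▸ hm⟩
    · exact .inr ⟨v, hv ▸ hm⟩
  · rintro (hx | hx)
    · obtain ⟨v, hv⟩ := readsFirst_subset_readsOf hx
      obtain ⟨j, hj⟩ := List.mem_iff_getElem?.1 hv
      obtain ⟨e, he, hl⟩ := h.lay.ex hj
      exact ⟨e, h.lay.mem he, h.lay.tx he, by simp [Event.loc, hl, Label.loc]⟩
    · obtain ⟨e, he, ht, hx, -⟩ := h.txWrites_iff.2 hx
      exact ⟨e, he, ht, hx⟩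

theorem mem_txs (h : TxLayout H tco tag T At) {p : Tid × ℕ} {x : Loc}
    (hx : x ∈ accessed (T p)) : tag p ∈ H.txs := by
  obtain ⟨e, he, ht, -⟩ := h.txAccesses_iff.2 hx
  exact ⟨h.tag_ne p, e, he, ht⟩

theorem mem_txs_of_at (h : TxLayout H tco tag T At) {p : Tid × ℕ} {j : ℕ}
    {e : Event Tid Loc Val} (he : At p j e) : tag p ∈ H.txs :=
  ⟨h.tag_ne p, e, h.lay.mem he, h.lay.tx he⟩

theorem lt_of_po (h : TxLayout H tco tag T At) {p : Tid × ℕ} {j i : ℕ}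
    {e f : Event Tid Loc Val} (he : At p j e) (hf : At p i f) (hpo : H.po e f) : j < i := by
  rcases (h.lay.po he hf).1 hpo with ⟨-, hlt | hlt⟩
  · exact (lt_irrefl _ hlt).elim
  · exact hlt.2

theorem st_of_at (h : TxLayout H tco tag T At) {p : Tid × ℕ} {j i : ℕ}
    {e f : Event Tid Loc Val} (he : At p j e) (hf : At p i f) : H.st e f :=
  ⟨h.lay.mem he, h.lay.mem hf, by rw [h.lay.tx he]; exact h.tag_ne p,
    (h.lay.tx he).trans (h.lay.tx hf).symm⟩

theorem txDep_of_po (h : TxLayout H tco tag T At) {p q : Tid × ℕ} (hp : tag p ∈ H.txs)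
    (hq : tag q ∈ H.txs) (hpq : p.1 = q.1) (hlt : p.2 < q.2) : H.TxDep (tag p) (tag q) := by
  obtain ⟨hp0, e, he, het⟩ := hp
  obtain ⟨hq0, f, hf, hft⟩ := hq
  obtain ⟨j, hj⟩ := h.exists_at_of_tx he het
  obtain ⟨i, hi⟩ := h.exists_at_of_tx hf hft
  refine .inl ⟨hp0, hq0, fun e => ?_, e, he, f, hf, het, hft,
    (h.lay.po hj hi).2 ⟨hpq, .inl hlt⟩⟩
  rw [h.tag_inj e] at hlt
  exact lt_irrefl _ hlt

/-- The writer that precedes the phase of a transaction. -/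
theorem exists_src (h : TxLayout H tco tag T At) (p : Tid × ℕ) (x : Loc) :
    ∃ o : Option (Tid × ℕ), ∀ q, o = some q ↔
      ∃ i, H.InPhase tco x (i + 1) (tag p) ∧ H.WriterAt tco x i (tag q) := by
  by_cases hex : ∃ q i, H.InPhase tco x (i + 1) (tag p) ∧ H.WriterAt tco x i (tag q)
  · obtain ⟨q, i, hp, hq⟩ := hex
    refine ⟨some q, fun q' => ⟨?_, ?_⟩⟩
    · rintro ⟨⟩
      exact ⟨i, hp, hq⟩
    · rintro ⟨k, hp', hq'⟩
      have hmem : tag p ∈ H.txs := by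
        rcases h.inPhase_iff.1 hp with hp | hp
        · exact hp.1
        · exact h.readerAt_mem hp (h.tag_ne p)
      obtain rfl : i = k := by
        have := h.inPhase_unique hmem hp hp'
        omega
      rw [h.tag_inj (h.writer_eq hq hq')]
  · refine ⟨none, fun q => ⟨by simp, fun hq => (hex ⟨q, hq⟩).elim⟩⟩

variable [DecidableEq Loc]

/-- The values read by the transactions of an SI-consistent graph are the last values written by
themselves, or else the last values written by the preceding writers. -/
theorem legal (h : TxLayout H tco tag T At) {src : Tid × ℕ → Loc → Option (Tid × ℕ)}
    (hsrc : ∀ p x q, src p x = some q ↔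
      ∃ i, H.InPhase tco x (i + 1) (tag p) ∧ H.WriterAt tco x i (tag q)) (p : Tid × ℕ) :
    Legal (extVal T src p) (T p) := by
  refine legal_of_getElem? fun j x v hj => ?_
  obtain ⟨r, hr, hrl⟩ := h.lay.ex hj
  obtain ⟨w, hrf, -⟩ := h.wf.rf_unique r (h.lay.mem hr) (by simp [Label.IsRead, hrl, Label.valR])
  have hwE := (h.wf.rf_mem _ _ hrf).1
  obtain ⟨hwx, v', hwv, hrv⟩ := h.wf.rf_val _ _ hrf
  obtain rfl : v = v' := by simpa [hrl, Label.valR] using hrv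
  have hrx : r.loc = x := by simp [Event.loc, hrl, Label.loc]
  rw [hrx] at hwx
  have hww : w.lab.IsWrite := by simp [Label.IsWrite, hwv]
  have hrw : ∀ {e : Event Tid Loc Val} {y u}, e.lab = .W y u → r ≠ e := by
    rintro e y u he rfl
    rw [hrl] at he; cases he
  have hwlab : ∀ {q n}, At q n w → w.lab = .W x v := by
    intro q n hn
    obtain ⟨u, hu⟩ := h.exists_W hn hww
    rw [hu] at hwv ⊢
    rw [hwx]
    simp only [Label.valW, Option.some.injEq] at hwv
    rw [hwv]
  have hrftx : ∀ {q n}, At q n w → q ≠ p → H.TxDep (tag q) (tag p) := fun {q n} hn hne =>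
    .inr (.inl ⟨h.tag_ne q, h.tag_ne p, fun e => hne (h.tag_inj e), w, hwE, r, h.lay.mem hr,
      h.lay.tx hn, h.lay.tx hr, hrf⟩)
  have hint : ∀ {n}, At p n w → n < j := fun hn =>
    h.lt_of_po hn hr (h.si.int _ _ (.inl ⟨hrf, h.st_of_at hn hr⟩))
  by_cases hx : x ∈ writesOf ((T p).take j)
  · -- the read is from the last preceding write of its own transaction
    obtain ⟨i, hlast⟩ := exists_isLastWrite hx
    obtain ⟨v₀, hv₀⟩ := hlast.1
    rw [memAfter_of_isLastWrite hlast hv₀]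
    have hij : i < j := by
      have := (List.getElem?_eq_some_iff.1 hv₀).1
      rw [List.length_take] at this
      omega
    rw [List.getElem?_take, if_pos hij] at hv₀
    obtain ⟨w₀, hw₀, hw₀l⟩ := h.lay.ex hv₀
    have hw₀W : w₀.lab.IsWrite := by simp [Label.IsWrite, hw₀l, Label.valW]
    have hw₀x : w₀.loc = x := by simp [Event.loc, hw₀l, Label.loc]
    have hno : ¬ H.mo w w₀ := fun hmo => by
      have := h.lt_of_po hr hw₀ (h.si.int _ _ (.inr (.inr
        ⟨⟨hrw hw₀l, w, hrf, hmo⟩, h.st_of_at hr hw₀⟩)))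
      omega
    suffices w = w₀ by
      subst this
      simpa [hw₀l, Label.valW] using hwv.symm
    by_contra hne
    have hmo := (h.wf.mo_total w hwE w₀ (h.lay.mem hw₀) hww hw₀W (hwx.trans hw₀x.symm)
      hne).resolve_left hno
    have ht : w.tid ≠ none := fun ht => hno (h.wf.mo_init w hwE w₀ (h.lay.mem hw₀) ht
      (by simp [h.lay.tid hw₀]) hw₀W (hwx.trans hw₀x.symm))
    obtain ⟨q, n, hn⟩ := h.lay.cover hwE ht
    by_cases hqp : q = p
    · subst hqp
      have h₁ := h.lt_of_po hw₀ hn (h.si.int _ _ (.inr (.inl ⟨hmo, h.st_of_at hw₀ hn⟩)))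
      have h₂ := hint hn
      have h₃ := hlast.2 n v (by rw [List.getElem?_take, if_pos h₂, h.lay.lab hn, hwlab hn])
      omega
    · refine h.asymm (h.mem_txs_of_at hn) (h.mem_txs_of_at hr) (h.tco_of_dep (hrftx hn hqp))
        (h.tco_of_dep (.inr (.inr ⟨h.tag_ne p, h.tag_ne q, fun e => hqp (h.tag_inj e).symm, w₀,
          h.lay.mem hw₀, w, hwE, h.lay.tx hw₀, h.lay.tx hn, hmo⟩)))
  · -- the read is from the initialisation write or from another transaction
    rw [memAfter_of_notMem hx]
    by_cases ht : w.tid = none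
    · obtain ⟨-, y, hy⟩ := h.wf.init_lab w hwE ht
      have hphase : H.InPhase tco x 0 (tag p) :=
        h.inPhase_iff.2 (.inr ⟨w, r, hrf, hwx, h.lay.tx hr, .inl ⟨rfl, ht⟩⟩)
      have hnone : src p x = none := by
        cases hs : src p x with
        | none => rfl
        | some q =>
          obtain ⟨i, hi, -⟩ := (hsrc p x q).1 hs
          have := h.inPhase_unique (h.mem_txs_of_at hr) hphase hi
          omega
      rw [extVal, hnone]
      simpa [hy, Label.valW] using hwv.symm
    · obtain ⟨q, n, hn⟩ := h.lay.cover hwE ht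
      have hqp : q ≠ p := by
        rintro rfl
        exact hx (mem_writesOf_iff_getElem?.2 ⟨n, v,
          by rw [List.getElem?_take, if_pos (hint hn), h.lay.lab hn, hwlab hn]⟩)
      obtain ⟨k, hk⟩ := exists_writerAt (tco := tco) (h.mem_txs_of_at hn)
        (⟨w, hwE, h.lay.tx hn, hwx, hww⟩ : H.TxWrites (tag q) x)
      have hphase : H.InPhase tco x (k + 1) (tag p) :=
        h.inPhase_iff.2 (.inr ⟨w, r, hrf, hwx, h.lay.tx hr, .inr ⟨k, rfl, h.lay.tx hn ▸ hk,
          fun e => hqp (h.tag_inj ((h.lay.tx hn).symm.trans e))⟩⟩)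
      rw [extVal, (hsrc p x q).2 ⟨k, hphase, hk⟩]
      refine (memAfter_of_isLastWrite (i := n) ⟨⟨v, hwlab hn ▸ h.lay.lab hn⟩, fun n' v' hn' => ?_⟩
        (hwlab hn ▸ h.lay.lab hn) _).symm
      -- A later write `w'` of the same transaction would yield `rb` from the reader to the writer
      -- and `rf` back to the reader, which is a cycle of `rb ; dep`.
      by_contra hlt
      obtain ⟨w', hw', hw'l⟩ := h.lay.ex hn'
      have hmo : H.mo w w' := by
        refine (h.wf.mo_total w hwE w' (h.lay.mem hw') hww
          (by simp [Label.IsWrite, hw'l, Label.valW])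
          (hwx.trans (by simp [Event.loc, hw'l, Label.loc])) ?_).resolve_right fun hmo => ?_
        · rintro rfl
          exact hlt (h.lay.inj hn hw').2.ge
        · exact hlt (h.lt_of_po hw' hn (h.si.int _ _ (.inr (.inl ⟨hmo, h.st_of_at hw' hn⟩)))).le
      refine h.ord.irrefl _ (h.mem_txs_of_at hr) (h.tco_of_edge (.inr ?_) (hrftx hn hqp))
      exact ⟨h.tag_ne p, h.tag_ne q, fun e => hqp (h.tag_inj e).symm, r, h.lay.mem hr, w',
        h.lay.mem hw', h.lay.tx hr, h.lay.tx hw', hrw hw'l, w, hrf, hmo⟩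

end TxLayout

end Transactions

/-! ### Realisation of SI-consistent graphs -/

section Realisation

variable {Tid Loc Val : Type*}

/-- The transaction that owns an event of a built graph, according to the block in which the event
is placed. -/
def ownTx (tag : Tid × ℕ → ℕ) (e : Event Tid Loc Val) : ℕ :=
  match e.tid with
  | none => 0
  | some τ => tag (τ, (Nat.unpair e.id).1)

theorem ownTx_placed {tag tag' : Tid × ℕ → ℕ} {B : Tid × ℕ → List (Label Loc Val)} {p : Tid × ℕ}
    {j : ℕ} {e : Event Tid Loc Val} (h : Placed tag' B p j e) : ownTx tag e = tag p := by
  rw [h.1]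
  simp [ownTx]

/-- A time at which an event of the implementation can be executed: initialisation events are
first, the lock calls and loads up to the end of the snapshot are at even times, and all other
events are at odd times. -/
noncomputable def eventTime (H : ExecGraph Tid Loc Val) (tco : ℕ → ℕ → Prop) (tag : Tid × ℕ → ℕ)
    (e : Event Tid Loc Val) : ℕ :=
  match e.tid with
  | none => 0
  | some _ => if e.lab.stage ≤ 1 then 2 * snapTime H tco (ownTx tag e)
      else 2 * commitTime H tco (ownTx tag e) + 1

/-- Events are ordered by time, and events that have the same time by program order. -/
def Earlier (H G : ExecGraph Tid Loc Val) (tco : ℕ → ℕ → Prop) (tag : Tid × ℕ → ℕ)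
    (a b : Event Tid Loc Val) : Prop :=
  eventTime H tco tag a < eventTime H tco tag b ∨
    eventTime H tco tag a = eventTime H tco tag b ∧ G.po a b

theorem Label.IsRLock.stage_le {l : Label Loc Val} (hl : l.IsRLock) :
    l.stage ≤ 1 := by
  rcases hl with hl | hl <;> rw [hl] <;> simp [Label.stage]

theorem Label.IsWLock.lt_stage {l : Label Loc Val} (hl : l.IsWLock) :
    1 < l.stage := by
  rcases hl with hl | hl | hl <;> rw [hl] <;> simp [Label.stage]

variable {H : ExecGraph Tid Loc Val} {tco : ℕ → ℕ → Prop} {tag : Tid × ℕ → ℕ}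
  {U : Tid × ℕ → List (Label Loc Val)} {src : Tid × ℕ → Loc → Option (Tid × ℕ)}
  {lo : Event Tid Loc Val → Event Tid Loc Val → Prop}

theorem eventTime_of_stage_le {p : Tid × ℕ} {j : ℕ}
    {e : Event Tid Loc Val} (he : Placed (fun _ => 0) U p j e) (hs : e.lab.stage ≤ 1) :
    eventTime H tco tag e = 2 * snapTime H tco (tag p) := by
  rw [eventTime, he.tid, ownTx_placed he]
  exact if_pos hs

theorem eventTime_of_lt_stage {p : Tid × ℕ} {j : ℕ}
    {e : Event Tid Loc Val} (he : Placed (fun _ => 0) U p j e) (hs : 1 < e.lab.stage) :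
    eventTime H tco tag e = 2 * commitTime H tco (tag p) + 1 := by
  rw [eventTime, he.tid, ownTx_placed he]
  exact if_neg (not_le.2 hs)

variable [Zero Val]

/-- The execution graph of the implementation, with lock order `lo`. -/
abbrev implGraph (tco : ℕ → ℕ → Prop) (tag : Tid × ℕ → ℕ)
    (src : Tid × ℕ → Loc → Option (Tid × ℕ)) (U : Tid × ℕ → List (Label Loc Val))
    (lo : Event Tid Loc Val → Event Tid Loc Val → Prop) : ExecGraph Tid Loc Val :=
  build (fun _ => 0) U (fun p q => tco (tag p) (tag q)) src lo

theorem exists_placed_of_lock {a : Event Tid Loc Val}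
    (ha : a ∈ (implGraph tco tag src U lo).E) (hl : a.lab.IsLock) :
    ∃ p j, Placed (fun _ => 0) U p j a := by
  rcases ha with ⟨x, rfl⟩ | ha
  · simp [initEvent, Label.IsLock, Label.IsRLock, Label.IsWLock] at hl
  · exact ha

variable [DecidableEq Loc]

/-- The blocks `U p` realise the transactions of the SI-consistent graph `H`, where `src` assigns
the preceding writers to transactions. -/
structure Realisation (H : ExecGraph Tid Loc Val) (tco : ℕ → ℕ → Prop) (tag : Tid × ℕ → ℕ)
    (T : Tid × ℕ → List (Label Loc Val)) (At : Tid × ℕ → ℕ → Event Tid Loc Val → Prop)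
    (src : Tid × ℕ → Loc → Option (Tid × ℕ)) (U : Tid × ℕ → List (Label Loc Val)) : Prop
    extends TxLayout H tco tag T At where
  src_iff : ∀ p x q, src p x = some q ↔
    ∃ i, H.InPhase tco x (i + 1) (tag p) ∧ H.WriterAt tco x i (tag q)
  block : ∀ p, ExactBlock (extVal T src p) (T p) (U p)

namespace Realisation

variable {T : Tid × ℕ → List (Label Loc Val)} {At : Tid × ℕ → ℕ → Event Tid Loc Val → Prop}

theorem loc_mem (h : Realisation H tco tag T At src U) {p : Tid × ℕ} {l : Label Loc Val}
    (hl : l ∈ U p) : l.loc ∈ accessed (T p) := by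
  have hb := h.block p
  cases l with
  | R x v => exact (hb.loads x v hl).2
  | W x v => exact .inr (hb.writes ▸ ⟨v, hl⟩)
  | U x a b => exact (hb.no_upd _ _ _ hl).elim
  | RL x => exact hb.rl_mem x hl
  | RU x => exact ((hb.ru_iff x).1 hl).1
  | WL x => exact (hb.no_wl x hl).elim
  | WU x => exact .inr ((hb.wu_iff x).1 hl)
  | PL x => exact .inr (hb.pl_mem x hl)

theorem placed_mem (h : Realisation H tco tag T At src U) {p : Tid × ℕ} {j : ℕ}
    {e : Event Tid Loc Val} (he : Placed (fun _ => 0) U p j e) : e.loc ∈ accessed (T p) :=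
  h.loc_mem (List.mem_of_getElem? he.2)

theorem tag_mem (h : Realisation H tco tag T At src U) {p : Tid × ℕ} {j : ℕ}
    {e : Event Tid Loc Val} (he : Placed (fun _ => 0) U p j e) : tag p ∈ H.txs :=
  h.mem_txs (h.placed_mem he)

theorem lt_of_stage_lt (h : Realisation H tco tag T At src U) {p : Tid × ℕ} {i j : ℕ}
    {e f : Event Tid Loc Val} (he : Placed (fun _ => 0) U p i e) (hf : Placed (fun _ => 0) U p j f)
    (hs : e.lab.stage < f.lab.stage) : i < j := by
  by_contra hij
  rcases (not_lt.1 hij).lt_or_eq with hij | rfl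
  · obtain ⟨h₁, h₁'⟩ := List.getElem?_eq_some_iff.1 he.2
    obtain ⟨h₂, h₂'⟩ := List.getElem?_eq_some_iff.1 hf.2
    have := List.pairwise_iff_getElem.1 (h.block p).sorted j i h₂ h₁ hij
    rw [h₁', h₂'] at this
    omega
  · rw [he.fn hf] at hs
    exact lt_irrefl _ hs

theorem writesOf_block (h : Realisation H tco tag T At src U) (p : Tid × ℕ) :
    writesOf (U p) = writesOf (T p) := (h.block p).writes

theorem mem_txs_of_writes (h : Realisation H tco tag T At src U) {p : Tid × ℕ} {x : Loc}
    (hx : x ∈ writesOf (U p)) : tag p ∈ H.txs :=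
  h.mem_txs (.inr (h.writesOf_block p ▸ hx))

theorem txWrites_of_mem (h : Realisation H tco tag T At src U) {p : Tid × ℕ} {x : Loc}
    (hx : x ∈ writesOf (U p)) : H.TxWrites (tag p) x :=
  h.txWrites_iff.2 (h.writesOf_block p ▸ hx)

/-- In a block, loads precede stores. -/
theorem notMem_writesOf_take (h : Realisation H tco tag T At src U) {p : Tid × ℕ} {j : ℕ}
    {x : Loc} {v : Val} (hj : (U p)[j]? = some (.R x v)) : x ∉ writesOf ((U p).take j) := by
  intro hx
  obtain ⟨i, u, hi⟩ := mem_writesOf_iff_getElem?.1 hx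
  rw [List.getElem?_take] at hi
  split_ifs at hi with hij
  obtain ⟨e, he, hel⟩ := exists_placed (tag := fun _ => 0) hi
  obtain ⟨f, hf, hfl⟩ := exists_placed (tag := fun _ => 0) hj
  have := h.lt_of_stage_lt hf he (by rw [hel, hfl]; exact Nat.succ_pos 2)
  omega

theorem buildable (h : Realisation H tco tag T At src U) :
    Buildable (fun _ => 0) U (fun p q => tco (tag p) (tag q)) src where
  tags := .inl fun _ => rfl
  no_upd p := (h.block p).no_upd
  irrefl x p hx := h.ord.irrefl _ (h.mem_txs_of_writes hx)
  trans x p q r hp hq hr := h.ord.trans _ (h.mem_txs_of_writes hp) _ (h.mem_txs_of_writes hq) _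
    (h.mem_txs_of_writes hr)
  total x p q hp hq hne := h.ord.total _ (h.mem_txs_of_writes hp) _ (h.mem_txs_of_writes hq)
    fun e => hne (h.tag_inj e)
  src_mem p x q hq := by
    obtain ⟨i, -, hw⟩ := (h.src_iff p x q).1 hq
    rw [h.writesOf_block]
    exact h.txWrites_iff.1 hw.2.1
  legal p := by
    refine legal_of_getElem? fun j x v hj => ?_
    rw [memAfter_of_notMem (h.notMem_writesOf_take hj),
      ((h.block p).loads x v (List.mem_of_getElem? hj)).1, extVal, extVal]
    cases src p x with
    | none => rfl
    | some q => exact (congrFun ((h.block q).mem _) x).symm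

theorem exists_lock_iff (h : Realisation H tco tag T At src U) {p : Tid × ℕ} {l : Label Loc Val}
    (hl : l.IsLock) : (∃ a ∈ (implGraph tco tag src U lo).E, a.lab = l ∧ ownTx tag a = tag p) ↔
      l ∈ U p := by
  constructor
  · rintro ⟨a, ha, rfl, ho⟩
    obtain ⟨q, j, hj⟩ := exists_placed_of_lock ha hl
    rw [ownTx_placed hj] at ho
    exact h.tag_inj ho ▸ List.mem_of_getElem? hj.2
  · intro hm
    obtain ⟨j, hj⟩ := List.mem_iff_getElem?.1 hm
    obtain ⟨e, he, hel⟩ := exists_placed (tag := fun _ => 0) hj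
    exact ⟨e, .inr ⟨p, j, he⟩, hel, ownTx_placed he⟩

theorem lockOwner (h : Realisation H tco tag T At src U) :
    H.LockOwner (implGraph tco tag src U lo) (ownTx tag) where
  mem a ha hl := by
    obtain ⟨p, j, hj⟩ := exists_placed_of_lock ha hl
    obtain ⟨h0, e, he, het⟩ := h.tag_mem hj
    obtain ⟨i, hi⟩ := h.exists_at_of_tx he het
    rw [ownTx_placed hj]
    exact ⟨h.tag_mem hj, e, he, het, (h.lay.tid hi).trans hj.tid.symm⟩
  po a b hla hlb hab hne c hc d hd hca hdb := by
    obtain ⟨ha, hb⟩ : a ∈ (implGraph tco tag src U lo).E ∧ b ∈ (implGraph tco tag src U lo).E := by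
      rcases hab with ⟨x, q, i, rfl, hi⟩ | ⟨p, j, q, i, hj, hi, -⟩
      · exact ⟨.inl ⟨x, rfl⟩, .inr ⟨q, i, hi⟩⟩
      · exact ⟨.inr ⟨p, j, hj⟩, .inr ⟨q, i, hi⟩⟩
    obtain ⟨p, j, hj⟩ := exists_placed_of_lock ha hla
    obtain ⟨q, i, hi⟩ := exists_placed_of_lock hb hlb
    rw [ownTx_placed hj] at hne hca
    rw [ownTx_placed hi] at hne hdb
    obtain ⟨j', hj'⟩ := h.exists_at_of_tx hc hca
    obtain ⟨i', hi'⟩ := h.exists_at_of_tx hd hdb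
    obtain ⟨h₁, h₂⟩ := (build_layout.po hj hi).1 hab
    refine (h.lay.po hj' hi').2 ⟨h₁, .inl (h₂.resolve_right fun h₂ => hne ?_)⟩
    rw [Prod.ext h₁ h₂.1]
  inj a ha b hb hl hlab ho := by
    obtain ⟨p, j, hj⟩ := exists_placed_of_lock ha hl
    obtain ⟨q, i, hi⟩ := exists_placed_of_lock hb (hlab ▸ hl)
    rw [ownTx_placed hj, ownTx_placed hi] at ho
    obtain rfl := h.tag_inj ho
    have key : ∀ {n k : ℕ} {e f : Event Tid Loc Val}, Placed (fun _ => 0) U p n e →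
        Placed (fun _ => 0) U p k f → e.lab.IsLock →
        e.lab = f.lab → ¬ n < k := by
      intro n k e f he hf hl hef hlt
      obtain ⟨h₁, h₁'⟩ := List.getElem?_eq_some_iff.1 he.2
      obtain ⟨h₂, h₂'⟩ := List.getElem?_eq_some_iff.1 hf.2
      exact List.pairwise_iff_getElem.1 (h.block p).distinct n k h₁ h₂ hlt (h₁' ▸ hl)
        (by rw [h₁', h₂', hef])
    obtain rfl : j = i := le_antisymm (not_lt.1 (key hi hj (hlab ▸ hl) hlab.symm))
      (not_lt.1 (key hj hi hl hlab))
    exact hj.fn hi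
  rl ξ hξ x := by
    obtain ⟨p, rfl⟩ := h.exists_tag_eq hξ
    rw [h.exists_lock_iff (.inl (.inl rfl)), h.txAccesses_iff]
    exact ⟨(h.block p).rl_mem x, (h.block p).rl x⟩
  ru ξ hξ x := by
    obtain ⟨p, rfl⟩ := h.exists_tag_eq hξ
    rw [h.exists_lock_iff (.inl (.inr rfl)), h.txAccesses_iff, h.txWrites_iff]
    exact (h.block p).ru_iff x
  pl ξ hξ x := by
    obtain ⟨p, rfl⟩ := h.exists_tag_eq hξ
    rw [h.exists_lock_iff (.inr (.inr (.inr rfl))), h.txWrites_iff]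
    exact ⟨(h.block p).pl_mem x, fun hx => ((h.block p).pl x hx).1⟩
  wu ξ hξ x := by
    obtain ⟨p, rfl⟩ := h.exists_tag_eq hξ
    rw [h.exists_lock_iff (.inr (.inr (.inl rfl))), h.txWrites_iff]
    exact (h.block p).wu_iff x
  wl a ha x hl := by
    obtain ⟨p, j, hj⟩ := exists_placed_of_lock ha
      (by simp [hl, Label.IsLock, Label.IsWLock, Label.loc])
    exact (h.block p).no_wl x (hl ▸ List.mem_of_getElem? hj.2)

theorem locksOwned (h : Realisation H tco tag T At src U) :
    LocksOwned H tco (implGraph tco tag src U lo) (ownTx tag) where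
  toTxOrdered := h.toTxOrdered
  owner := h.lockOwner
  po_stage a ha b hb hla hlb ho hs := by
    obtain ⟨p, j, hj⟩ := exists_placed_of_lock ha hla
    obtain ⟨q, i, hi⟩ := exists_placed_of_lock hb hlb
    rw [ownTx_placed hj, ownTx_placed hi] at ho
    obtain rfl := h.tag_inj ho
    exact (build_layout.po hj hi).2 ⟨rfl, .inr ⟨rfl, h.lt_of_stage_lt hj hi hs⟩⟩

/-! ### All edges go forward in time -/

theorem eventTime_bounds (h : Realisation H tco tag T At src U) {p : Tid × ℕ} {j : ℕ}
    {e : Event Tid Loc Val} (he : Placed (fun _ => 0) U p j e) :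
    2 * snapTime H tco (tag p) ≤ eventTime H tco tag e ∧
      eventTime H tco tag e ≤ 2 * commitTime H tco (tag p) + 1 := by
  have hle := h.snapTime_le_commitTime (ξ := tag p) (.inl rfl)
  by_cases hs : e.lab.stage ≤ 1
  · rw [eventTime_of_stage_le he hs]; omega
  · rw [eventTime_of_lt_stage he (not_le.1 hs)]; omega

theorem init_lt (h : Realisation H tco tag T At src U) {p : Tid × ℕ} {j : ℕ}
    {e : Event Tid Loc Val} (he : Placed (fun _ => 0) U p j e) (x : Loc) :
    eventTime H tco tag (initEvent x : Event Tid Loc Val) < eventTime H tco tag e := by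
  have h₁ := (h.eventTime_bounds he).1
  have h₂ := h.snapTime_pos (h.tag_mem he)
  change 0 < _
  omega

theorem lt_of_dep (h : Realisation H tco tag T At src U) {p q : Tid × ℕ} {i j : ℕ}
    {e f : Event Tid Loc Val} (he : Placed (fun _ => 0) U p i e) (hf : Placed (fun _ => 0) U q j f)
    (hd : Relation.TransGen H.TxDep (tag p) (tag q)) :
    eventTime H tco tag e < eventTime H tco tag f := by
  have h₁ := (h.eventTime_bounds he).2
  have h₂ := (h.eventTime_bounds hf).1
  have h₃ := h.commitTime_lt_snapTime hd
  omega

theorem lt_of_rb (h : Realisation H tco tag T At src U) {p q : Tid × ℕ} {i j : ℕ}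
    {e f : Event Tid Loc Val} (he : Placed (fun _ => 0) U p i e) (hf : Placed (fun _ => 0) U q j f)
    (hs : e.lab.stage ≤ 1)
    (hs' : 1 < f.lab.stage) (hr : tag p = tag q ∨ H.TxRel H.rb (tag p) (tag q)) :
    eventTime H tco tag e < eventTime H tco tag f := by
  rw [eventTime_of_stage_le he hs, eventTime_of_lt_stage hf hs']
  have := h.snapTime_le_commitTime hr
  omega

theorem earlier_of_lt (h : Realisation H tco tag T At src U) {p : Tid × ℕ} {i j : ℕ}
    {e f : Event Tid Loc Val} (he : Placed (fun _ => 0) U p i e) (hf : Placed (fun _ => 0) U p j f)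
    (hij : i < j) :
    Earlier H (implGraph tco tag src U lo) tco tag e f := by
  have hpo : (implGraph tco tag src U lo).po e f :=
    (build_layout.po he hf).2 ⟨rfl, .inr ⟨rfl, hij⟩⟩
  have hstage : e.lab.stage ≤ f.lab.stage := not_lt.1 fun hs =>
    absurd (h.lt_of_stage_lt hf he hs) (by omega)
  by_cases hs : e.lab.stage ≤ 1
  · by_cases hs' : f.lab.stage ≤ 1
    · exact .inr ⟨(eventTime_of_stage_le he hs).trans (eventTime_of_stage_le hf hs').symm, hpo⟩
    · exact .inl (h.lt_of_rb he hf hs (not_le.1 hs') (.inl rfl))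
  · have hs := not_le.1 hs
    exact .inr ⟨(eventTime_of_lt_stage he hs).trans
      (eventTime_of_lt_stage hf (by omega)).symm, hpo⟩

theorem po_earlier (h : Realisation H tco tag T At src U) {a b : Event Tid Loc Val}
    (hab : (implGraph tco tag src U lo).po a b) :
    Earlier H (implGraph tco tag src U lo) tco tag a b := by
  rcases hab with ⟨x, q, i, rfl, hi⟩ | ⟨p, j, q, i, hj, hi, hpq, hlt | ⟨he, hlt⟩⟩
  · exact .inl (h.init_lt hi x)
  · exact .inl (h.lt_of_dep hj hi (.single (h.txDep_of_po (h.tag_mem hj) (h.tag_mem hi) hpq hlt)))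
  · obtain rfl : p = q := Prod.ext hpq he
    exact h.earlier_of_lt hj hi hlt

theorem rf_earlier (h : Realisation H tco tag T At src U) {a b : Event Tid Loc Val}
    (hab : (implGraph tco tag src U lo).rf a b) :
    Earlier H (implGraph tco tag src U lo) tco tag a b := by
  obtain ⟨p, j, x, v, hj, hl, ⟨i, hi, hlast⟩ | ⟨-, ⟨-, rfl⟩ | ⟨q, i, hs, hi, -⟩⟩⟩ := hab
  · exact (h.notMem_writesOf_take (hl ▸ hj.2) (mem_writesOf_iff_getElem?.2 ⟨i, hlast.1⟩)).elim
  · exact .inl (h.init_lt hj x)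
  · obtain ⟨k, hk, hw⟩ := (h.src_iff p x q).1 hs
    exact .inl (h.lt_of_dep hi hj (h.dep_of_writer hw hk (h.tag_ne p) (Nat.lt_succ_self k)))

theorem mo_earlier (h : Realisation H tco tag T At src U) {a b : Event Tid Loc Val}
    (hab : (implGraph tco tag src U lo).mo a b) :
    Earlier H (implGraph tco tag src U lo) tco tag a b := by
  rcases hab with
    ⟨x, v, q, i, rfl, hi, -⟩ | ⟨p, j, q, i, x, v, w, hj, hi, hla, hlb, hlt | ⟨rfl, hlt⟩⟩
  · exact .inl (h.init_lt hi x)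
  · exact .inl (h.lt_of_dep hj hi (.single (h.dep_of_writes (h.tag_mem hj) (h.tag_mem hi)
      (h.txWrites_of_mem (hj.mem_writesOf hla)) (h.txWrites_of_mem (hi.mem_writesOf hlb)) hlt)))
  · exact h.earlier_of_lt hj hi hlt

theorem rb_earlier (h : Realisation H tco tag T At src U) {a b : Event Tid Loc Val}
    (hab : (implGraph tco tag src U lo).rb a b) :
    Earlier H (implGraph tco tag src U lo) tco tag a b := by
  obtain ⟨-, w, ⟨p, j, x, v, hj, hl, hsrc⟩, hmo⟩ := hab
  have hwl : w.lab = .W x v := hsrc.value h.buildable (hl ▸ hj.2)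
  obtain ⟨q, i, u, hi, hbl⟩ : ∃ q i u, Placed (fun _ => 0) U q i b ∧ b.lab = .W x u := by
    rcases hmo with ⟨y, u, q, i, rfl, hi, hbl⟩ | ⟨_, _, q, i, y, u, u', _, hi, hwl', hbl, -⟩
    · cases hwl
      exact ⟨q, i, u, hi, hbl⟩
    · rw [hwl] at hwl'
      cases hwl'
      exact ⟨q, i, u', hi, hbl⟩
  have hxq := hi.mem_writesOf hbl
  obtain ⟨k, hk⟩ := exists_writerAt (tco := tco) (h.mem_txs_of_writes hxq) (h.txWrites_of_mem hxq)
  have hx : x ∈ accessed (T p) := ((h.block p).loads x v (hl ▸ List.mem_of_getElem? hj.2)).2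
  obtain ⟨n, hn⟩ := h.exists_inPhase (h.mem_txs hx) (h.txAccesses_iff.2 hx)
  -- the reader belongs to the phase of the overwriting transaction or to an earlier one
  have hnk : n ≤ k := by
    rcases hsrc with ⟨i', hi', hlast⟩ | ⟨-, ⟨hs, -⟩ | ⟨q', i', hs, hi', hlast⟩⟩
    · exact (h.notMem_writesOf_take (hl ▸ hj.2) (mem_writesOf_iff_getElem?.2 ⟨i', hlast.1⟩)).elim
    · cases n with
      | zero => exact Nat.zero_le k
      | succ n =>
        obtain ⟨η, hη⟩ := h.exists_writer_of_inPhase_succ hn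
        obtain ⟨q', rfl⟩ := h.exists_tag_eq hη.1
        have := (h.src_iff p x q').2 ⟨n, hn, hη⟩
        simp [hs] at this
    · obtain ⟨n', hn', hw⟩ := (h.src_iff p x q').1 hs
      obtain rfl := h.inPhase_unique (h.mem_txs hx) hn hn'
      rcases hmo with ⟨y, _, _, _, rfl, -, -⟩ | ⟨q₁, i₁, q₂, i₂, y, _, u', h₁, h₂, -, -, hlt⟩
      · exact (hi'.ne_init).elim
      · obtain ⟨rfl, rfl⟩ := hi'.inj h₁
        obtain ⟨rfl, rfl⟩ := hi.inj h₂
        rcases hlt with hlt | ⟨rfl, hlt⟩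
        · exact h.lt_of_tco hw hk hlt
        · have := hlast.2 i u (hbl ▸ hi.2)
          omega
  have hs : a.lab.stage ≤ 1 := by rw [hl]; exact Nat.zero_le 1
  have hs' : 1 < b.lab.stage := by rw [hbl]; exact Nat.succ_lt_succ (Nat.succ_pos 1)
  by_cases hpq : tag p = tag q
  · exact .inl (h.lt_of_rb hj hi hs hs' (.inl hpq))
  · rcases h.dep_or_rb_of_inPhase hn (h.tag_ne p) hk hnk hpq with hd | hd
    · exact .inl (h.lt_of_dep hj hi (.single hd))
    · exact .inl (h.lt_of_rb hj hi hs hs' (.inr hd))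

theorem rlo_earlier (h : Realisation H tco tag T At src U) {a b : Event Tid Loc Val}
    (hab : ExecGraph.RLO H tco (implGraph tco tag src U lo) (ownTx tag) a b) :
    Earlier H (implGraph tco tag src U lo) tco tag a b := by
  have hL := h.locksOwned (lo := lo)
  obtain ⟨ha, hb, hla, hlb, hloc⟩ := mem_of_rlo hab
  obtain ⟨p, j, hj⟩ := exists_placed_of_lock ha hla
  obtain ⟨q, i, hi⟩ := exists_placed_of_lock hb hlb
  obtain ⟨n, hn⟩ := hL.exists_phase ha hla
  obtain ⟨k, hk⟩ := hL.exists_phase hb hlb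
  have hn' : H.InPhase tco a.loc n (tag p) := ownTx_placed (tag := tag) hj ▸ hn
  have hk' : H.InPhase tco a.loc k (tag q) := ownTx_placed (tag := tag) hi ▸ hloc ▸ hk
  -- reader calls precede the writer calls of the same and of later phases
  have hRW : a.lab.IsRLock → b.lab.IsWLock → n ≤ k →
      Earlier H (implGraph tco tag src U lo) tco tag a b := by
    intro hR hW hnk
    by_cases hpq : tag p = tag q
    · exact .inl (h.lt_of_rb hj hi hR.stage_le hW.lt_stage (.inl hpq))
    have hw : H.WriterAt tco a.loc k (tag q) := by
      have := hL.writerAt hb hW hk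
      rwa [ownTx_placed hi, ← hloc] at this
    rcases h.dep_or_rb_of_inPhase hn' (h.tag_ne p) hw hnk hpq with hd | hd
    · exact .inl (h.lt_of_dep hj hi (.single hd))
    · exact .inl (h.lt_of_rb hj hi hR.stage_le hW.lt_stage (.inr hd))
  have hRR : a.lab.IsRLock → b.lab.IsRLock → tco (tag p) (tag q) →
      Earlier H (implGraph tco tag src U lo) tco tag a b := by
    intro hR hR' hlt
    refine .inl ?_
    rw [eventTime_of_stage_le hj hR.stage_le, eventTime_of_stage_le hi hR'.stage_le]
    have := h.snapTime_lt_of_tco (h.tag_mem hj) (h.tag_mem hi) hlt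
    omega
  have hown : ownTx tag a = ownTx tag b → a.lab.stage < b.lab.stage →
      Earlier H (implGraph tco tag src U lo) tco tag a b := by
    intro he hs
    rw [ownTx_placed hj, ownTx_placed hi] at he
    obtain rfl := h.tag_inj he
    exact h.earlier_of_lt hj hi (h.lt_of_stage_lt hj hi hs)
  rcases (hL.rlo_iff ha hb hla hlb hloc hn hk).1 hab with
    hlt | ⟨rfl, ⟨hR, hW⟩ | ⟨h₁, h₂, h₃⟩ | ⟨hR, hR', ht | ⟨h₁, h₂, h₃⟩⟩⟩
  · rcases hla with hR | hW
    · rcases hlb with hR' | hW'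
      · exact hRR hR hR' (h.tco_of_inPhase hn' (h.tag_ne p) hk' (h.tag_ne q) hlt)
      · exact hRW hR hW' hlt.le
    · have hw : H.WriterAt tco a.loc n (tag p) := by
        have := hL.writerAt ha hW hn
        rwa [ownTx_placed hj] at this
      exact .inl (h.lt_of_dep hj hi (h.dep_of_writer hw hk' (h.tag_ne q) hlt))
  · exact hRW hR hW le_rfl
  · exact hown h₃ (by rw [h₁, h₂]; simp [Label.stage])
  · rw [ownTx_placed hj, ownTx_placed hi] at ht
    exact hRR hR hR' ht
  · exact hown h₁ (by rw [h₂, h₃]; simp [Label.stage])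

end Realisation

end Realisation

/-! ### Completeness -/

section Completeness

namespace Realisation

variable {Tid Loc Val : Type*} [Zero Val] [DecidableEq Loc]
  {H : ExecGraph Tid Loc Val} {tco : ℕ → ℕ → Prop} {tag : Tid × ℕ → ℕ}
  {T U : Tid × ℕ → List (Label Loc Val)} {At : Tid × ℕ → ℕ → Event Tid Loc Val → Prop}
  {src : Tid × ℕ → Loc → Option (Tid × ℕ)} {lo : Event Tid Loc Val → Event Tid Loc Val → Prop}

theorem implGraph_wf (h : Realisation H tco tag T At src U)
    (hlo : ∀ a b, lo a b → ExecGraph.RLO H tco (implGraph tco tag src U lo) (ownTx tag) a b)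
    (ht : ∀ a b d, lo a b → lo b d → lo a d) : (implGraph tco tag src U lo).WF := by
  refine build_wf h.buildable (fun a b hab => ?_) (fun a b hab => ?_)
    (fun a haa => h.locksOwned.rlo_irrefl a (hlo a a haa)) ht
  · obtain ⟨ha, hb, -⟩ := mem_of_rlo (hlo a b hab)
    exact ⟨ha, hb⟩
  · exact (mem_of_rlo (hlo a b hab)).2.2

/-- The graph of the implementation is RA-consistent for all transitive lock orders between the
generating edges `LO` and the total order `RLO`: all relations lead forward in time, and the edges
that the lock conditions ask for belong to `LO`. -/
theorem raConsistent (h : Realisation H tco tag T At src U)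
    (hlo : ∀ a b, lo a b → ExecGraph.RLO H tco (implGraph tco tag src U lo) (ownTx tag) a b)
    (hlo' : ∀ a b, ExecGraph.LO H tco (implGraph tco tag src U lo) (ownTx tag) a b → lo a b)
    (ht : ∀ a b d, lo a b → lo b d → lo a d) : (implGraph tco tag src U lo).RAConsistent := by
  have hL := h.locksOwned (lo := lo)
  have hwf := h.implGraph_wf hlo ht
  have trans : ∀ {a b d}, Earlier H (implGraph tco tag src U lo) tco tag a b →
      Earlier H (implGraph tco tag src U lo) tco tag b d →
      Earlier H (implGraph tco tag src U lo) tco tag a d := by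
    rintro a b d (h₁ | ⟨h₁, h₁'⟩) (h₂ | ⟨h₂, h₂'⟩)
    · exact .inl (h₁.trans h₂)
    · exact .inl (h₂ ▸ h₁)
    · exact .inl (h₁ ▸ h₂)
    · exact .inr ⟨h₁.trans h₂, hwf.po_trans _ _ _ h₁' h₂'⟩
  have hhb : ∀ {a b}, (implGraph tco tag src U lo).hb a b →
      Earlier H (implGraph tco tag src U lo) tco tag a b := by
    have step : ∀ {a b}, ((implGraph tco tag src U lo).po a b ∨
        (implGraph tco tag src U lo).rf a b ∨ lo a b) →
        Earlier H (implGraph tco tag src U lo) tco tag a b := by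
      rintro a b (hab | hab | hab)
      · exact h.po_earlier hab
      · exact h.rf_earlier hab
      · exact h.rlo_earlier (hlo a b hab)
    intro a b hab
    induction hab with
    | single hab => exact step hab
    | tail _ hbd ih => exact trans ih (step hbd)
  refine ⟨fun a hcyc => ?_, fun a ha b hb hla hlb hloc hne => ?_, fun a b hab hl => ?_,
    fun a b hab hl hlb => ?_⟩
  · suffices key : ∀ {b}, Relation.TransGen (fun a b =>
        ((implGraph tco tag src U lo).hb a b ∧ a.loc = b.loc) ∨
          (implGraph tco tag src U lo).mo a b ∨ (implGraph tco tag src U lo).rb a b) a b →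
        Earlier H (implGraph tco tag src U lo) tco tag a b by
      rcases key hcyc with hlt | ⟨-, hpo⟩
      · exact lt_irrefl _ hlt
      · exact hwf.po_irrefl _ hpo
    have step : ∀ {a b}, (((implGraph tco tag src U lo).hb a b ∧ a.loc = b.loc) ∨
        (implGraph tco tag src U lo).mo a b ∨ (implGraph tco tag src U lo).rb a b) →
        Earlier H (implGraph tco tag src U lo) tco tag a b := by
      rintro a b (⟨hab, -⟩ | hab | hab)
      · exact hhb hab
      · exact h.mo_earlier hab
      · exact h.rb_earlier hab
    intro b hab
    induction hab with
    | single hab => exact step hab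
    | tail _ hbd ih => exact trans ih (step hbd)
  · exact (hL.lo_total ha hb hla hlb hloc hne).imp (hlo' _ _) (hlo' _ _)
  · rcases hl with hl | hl
    · exact (hL.owner.wl a (mem_of_rlo (hlo a b hab)).1 _ hl).elim
    · obtain ⟨u, hu, hul, hpo, hub⟩ := hL.exists_release (hlo a b hab) hl
      exact ⟨u, hu, hul, hpo, hub.imp_right (hlo' _ _)⟩
  · obtain ⟨u, hu, hul, hpo, hub⟩ := hL.exists_release_or_promotion (hlo a b hab) hl hlb
    exact ⟨u, hu, hul, hpo, hub.imp_right (hlo' _ _)⟩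

end Realisation

variable {Tid Reg Loc Val : Type*} [Zero Val]

theorem Layout.finite_txs [Finite Tid] {H : ExecGraph Tid Loc Val} {tag : Tid × ℕ → ℕ}
    {bs : Tid → List (List (Label Loc Val))} {At : Tid × ℕ → ℕ → Event Tid Loc Val → Prop}
    (wf : H.WF) (lay : Layout H tag (blockOf bs) At) : H.txs.Finite := by
  have hfin : (⋃ τ : Tid, (fun k => tag (τ, k)) '' Set.Iio (bs τ).length).Finite :=
    Set.finite_iUnion fun τ => (Set.finite_Iio _).image _
  refine hfin.subset ?_
  rintro ξ ⟨h0, e, he, rfl⟩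
  obtain ⟨p, j, hj⟩ := lay.cover he fun ht => h0 (wf.init_lab e he ht).1
  obtain ⟨b, hb, -⟩ := getElem?_blockOf.1 (lay.lab hj)
  exact Set.mem_iUnion.2 ⟨p.1, p.2, (List.getElem?_eq_some_iff.1 hb).1, (lay.tx hj).symm⟩

variable [LinearOrder Loc] [DecidableEq Reg]

/-- Completeness of every implementation whose transactions can follow the transactions of the
program by a single successful attempt. -/
theorem completeness [Finite Tid]
    {f : Body Reg Loc Val → Finset Loc → Finset Loc → Com (LState Reg Loc Val) Loc Val}
    {P : Tid → Prog Reg Loc Val}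
    (hc : ∀ τ, (P τ).AllTx fun T rs ws => ∀ σ t σ', BRun T σ t σ' → ∀ m, Legal m t →
      ∀ s, s.regs = σ → ∃ u s', Run (f T rs ws) s u s' ∧ s'.regs = σ' ∧ ExactBlock m t u)
    {H : ExecGraph Tid Loc Val} {out : Tid → Reg → Val} (h : SIExec P H out)
    (hsi : H.SIConsistent) {tco : ℕ → ℕ → Prop} (hord : H.IsTCO tco) :
    Realised (fun τ => implement f (P τ)) H tco out := by
  obtain ⟨wf, ts, txid, h0, hinj, hrun, hth⟩ := h
  let tag : Tid × ℕ → ℕ := fun p => txid p.1 p.2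
  obtain ⟨At, lay⟩ := exists_layout (tag := tag) wf hth
  have hlay : TxLayout H tco tag (blockOf ts) At := by
    refine ⟨⟨wf, hsi, hord, lay.finite_txs wf, fun e he ht => ?_⟩, lay, fun p q hpq => ?_,
      fun p => h0 _ _, fun p l hl => ?_⟩
    · obtain ⟨p, j, hj⟩ := lay.cover he ht
      rw [lay.tx hj]
      exact h0 _ _
    · obtain ⟨h₁, h₂⟩ := hinj _ _ _ _ hpq
      exact Prod.ext h₁ h₂
    · obtain ⟨i, hi⟩ := List.mem_iff_getElem?.1 hl
      obtain ⟨b, hb, hbl⟩ := getElem?_blockOf.1 hi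
      exact (hrun p.1).labels b (List.mem_of_getElem? hb) l (List.mem_of_getElem? hbl)
  choose src hsrc using hlay.exists_src
  have hlegal := hlay.legal hsrc
  let ms : Tid → List (Loc → Val) := fun τ =>
    (List.range (ts τ).length).map fun k => extVal (blockOf ts) src (τ, k)
  have hms : ∀ τ, List.Forall₂ Legal (ms τ) (ts τ) := fun τ => by
    refine List.forall₂_iff_get.2 ⟨by simp [ms], fun k h₁ h₂ => ?_⟩
    have := hlegal (τ, k)
    simp only [List.get_eq_getElem, ms, List.getElem_map, List.getElem_range]
    rwa [blockOf, List.getD_eq_getElem _ _ h₂] at this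
  have hex := fun τ => implement_complete (hc τ) (hrun τ) (hms τ) LState.start rfl
  choose us fin hfin hreg hblk using hex
  have hR : Realisation H tco tag (blockOf ts) At src (blockOf us) := by
    refine ⟨hlay, hsrc, fun p => ?_⟩
    have hd := List.Forall₂.getD (a := (extVal (blockOf ts) src p, [])) (b := [])
      (exactBlock_nil _) (hblk p.1) p.2
    have hp : ((ms p.1).zip (ts p.1)).getD p.2 (extVal (blockOf ts) src p, []) =
        (extVal (blockOf ts) src p, blockOf ts p) := by
      by_cases hlt : p.2 < (ts p.1).length
      · rw [List.getD_eq_getElem _ _ (by simpa [ms] using hlt), blockOf,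
          List.getD_eq_getElem _ _ hlt]
        simp [ms]
      · rw [List.getD_eq_default _ _ (by simpa [ms] using hlt), blockOf,
          List.getD_eq_default _ _ (not_lt.1 hlt)]
    rw [hp] at hd
    exact hd
  -- the events and the ownership of locks, and hence the relations `LO` and `RLO`, do not depend on
  -- the lock order of the graph
  let lo₀ : Event Tid Loc Val → Event Tid Loc Val → Prop := fun _ _ => False
  let G := implGraph tco tag src (blockOf us) lo₀
  have hL : LocksOwned H tco G (ownTx tag) := hR.locksOwned
  have hexec : ∀ lo, (implGraph tco tag src (blockOf us) lo).WF →
      ImplExec (fun τ => implement f (P τ)) (implGraph tco tag src (blockOf us) lo) out := by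
    intro lo hwf
    refine ⟨hwf, fun τ => (us τ).flatten, fin, hfin, hreg, ?_⟩
    simp only [← taggedTraces_zero]
    exact build_hasThreads
  have hlo₁ : ∀ a b, Relation.TransGen (ExecGraph.LO H tco G (ownTx tag)) a b →
      ExecGraph.RLO H tco G (ownTx tag) a b := fun a b hab => hL.rlo_of_transGen_lo hab
  refine ⟨G, { G with lo := Relation.TransGen (ExecGraph.LO H tco G (ownTx tag)) },
    { G with lo := ExecGraph.RLO H tco G (ownTx tag) }, ownTx tag, hL.owner, rfl, rfl,
    hexec _ (hR.implGraph_wf hlo₁ fun _ _ _ => .trans),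
    hR.raConsistent hlo₁ (fun _ _ => .single) fun _ _ _ => .trans,
    hexec _ (hR.implGraph_wf (fun _ _ hab => hab) hL.rlo_trans),
    hR.raConsistent (fun _ _ hab => hab) (fun _ _ => .inl) hL.rlo_trans, ?_⟩
  exact fun a ha b hb hla hlb hloc hne => hL.rsync ha hb hla hlb hloc hne

end Completeness

end SnapIso

theorem mainTheorem2 {Tid Reg Loc Val : Type*} [Finite Tid] [Finite Loc] [LinearOrder Loc]
    [DecidableEq Reg] [Zero Val] (P : Tid → SnapIso.Prog Reg Loc Val) :
    -- both implementations have the outcomes of the SI model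
    ((∀ τ, (P τ).SetsExact) →
      SnapIso.RAOutcomes (SnapIso.eager P) = SnapIso.SIOutcomes P) ∧
    SnapIso.RAOutcomes (SnapIso.lazy P) = SnapIso.SIOutcomes P ∧
    -- soundness
    ((∀ τ, (P τ).SetsCover) → ∀ G out, SnapIso.ImplExec (SnapIso.eager P) G out →
      G.RAConsistent → ∃ H, SnapIso.SIExec P H out ∧ H.SIConsistent) ∧
    (∀ G out, SnapIso.ImplExec (SnapIso.lazy P) G out →
      G.RAConsistent → ∃ H, SnapIso.SIExec P H out ∧ H.SIConsistent) ∧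
    -- completeness
    (∀ H out, SnapIso.SIExec P H out → H.SIConsistent →
      (∃ tco, H.IsTCO tco) ∧
      ∀ tco, H.IsTCO tco →
        ((∀ τ, (P τ).SetsExact) → SnapIso.Realised (SnapIso.eager P) H tco out) ∧
        SnapIso.Realised (SnapIso.lazy P) H tco out) := by
  have sound_eager : (∀ τ, (P τ).SetsCover) → ∀ G out,
      SnapIso.ImplExec (SnapIso.eager P) G out → G.RAConsistent →
      ∃ H, SnapIso.SIExec P H out ∧ H.SIConsistent := fun hP G out h hra =>
    SnapIso.soundness (fun τ => (hP τ).imp fun T rs ws hc s u s' hr =>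
      SnapIso.eagerTx_sound hc hr) h hra
  have sound_lazy : ∀ G out, SnapIso.ImplExec (SnapIso.lazy P) G out → G.RAConsistent →
      ∃ H, SnapIso.SIExec P H out ∧ H.SIConsistent := fun G out h hra =>
    SnapIso.soundness (fun τ => SnapIso.Prog.allTx_of_forall fun T rs ws s u s' hr =>
      SnapIso.lazyTx_sound hr) h hra
  have complete_eager : (∀ τ, (P τ).SetsExact) → ∀ H out, SnapIso.SIExec P H out →
      H.SIConsistent → ∀ tco, H.IsTCO tco → SnapIso.Realised (SnapIso.eager P) H tco out :=
    fun hP H out h hsi tco htco =>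
      SnapIso.completeness (fun τ => (hP τ).imp fun T rs ws hc σ t σ' hr m hl s hs =>
        SnapIso.eagerTx_complete (hc σ t σ' hr) hr hl s hs) h hsi htco
  have complete_lazy : ∀ H out, SnapIso.SIExec P H out →
      H.SIConsistent → ∀ tco, H.IsTCO tco → SnapIso.Realised (SnapIso.lazy P) H tco out :=
    fun H out h hsi tco htco =>
      SnapIso.completeness (fun τ => SnapIso.Prog.allTx_of_forall fun T rs ws σ t σ' hr m hl s hs =>
        SnapIso.lazyTx_complete hr hl s hs) h hsi htco
  have outcomes_eq : ∀ C, (∀ G out, SnapIso.ImplExec C G out → G.RAConsistent →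
      ∃ H, SnapIso.SIExec P H out ∧ H.SIConsistent) → (∀ H out, SnapIso.SIExec P H out →
      H.SIConsistent → ∀ tco, H.IsTCO tco → SnapIso.Realised C H tco out) →
      SnapIso.RAOutcomes C = SnapIso.SIOutcomes P := by
    intro C hs hc
    ext out
    constructor
    · rintro ⟨G, h, hra⟩
      exact hs G out h hra
    · rintro ⟨H, h, hsi⟩
      obtain ⟨tco, htco⟩ := SnapIso.ExecGraph.exists_isTCO hsi
      obtain ⟨-, G₁, -, -, -, -, -, h₁, hra, -⟩ := hc H out h hsi tco htco
      exact ⟨G₁, h₁, hra⟩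
  refine ⟨fun hP => outcomes_eq _ (sound_eager fun τ => ?_) (complete_eager hP),
    outcomes_eq _ sound_lazy complete_lazy, sound_eager, sound_lazy,
    fun H out h hsi => ⟨SnapIso.ExecGraph.exists_isTCO hsi, fun tco htco =>
      ⟨fun hP => complete_eager hP H out h hsi tco htco, complete_lazy H out h hsi tco htco⟩⟩⟩
  exact (hP τ).imp fun T rs ws hc σ t σ' hr =>
    ⟨(hc σ t σ' hr).1, (hc σ t σ' hr).2.2.subset⟩
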